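/- \textbf{Notation.} Let $\eta_0:\mathbb R\to[0,1]$ be an even smooth function supported in $[-8/5,8/5]$ and equal to $1$ on $[-5/4,5/4]$. For $k\in\mathbb Z$ put $\chi_k(\xi)=\eta_0(|\xi|/2^k)-\eta_0(|\xi|/2^{k-1})$, and put $\eta_j=\chi_j$ for integers $j\ge1$. Let $I_k=\{\xi\in\mathbb R:\tfrac34 2^k\le|\xi|<\tfrac32 2^k\}$, $I_{\le0}=\bigcup_{j\le0}I_j$, and $\omega(\xi,\mu)=\xi^3+\mu^2/\xi$ for $\xi\ne0$. Let $\mathcal F$ denote the space-time Fourier transform on $\mathcal S'(\mathbb R^3)$, from $(x,y,t)$ to $(\xi,\mu,\tau)$, with kernel $e^{-i(x\xi+y\mu+t\tau)}$, and let $P_k$ be the operator $\mathcal F(P_ku)=\chi_k(\xi)\,\mathcal F u$. For measurable $g(\xi,\mu,\tau)$ put $$\|g\|_{X}=\sum_{j=0}^\infty 2^{j/2}\big\|\eta_j(\tau-\omega(\xi,\mu))\,g(\xi,\mu,\tau)\big\|_{L^2_{\xi,\mu,\tau}}\in[0,\infty],$$ and for an integer $k\ge0$ let $X_k$ be the space of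 those $g$ with $\|g\|_{X}<\infty$ that are supported (up to a null set) in $I_k\times\mathbb R^2$ (in $I_{\le0}\times\mathbb R^2$ if $k=0$). Put $$\|f\|_{F_k}=\sup_{t_k\in\mathbb R}\big\|\mathcal F[f\cdot\eta_0(2^k(t-t_k))]\big\|_{X},\qquad \|f\|_{N_k}=\sup_{t_k\in\mathbb R}\big\|(\tau-\omega(\xi,\mu)+i2^k)^{-1}\mathcal F[f\cdot\eta_0(2^k(t-t_k))]\big\|_{X}$$ (the quantity under the supremum being $\infty$ if the Fourier transform is not a function). Let $F_k$ be the space of functions $f:\mathbb R^3\to\mathbb C$ that define a tempered distribution (that is, $f$ is measurable and $\int_{\mathbb R^3}(1+|z|)^{-N}|f(z)|\,dz<\infty$ for some $N$), with $\mathcal F[f\cdot\eta_0(2^k(t-t_k))]\in X_k$ for every $t_k\in\mathbb R$ and $\|f\|_{F_k}<\infty$. \textbf{Proposition (dyadic bilinear estimate, high-low to high).} There is a constant $C>0$, depending only on $\eta_0$, such that for all integers $k_1,k_2,k_3$ with $k_3\ge20$, $|k_2-k_3|\le5$ and $0\le k_1\le k_2-10$, and for all $u_{k_1}\in F_{k_1}$,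 $v_{k_2}\in F_{k_2}$, the product $u_{k_1}v_{k_2}$ defines a tempered distribution in the above sense and $$\big\|P_{k_3}\partial_x(u_{k_1}v_{k_2})\big\|_{N_{k_3}}\le C\,(1+k_1)\,2^{-k_1/2}\,\|u_{k_1}\|_{F_{k_1}}\,\|v_{k_2}\|_{F_{k_2}}.$$ -/

import Mathlib

open MeasureTheory Set
open scoped ENNReal ContDiff SchwartzMap FourierTransform LineDeriv

noncomputable section

namespace KPI

/-- Space-time `ℝ³` with coordinates `(x, y, t) = (z 0, z 1, z 2)`; the same space carries the
dual variables `(ξ, μ, τ) = (ζ 0, ζ 1, ζ 2)`. -/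
abbrev E3 : Type := EuclideanSpace ℝ (Fin 3)

/-! ### Functions as tempered distributions -/

/-- `f` is measurable and integrable against some negative power of `1 + ‖z‖`, so that it defines a
tempered distribution by integration. -/
def IsTemperedFun (f : E3 → ℂ) : Prop :=
  AEStronglyMeasurable f volume ∧
    ∃ N : ℕ, Integrable (fun z : E3 => ((1 + ‖z‖) ^ N)⁻¹ * ‖f z‖) volume

theorem norm_schwartz_le (φ : 𝓢(E3, ℂ)) (N : ℕ) (z : E3) :
    ‖φ z‖ ≤ ((1 + ‖z‖) ^ N)⁻¹ *
      (2 ^ N * ((Finset.Iic ((N, 0) : ℕ × ℕ)).sup (schwartzSeminormFamily ℂ E3 ℂ)) φ) := by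
  rw [inv_mul_eq_div, le_div_iff₀' (by positivity)]
  simpa using! SchwartzMap.one_add_le_sup_seminorm_apply (𝕜 := ℂ) (m := (N, 0)) (k := N) (n := 0)
    le_rfl le_rfl φ z

theorem norm_schwartz_mul_le (φ : 𝓢(E3, ℂ)) (f : E3 → ℂ) (N : ℕ) (z : E3) :
    ‖φ z * f z‖ ≤
      (2 ^ N * ((Finset.Iic ((N, 0) : ℕ × ℕ)).sup (schwartzSeminormFamily ℂ E3 ℂ)) φ) *
        (((1 + ‖z‖) ^ N)⁻¹ * ‖f z‖) := by
  rw [norm_mul]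
  calc ‖φ z‖ * ‖f z‖ ≤ (((1 + ‖z‖) ^ N)⁻¹ *
      (2 ^ N * ((Finset.Iic ((N, 0) : ℕ × ℕ)).sup (schwartzSeminormFamily ℂ E3 ℂ)) φ)) * ‖f z‖ :=
        mul_le_mul_of_nonneg_right (norm_schwartz_le φ N z) (norm_nonneg _)
    _ = _ := by ring

theorem IsTemperedFun.integrable_mul {f : E3 → ℂ} (hf : IsTemperedFun f) (φ : 𝓢(E3, ℂ)) :
    Integrable (fun z => φ z * f z) volume := by
  obtain ⟨hm, N, hN⟩ := hf
  exact (hN.const_mul _).mono' (φ.continuous.aestronglyMeasurable.mul hm)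
    (Filter.Eventually.of_forall fun z => norm_schwartz_mul_le φ f N z)

/-- The continuous functional `φ ↦ ∫ φ f` on Schwartz space. -/
def pairingCLM (f : E3 → ℂ) (hf : IsTemperedFun f) : 𝓢(E3, ℂ) →L[ℂ] ℂ :=
  SchwartzMap.mkCLMtoNormedSpace (fun φ => ∫ z, φ z * f z)
    (fun φ ψ => by
      simp only [add_apply, add_mul]
      exact integral_add (hf.integrable_mul φ) (hf.integrable_mul ψ))
    (fun a φ => by
      simp only [smul_apply, smul_eq_mul, mul_assoc, RingHom.id_apply]
      exact integral_const_mul _ _)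
    (by
      obtain ⟨hm, N, hN⟩ := hf
      refine ⟨Finset.Iic (N, 0), 2 ^ N * ∫ z : E3, ((1 + ‖z‖) ^ N)⁻¹ * ‖f z‖, ?_, fun φ => ?_⟩
      · exact mul_nonneg (by positivity) (integral_nonneg fun z => by positivity)
      · refine (norm_integral_le_of_norm_le (hN.const_mul _)
          (Filter.Eventually.of_forall fun z => norm_schwartz_mul_le φ f N z)).trans ?_
        rw [integral_const_mul]
        exact le_of_eq (by ring))

open Classical in
/-- The tempered distribution `φ ↦ ∫ φ f` of a function `f` (and `0` if `f` does not satisfy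
`IsTemperedFun`). -/
def toTD (f : E3 → ℂ) : 𝓢'(E3, ℂ) :=
  if hf : IsTemperedFun f then
    ContinuousLinearMap.toPointwiseConvergenceCLM _ _ _ _ (pairingCLM f hf)
  else 0

theorem toTD_apply {f : E3 → ℂ} (hf : IsTemperedFun f) (φ : 𝓢(E3, ℂ)) :
    toTD f φ = ∫ z, φ z * f z := by
  rw [toTD, dif_pos hf]
  rfl

/-- `g` is the space-time Fourier transform of `T`, with the normalization
`∫ e^{-i(xξ + yμ + tτ)} f(x, y, t) dx dy dt`. Mathlib's `𝓕` has `e^{-2πi z·ζ}`, hence the dilation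
by `2π`. -/
def IsFourierOf (T : 𝓢'(E3, ℂ)) (g : E3 → ℂ) : Prop :=
  IsTemperedFun (fun ζ => g ((2 * Real.pi) • ζ)) ∧
    𝓕 T = toTD (fun ζ => g ((2 * Real.pi) • ζ))

/-! ### Cutoffs -/

/-- An even smooth function `ℝ → [0, 1]` supported in `[-8/5, 8/5]` and equal to `1` in
`[-5/4, 5/4]`. -/
structure IsCutoff (η₀ : ℝ → ℝ) : Prop where
  smooth : ContDiff ℝ ∞ η₀
  even : ∀ x, η₀ (-x) = η₀ x
  mem_Icc : ∀ x, η₀ x ∈ Icc (0 : ℝ) 1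
  support_subset : Function.support η₀ ⊆ Icc (-(8 / 5)) (8 / 5)
  eq_one : ∀ x ∈ Icc (-(5 / 4) : ℝ) (5 / 4), η₀ x = 1

/-- `χ_k(ξ) = η₀(|ξ| / 2^k) - η₀(|ξ| / 2^{k-1})`, `k ∈ ℤ`. -/
def chi (η₀ : ℝ → ℝ) (k : ℤ) (ξ : ℝ) : ℝ :=
  η₀ (|ξ| / (2 : ℝ) ^ k) - η₀ (|ξ| / (2 : ℝ) ^ (k - 1))

/-- The inhomogeneous decomposition of the modulation variable: `η_0` is the given bump and
`η_j = χ_j` for `j ≥ 1`. -/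
def etaJ (η₀ : ℝ → ℝ) (j : ℕ) (s : ℝ) : ℝ :=
  if j = 0 then η₀ s else chi η₀ j s

/-- `I_k = {ξ : |ξ| ∈ [(3/4) 2^k, (3/2) 2^k)}`, `k ∈ ℤ`. -/
def dyadicI (k : ℤ) : Set ℝ :=
  {ξ | |ξ| ∈ Ico (3 / 4 * (2 : ℝ) ^ k) (3 / 2 * (2 : ℝ) ^ k)}

/-- `I_k` for `k ≥ 1` and `I_{≤ 0} = ⋃_{j ≤ 0} I_j` for `k = 0`. -/
def freqSet (k : ℕ) : Set ℝ :=
  if k = 0 then ⋃ j ∈ {j : ℤ | j ≤ 0}, dyadicI j else dyadicI k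

/-- The dispersion relation `ω(ξ, μ) = ξ³ + μ² / ξ` (used for `ξ ≠ 0`, i.e. almost everywhere). -/
def omega (ξ μ : ℝ) : ℝ := ξ ^ 3 + μ ^ 2 / ξ

/-! ### The spaces `X_k`, `F_k`, `N_k` -/

/-- `∑_{j ≥ 0} 2^{j/2} ‖η_j(τ - ω(ξ, μ)) g(ξ, μ, τ)‖_{L²}`. -/
def normX (η₀ : ℝ → ℝ) (g : E3 → ℂ) : ℝ≥0∞ :=
  ∑' j : ℕ, ENNReal.ofReal ((2 : ℝ) ^ ((j : ℝ) / 2)) *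
    eLpNorm (fun ζ : E3 => (etaJ η₀ j (ζ 2 - omega (ζ 0) (ζ 1)) : ℂ) * g ζ) 2 volume

/-- `g ∈ X_k`: measurable, supported (a.e.) in `I_k × ℝ²` (`I_{≤ 0} × ℝ²` if `k = 0`), with finite
norm. -/
def MemX (η₀ : ℝ → ℝ) (k : ℕ) (g : E3 → ℂ) : Prop :=
  AEStronglyMeasurable g volume ∧ (∀ᵐ ζ : E3, ζ 0 ∉ freqSet k → g ζ = 0) ∧ normX η₀ g < ⊤

/-- The product `T · η₀(2^k (t - t₀))`. -/
def timeLoc (η₀ : ℝ → ℝ) (k : ℕ) (t₀ : ℝ) (T : 𝓢'(E3, ℂ)) : 𝓢'(E3, ℂ) :=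
  TemperedDistribution.smulLeftCLM ℂ (fun z : E3 => (η₀ ((2 : ℝ) ^ k * (z 2 - t₀)) : ℂ)) T

/-- `‖T‖_{F_k} = sup_{t₀} ‖F[T η₀(2^k (t - t₀))]‖_{X_k}`, where the inner norm is `∞` if the Fourier
transform is not a function. The infimum is over representatives of the Fourier transform, which
agree almost everywhere. -/
def normF (η₀ : ℝ → ℝ) (k : ℕ) (T : 𝓢'(E3, ℂ)) : ℝ≥0∞ :=
  ⨆ t₀ : ℝ, ⨅ (g : E3 → ℂ) (_ : IsFourierOf (timeLoc η₀ k t₀ T) g), normX η₀ g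

/-- `‖T‖_{N_k} = sup_{t₀} ‖(τ - ω(ξ, μ) + i 2^k)⁻¹ F[T η₀(2^k (t - t₀))]‖_{X_k}`, where the inner
norm is `∞` if the Fourier transform is not a function. -/
def normN (η₀ : ℝ → ℝ) (k : ℕ) (T : 𝓢'(E3, ℂ)) : ℝ≥0∞ :=
  ⨆ t₀ : ℝ, ⨅ (g : E3 → ℂ) (_ : IsFourierOf (timeLoc η₀ k t₀ T) g),
    normX η₀ (fun ζ : E3 =>
      (((ζ 2 - omega (ζ 0) (ζ 1) : ℝ) : ℂ) + Complex.I * (2 : ℂ) ^ k)⁻¹ * g ζ)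

/-- `u ∈ F_k`: all the time-localized Fourier transforms of `u` lie in `X_k`, with uniformly bounded
norms. -/
def MemF (η₀ : ℝ → ℝ) (k : ℕ) (u : E3 → ℂ) : Prop :=
  IsTemperedFun u ∧
    (∀ t₀ : ℝ, ∃ g : E3 → ℂ, IsFourierOf (timeLoc η₀ k t₀ (toTD u)) g ∧ MemX η₀ k g) ∧
    normF η₀ k (toTD u) < ⊤

/-! ### Operators in the `x` variable -/

/-- The Littlewood-Paley projection `P_k`: multiplication of the Fourier transform by `χ_k(ξ)`. In
Mathlib's normalization the frequency variable is `ξ / (2π)`. -/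
def proj (η₀ : ℝ → ℝ) (k : ℤ) (T : 𝓢'(E3, ℂ)) : 𝓢'(E3, ℂ) :=
  TemperedDistribution.fourierMultiplierCLM ℂ
    (fun ζ : E3 => (chi η₀ k (2 * Real.pi * ζ 0) : ℂ)) T

/-- The distributional derivative `∂_x`. -/
def dx (T : 𝓢'(E3, ℂ)) : 𝓢'(E3, ℂ) := ∂_{(EuclideanSpace.single 0 1 : E3)} T

/-! ### The symbols above have temperate growth -/

theorem IsCutoff.hasTemperateGrowth {η₀ : ℝ → ℝ} (h : IsCutoff η₀) : η₀.HasTemperateGrowth :=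
  (HasCompactSupport.of_support_subset_isCompact isCompact_Icc h.support_subset).hasTemperateGrowth
    h.smooth

theorem IsCutoff.timeSymbol_hasTemperateGrowth {η₀ : ℝ → ℝ} (h : IsCutoff η₀) (k : ℕ) (t₀ : ℝ) :
    (fun z : E3 => (η₀ ((2 : ℝ) ^ k * (z 2 - t₀)) : ℂ)).HasTemperateGrowth := by
  have h2 : (fun z : E3 => z 2).HasTemperateGrowth :=
    (EuclideanSpace.proj (𝕜 := ℝ) (2 : Fin 3)).hasTemperateGrowth
  have h1 : (fun z : E3 => (2 : ℝ) ^ k * (z 2 - t₀)).HasTemperateGrowth :=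
    (Function.HasTemperateGrowth.const _).mul (h2.sub (Function.HasTemperateGrowth.const _))
  exact Function.HasTemperateGrowth.comp Function.Complex.hasTemperateGrowth_ofReal (h.hasTemperateGrowth.comp h1)

theorem IsCutoff.projSymbol_hasTemperateGrowth {η₀ : ℝ → ℝ} (h : IsCutoff η₀) (k : ℤ) :
    (fun ζ : E3 => (chi η₀ k (2 * Real.pi * ζ 0) : ℂ)).HasTemperateGrowth := by
  have h0 : (fun z : E3 => z 0).HasTemperateGrowth :=
    (EuclideanSpace.proj (𝕜 := ℝ) (0 : Fin 3)).hasTemperateGrowth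
  have habs : ∀ (x c : ℝ), η₀ (|x| / c) = η₀ (c⁻¹ * x) := by
    intro x c
    rcases abs_choice x with hx | hx
    · rw [hx, div_eq_inv_mul]
    · rw [hx, neg_div, h.even, div_eq_inv_mul]
  have h1 : ∀ c : ℝ, (fun z : E3 => η₀ (c⁻¹ * (2 * Real.pi * z 0))).HasTemperateGrowth := fun c =>
    h.hasTemperateGrowth.comp ((Function.HasTemperateGrowth.const _).mul
      ((Function.HasTemperateGrowth.const _).mul h0))
  simp only [chi, habs]
  exact Function.HasTemperateGrowth.comp Function.Complex.hasTemperateGrowth_ofReal ((h1 _).sub (h1 _))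

end KPI

end

open MeasureTheory Set
open scoped ENNReal ContDiff SchwartzMap FourierTransform LineDeriv

noncomputable section

namespace KPI

/-! Write σ = τ - ω(ξ,μ) for the modulation. At output modulation 2^j the derivative costs 2^{k₃}
and the resolvent gains 2^{-max(j,k₃)}, so all j < k₃ can be merged with j = k₃
(`IsCutoff.normX_resolvent_le`). What remains is to sum, over j ≥ k₃, the quantities 2^{k₃-j/2} ‖f *
g‖_{L²(|σ| ≲ 2^j)}, where f lives at low frequency 2^{k₁} with modulation 2^{j₁} and g at high
frequency with modulation 2^{j₂}. The target is (1+k₁) 2^{-k₁/2} 2^{(j₁+j₂)/2} ‖f‖ ‖g‖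
(`tsum_l2_lconv_le`).

Three bounds for f * g enter, each a Cauchy-Schwarz argument reduced to the measure of an
intersection of supports. (a) Fixing the output point, the admissible low-frequency points have
measure about 2^{j₁+j₂+k₁-k₃} (`volume_omega_add_low_le`). For j ≥ k₃+2k₁ this sums geometrically to
the target. (b) If j₁ or j₂ is at least comparable to k₁+2k₃, that modulation is discarded. By
duality the counting moves to the output and the other factor. For positive frequencies the level
sets of ω(P₁)+ω(P-P₁) are images of circular annuli, whose area is bounded independently of the
frequencies (`volume_omega_add_pos_le`). (c) If all modulations are far below 2^{k₁+2k₃}, the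
interaction is resonant and the squared constant is about 2^{j₁+j₂+j-k₁-2k₃}
(`lconv_sq_le_resonant`). The cases (b) and (c) give the target for each single j, with no decay in
j; there are 2k₁ values of j between k₃ and k₃+2k₁, and this produces the factor 1+k₁.

The heart is (c). By `omega_sub_sub` the resonance function is ξ₁ξ₂ξ(3-p²), where |pξ| is the
difference of the slopes μ/ξ of the two factors; it vanishes on the two sheets p = ±√3. The
convolution is first split according to the sign of the slope difference. Expanding the square and
applying Cauchy-Schwarz (`lintegral_lconv_restrict_sq_le`) leaves, for fixed a in the low and b in
the high support, the measure of the z having both decompositions a+(z-a) and (z-b)+b. On a slice of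
constant modulation and in the variables (frequency, slope) of z, each decomposition confines z to a
neighbourhood of a line. Thanks to the sign splitting the two lines have slopes -√3 and +√3, so they
are uniformly transverse and the area is the product of the two widths
(`volume_resonance_plane_le`).

The passage from functions to their Fourier transforms uses the time scales. The output is cut to
length 2^{-k₃}; this cutoff is divided into 121 shorter pieces, on each of which suitable cutoffs of
u at scale 2^{-k₁} and of v at scale 2^{-k₂} equal one (`IsCutoff.timeCut_mul_eq_sum`). A piece
therefore has Fourier transform (κ *_τ û) * v̂, where κ has width 2^{k₃} in τ. This smearing is
harmless in the X norm once the modulations of û below 2^{k₃} are treated as one block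
(`tsum_l2_tlconv_le`). -/

/-! ### The `L²` norm of nonnegative functions -/

section L2

variable {α : Type*} [MeasurableSpace α] {μ : Measure α}

/-- The `L²` norm of a function with values in `[0, ∞]`. -/
def l2 (μ : Measure α) (f : α → ℝ≥0∞) : ℝ≥0∞ := (∫⁻ a, f a ^ 2 ∂μ) ^ (1 / 2 : ℝ)

theorem rpow_half_sq (x : ℝ≥0∞) : (x ^ (1 / 2 : ℝ)) ^ 2 = x := by
  rw [← ENNReal.rpow_natCast, ← ENNReal.rpow_mul]; norm_num

theorem sq_rpow_half (x : ℝ≥0∞) : (x ^ 2) ^ (1 / 2 : ℝ) = x := by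
  rw [← ENNReal.rpow_natCast, ← ENNReal.rpow_mul]; norm_num

theorem l2_sq (f : α → ℝ≥0∞) : l2 μ f ^ 2 = ∫⁻ a, f a ^ 2 ∂μ := rpow_half_sq _

theorem l2_le_of_sq_le {f : α → ℝ≥0∞} {B : ℝ≥0∞} (h : ∫⁻ a, f a ^ 2 ∂μ ≤ B ^ 2) : l2 μ f ≤ B := by
  rw [← sq_rpow_half B]
  exact ENNReal.rpow_le_rpow h (by norm_num)

theorem l2_mono {f g : α → ℝ≥0∞} (h : ∀ a, f a ≤ g a) : l2 μ f ≤ l2 μ g :=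
  ENNReal.rpow_le_rpow (lintegral_mono fun a => pow_le_pow_left' (h a) 2) (by norm_num)

theorem l2_mono_ae {f g : α → ℝ≥0∞} (h : ∀ᵐ a ∂μ, f a ≤ g a) : l2 μ f ≤ l2 μ g :=
  ENNReal.rpow_le_rpow (lintegral_mono_ae (h.mono fun a ha => pow_le_pow_left' ha 2)) (by norm_num)

theorem l2_zero : l2 μ (fun _ => 0) = 0 := by simp [l2]

theorem l2_const_mul (c : ℝ≥0∞) {f : α → ℝ≥0∞} (hf : Measurable f) :
    l2 μ (fun a => c * f a) = c * l2 μ f := by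
  unfold l2
  simp_rw [mul_pow]
  rw [lintegral_const_mul _ (hf.pow_const 2), ENNReal.mul_rpow_of_nonneg _ _ (by norm_num),
    sq_rpow_half]

theorem l2_add_le {f g : α → ℝ≥0∞} (hf : Measurable f) (hg : Measurable g) :
    l2 μ (fun a => f a + g a) ≤ l2 μ f + l2 μ g := by
  have := ENNReal.lintegral_Lp_add_le (μ := μ) (p := 2) hf.aemeasurable hg.aemeasurable (by norm_num)
  simpa only [ENNReal.rpow_ofNat, Pi.add_apply, l2] using this

theorem l2_finset_sum_le {ι : Type*} (s : Finset ι) {f : ι → α → ℝ≥0∞}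
    (hf : ∀ i, Measurable (f i)) :
    l2 μ (fun a => ∑ i ∈ s, f i a) ≤ ∑ i ∈ s, l2 μ (f i) := by
  classical
  induction s using Finset.induction_on with
  | empty => simp [l2_zero]
  | insert i s hi ih =>
    simp only [Finset.sum_insert hi]
    exact (l2_add_le (hf i) (Finset.measurable_sum _ fun i _ => hf i)).trans (add_le_add_right ih _)

theorem l2_tsum_le {f : ℕ → α → ℝ≥0∞} (hf : ∀ i, Measurable (f i)) :
    l2 μ (fun a => ∑' i, f i a) ≤ ∑' i, l2 μ (f i) := by
  refine l2_le_of_sq_le ?_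
  have h1 : ∀ a, (∑' i, f i a) ^ 2 = ⨆ n : ℕ, (∑ i ∈ Finset.range n, f i a) ^ 2 := by
    intro a
    have hm : Monotone fun n : ℕ => ∑ i ∈ Finset.range n, f i a := fun m n hmn =>
      Finset.sum_le_sum_of_subset (Finset.range_mono hmn)
    have ht : Filter.Tendsto (fun n : ℕ => ∑ i ∈ Finset.range n, f i a) Filter.atTop
        (nhds (∑' i, f i a)) := ENNReal.tendsto_nat_tsum _
    exact tendsto_nhds_unique ((ENNReal.continuous_pow 2).continuousAt.tendsto.comp ht)
      (tendsto_atTop_iSup fun m n hmn => pow_le_pow_left' (hm hmn) 2)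
  simp_rw [h1]
  rw [lintegral_iSup (fun n => (Finset.measurable_sum _ fun i _ => hf i).pow_const 2)]
  · refine iSup_le fun n => ?_
    rw [← l2_sq]
    exact pow_le_pow_left' ((l2_finset_sum_le _ hf).trans (ENNReal.sum_le_tsum _)) 2
  · intro m n hmn a
    exact pow_le_pow_left' (Finset.sum_le_sum_of_subset (Finset.range_mono hmn)) 2

theorem lintegral_mul_le_l2 {f g : α → ℝ≥0∞} (hf : Measurable f) (hg : Measurable g) :
    ∫⁻ a, f a * g a ∂μ ≤ l2 μ f * l2 μ g := by
  have := ENNReal.lintegral_mul_le_Lp_mul_Lq μ Real.HolderConjugate.two_two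
    hf.aemeasurable hg.aemeasurable
  simpa only [ENNReal.rpow_ofNat, Pi.mul_apply, l2] using this

theorem sq_lintegral_mul_le {f g : α → ℝ≥0∞} (hf : Measurable f) (hg : Measurable g) :
    (∫⁻ a, f a * g a ∂μ) ^ 2 ≤ (∫⁻ a, f a ^ 2 ∂μ) * ∫⁻ a, g a ^ 2 ∂μ := by
  rw [← l2_sq, ← l2_sq, ← mul_pow]
  exact pow_le_pow_left' (lintegral_mul_le_l2 hf hg) 2

theorem sq_lintegral_le {f : α → ℝ≥0∞} (hf : Measurable f) {s : Set α} (hs : MeasurableSet s)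
    (h : ∀ a, a ∉ s → f a = 0) : (∫⁻ a, f a ∂μ) ^ 2 ≤ μ s * ∫⁻ a, f a ^ 2 ∂μ := by
  have h1 : ∀ a, f a = s.indicator 1 a * f a := by
    intro a
    by_cases ha : a ∈ s
    · simp [ha]
    · simp [ha, h a ha]
  have h2 : ∫⁻ a, (s.indicator (1 : α → ℝ≥0∞) a) ^ 2 ∂μ = μ s := by
    rw [← lintegral_indicator_one hs]
    congr with a
    by_cases ha : a ∈ s <;> simp [ha]
  calc (∫⁻ a, f a ∂μ) ^ 2 = (∫⁻ a, s.indicator 1 a * f a ∂μ) ^ 2 := by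
        congr 1; exact lintegral_congr h1
    _ ≤ _ := (sq_lintegral_mul_le (measurable_one.indicator hs) hf).trans (by rw [h2])

theorem two_mul_le_sq_add_sq (a b : ℝ≥0∞) : 2 * (a * b) ≤ a ^ 2 + b ^ 2 := by
  rcases eq_or_ne a ⊤ with rfl | ha
  · simp
  rcases eq_or_ne b ⊤ with rfl | hb
  · simp
  lift a to NNReal using ha
  lift b to NNReal using hb
  norm_cast
  have := two_mul_le_add_sq a b
  rwa [mul_assoc] at this

end L2

/-! ### Convolution estimates by counting -/

section Conv

set_option linter.unusedSectionVars false

variable {G : Type*} [AddCommGroup G] [MeasurableSpace G] [MeasurableAdd₂ G] [MeasurableNeg G]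
  {μ : Measure G} [SFinite μ] [μ.IsAddLeftInvariant] [μ.IsNegInvariant]

/-- The convolution of functions with values in `[0, ∞]`. -/
def lconv (μ : Measure G) (f g : G → ℝ≥0∞) (z : G) : ℝ≥0∞ := ∫⁻ w, f w * g (z - w) ∂μ

theorem measurable_lconv {f g : G → ℝ≥0∞} (hf : Measurable f) (hg : Measurable g) :
    Measurable (lconv μ f g) := by
  apply Measurable.lintegral_prod_right' (f := fun p : G × G => f p.2 * g (p.1 - p.2))
  fun_prop

theorem lconv_comm (f g : G → ℝ≥0∞) (z : G) : lconv μ f g z = lconv μ g f z := by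
  unfold lconv
  rw [← lintegral_sub_left_eq_self _ z]
  simp [mul_comm]

/-- If the supports of `f` and `z - g` meet in measure at most `M` for `z ∈ E`, then
`‖f * g‖_{L²(E)}² ≤ M ‖f‖² ‖g‖²`. -/
theorem lintegral_lconv_sq_le {f g : G → ℝ≥0∞} (hf : Measurable f) (hg : Measurable g)
    {E : Set G} (hE : MeasurableSet E) {M : ℝ≥0∞}
    (hM : ∀ z ∈ E, μ {w | f w ≠ 0 ∧ g (z - w) ≠ 0} ≤ M) :
    ∫⁻ z in E, lconv μ f g z ^ 2 ∂μ ≤ M * ((∫⁻ z, f z ^ 2 ∂μ) * ∫⁻ z, g z ^ 2 ∂μ) := by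
  have hp : ∀ z ∈ E, lconv μ f g z ^ 2 ≤ M * ∫⁻ w, f w ^ 2 * g (z - w) ^ 2 ∂μ := by
    intro z hz
    have hs : MeasurableSet {w | f w ≠ 0 ∧ g (z - w) ≠ 0} :=
      (hf (measurableSet_singleton 0).compl).inter
        ((hg.comp (measurable_const.sub measurable_id)) (measurableSet_singleton 0).compl)
    refine (sq_lintegral_le (by fun_prop) hs ?_).trans ?_
    · intro w hw
      simp only [mem_ofPred_eq, not_and_or, not_not] at hw
      rcases hw with h | h <;> simp [h]
    · simp_rw [mul_pow]
      exact mul_le_mul_left (hM z hz) _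
  calc ∫⁻ z in E, lconv μ f g z ^ 2 ∂μ
      ≤ ∫⁻ z in E, M * ∫⁻ w, f w ^ 2 * g (z - w) ^ 2 ∂μ ∂μ := setLIntegral_mono' hE hp
    _ ≤ ∫⁻ z, M * ∫⁻ w, f w ^ 2 * g (z - w) ^ 2 ∂μ ∂μ := setLIntegral_le_lintegral _ _
    _ = M * ∫⁻ z, ∫⁻ w, f w ^ 2 * g (z - w) ^ 2 ∂μ ∂μ := by
      rw [lintegral_const_mul]
      apply Measurable.lintegral_prod_right' (f := fun p : G × G => f p.2 ^ 2 * g (p.1 - p.2) ^ 2)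
      fun_prop
    _ = M * ∫⁻ w, ∫⁻ z, f w ^ 2 * g (z - w) ^ 2 ∂μ ∂μ := by
      rw [lintegral_lintegral_swap]
      exact Measurable.aemeasurable (by fun_prop)
    _ = M * ∫⁻ w, f w ^ 2 * ∫⁻ z, g z ^ 2 ∂μ ∂μ := by
      congr 1
      refine lintegral_congr fun w => ?_
      rw [lintegral_const_mul _ (by fun_prop), lintegral_sub_right_eq_self (fun z => g z ^ 2) w]
    _ = _ := by rw [lintegral_mul_const _ (by fun_prop)]

/-- The correlation estimate: if the supports of `h` and of `z - g` meet in measure at most `M`,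
then `w ↦ ∫ g (z - w) h z dz` has square integral at most `M ‖g‖² ‖h‖²`. -/
theorem lintegral_correlation_sq_le {g h : G → ℝ≥0∞} (hg : Measurable g) (hh : Measurable h)
    {M : ℝ≥0∞} (hM : ∀ z, μ {w | h w ≠ 0 ∧ g (z - w) ≠ 0} ≤ M) :
    ∫⁻ w, (∫⁻ z, g (z - w) * h z ∂μ) ^ 2 ∂μ ≤
      M * ((∫⁻ z, g z ^ 2 ∂μ) * ∫⁻ z, h z ^ 2 ∂μ) := by
  have hSg : MeasurableSet {z | g z ≠ 0} := hg (measurableSet_singleton 0).compl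
  have hSh : MeasurableSet {z | h z ≠ 0} := hh (measurableSet_singleton 0).compl
  set ig : G → ℝ≥0∞ := {z | g z ≠ 0}.indicator 1 with hig
  set ih : G → ℝ≥0∞ := {z | h z ≠ 0}.indicator 1 with hih
  have hmg : Measurable ig := measurable_one.indicator hSg
  have hmh : Measurable ih := measurable_one.indicator hSh
  have eg : ∀ z, g z = g z * ig z := by
    intro z; by_cases hz : g z = 0 <;> simp [hig, hz]
  have eh : ∀ z, h z = h z * ih z := by
    intro z; by_cases hz : h z = 0 <;> simp [hih, hz]
  have ig2 : ∀ z, ig z ^ 2 = ig z := by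
    intro z; by_cases hz : g z = 0 <;> simp [hig, hz]
  have ih2 : ∀ z, ih z ^ 2 = ih z := by
    intro z; by_cases hz : h z = 0 <;> simp [hih, hz]
  -- The squared correlation integrates g(z-w)h(z)g(z'-w)h(z'). Regrouped as `A w z z' * A w z' z`,
  -- with each factor keeping the indicators of the supports it gave away, it is bounded by ∫∫ A²
  -- using 2xy ≤ x²+y² and the symmetry in z, z'. With a = z-w, the surviving indicators restrict z
  -- to `h z ≠ 0` and `g (z' + a - z) ≠ 0`, a condition of sum type although the correlation is of
  -- difference type.
  set A : G → G → G → ℝ≥0∞ := fun w z z' => g (z - w) * h z' * ig (z' - w) * ih z with hA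
  have hAm : Measurable fun p : G × G × G => A p.1 p.2.1 p.2.2 := by
    simp only [hA]; fun_prop
  have key : ∀ w, 2 * (∫⁻ z, g (z - w) * h z ∂μ) ^ 2 ≤
      2 * ∫⁻ z, ∫⁻ z', A w z z' ^ 2 ∂μ ∂μ := by
    intro w
    have e1 : (∫⁻ z, g (z - w) * h z ∂μ) ^ 2 =
        ∫⁻ z, ∫⁻ z', A w z z' * A w z' z ∂μ ∂μ := by
      rw [sq, ← lintegral_mul_const _ (by fun_prop)]
      refine lintegral_congr fun z => ?_
      rw [← lintegral_const_mul _ (by fun_prop)]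
      refine lintegral_congr fun z' => ?_
      simp only [hA]
      calc g (z - w) * h z * (g (z' - w) * h z')
          = (g (z - w) * ig (z - w)) * (h z * ih z) *
            ((g (z' - w) * ig (z' - w)) * (h z' * ih z')) := by simp only [← eg, ← eh]
        _ = _ := by ring
    have m1 : ∀ z, Measurable fun z' => A w z z' := fun z => by simp only [hA]; fun_prop
    have m2 : ∀ z, Measurable fun z' => A w z' z := fun z => by simp only [hA]; fun_prop
    have m3 : Measurable fun p : G × G => A w p.1 p.2 := by simp only [hA]; fun_prop
    have m4 : Measurable fun p : G × G => A w p.2 p.1 := by simp only [hA]; fun_prop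
    rw [e1, ← lintegral_const_mul _ (Measurable.lintegral_prod_right'
      (f := fun p : G × G => A w p.1 p.2 * A w p.2 p.1) (m3.mul m4))]
    calc ∫⁻ z, 2 * ∫⁻ z', A w z z' * A w z' z ∂μ ∂μ
        ≤ ∫⁻ z, ((∫⁻ z', A w z z' ^ 2 ∂μ) + ∫⁻ z', A w z' z ^ 2 ∂μ) ∂μ := by
          refine lintegral_mono fun z => ?_
          rw [← lintegral_const_mul _ (show Measurable fun z' => A w z z' * A w z' z from (m1 z).mul (m2 z)),
            ← lintegral_add_left ((m1 z).pow_const 2)]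
          exact lintegral_mono fun z' => two_mul_le_sq_add_sq _ _
      _ = (∫⁻ z, ∫⁻ z', A w z z' ^ 2 ∂μ ∂μ) + ∫⁻ z, ∫⁻ z', A w z' z ^ 2 ∂μ ∂μ :=
          lintegral_add_left (Measurable.lintegral_prod_right'
            (f := fun p : G × G => A w p.1 p.2 ^ 2) (m3.pow_const 2)) _
      _ = _ := by
          rw [lintegral_lintegral_swap (f := fun z z' => A w z' z ^ 2)
            (m4.pow_const 2).aemeasurable, two_mul]
  have key' : ∀ w, (∫⁻ z, g (z - w) * h z ∂μ) ^ 2 ≤ ∫⁻ z, ∫⁻ z', A w z z' ^ 2 ∂μ ∂μ := fun w =>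
    (ENNReal.mul_le_mul_iff_right (by norm_num) (by norm_num)).1 (key w)
  calc ∫⁻ w, (∫⁻ z, g (z - w) * h z ∂μ) ^ 2 ∂μ
      ≤ ∫⁻ w, ∫⁻ z, ∫⁻ z', A w z z' ^ 2 ∂μ ∂μ ∂μ := lintegral_mono key'
    _ = ∫⁻ z, ∫⁻ w, ∫⁻ z', A w z z' ^ 2 ∂μ ∂μ ∂μ := by
      rw [lintegral_lintegral_swap]
      apply Measurable.aemeasurable
      apply Measurable.lintegral_prod_right'
        (f := fun p : (G × G) × G => A p.1.1 p.1.2 p.2 ^ 2)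
      simp only [hA]; fun_prop
    _ = ∫⁻ z, ∫⁻ a, ∫⁻ z', A (z - a) z z' ^ 2 ∂μ ∂μ ∂μ := by
      refine lintegral_congr fun z => ?_
      rw [← lintegral_sub_left_eq_self _ z]
    _ = ∫⁻ a, ∫⁻ z, ∫⁻ z', A (z - a) z z' ^ 2 ∂μ ∂μ ∂μ := by
      rw [lintegral_lintegral_swap]
      apply Measurable.aemeasurable
      apply Measurable.lintegral_prod_right'
        (f := fun p : (G × G) × G => A (p.1.1 - p.1.2) p.1.1 p.2 ^ 2)
      simp only [hA]; fun_prop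
    _ = ∫⁻ a, ∫⁻ z', ∫⁻ z, A (z - a) z z' ^ 2 ∂μ ∂μ ∂μ := by
      refine lintegral_congr fun a => ?_
      rw [lintegral_lintegral_swap]
      apply Measurable.aemeasurable
      simp only [hA]; fun_prop
    _ ≤ ∫⁻ a, ∫⁻ z', g a ^ 2 * h z' ^ 2 * M ∂μ ∂μ := by
      refine lintegral_mono fun a => lintegral_mono fun z' => ?_
      have hs : MeasurableSet {w | h w ≠ 0 ∧ g (z' + a - w) ≠ 0} :=
        hSh.inter ((measurable_const.sub measurable_id) hSg)
      calc ∫⁻ z, A (z - a) z z' ^ 2 ∂μ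
          = ∫⁻ z, g a ^ 2 * h z' ^ 2 *
              {w | h w ≠ 0 ∧ g (z' + a - w) ≠ 0}.indicator 1 z ∂μ := by
            refine lintegral_congr fun z => ?_
            have hind : ({w | h w ≠ 0 ∧ g (z' + a - w) ≠ 0}.indicator 1 z : ℝ≥0∞) =
                ig (z' + a - z) * ih z := by
              by_cases h1 : h z = 0 <;> by_cases h2 : g (z' + a - z) = 0 <;>
                simp [hig, hih, h1, h2]
            rw [hind]
            simp only [hA, mul_pow, ig2, ih2]
            rw [sub_sub_cancel, show z' - (z - a) = z' + a - z by abel]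
            ring
        _ = g a ^ 2 * h z' ^ 2 * μ {w | h w ≠ 0 ∧ g (z' + a - w) ≠ 0} := by
            rw [lintegral_const_mul _ (measurable_one.indicator hs), lintegral_indicator_one hs]
        _ ≤ _ := mul_le_mul_right (hM _) _
    _ = _ := by
      have : ∀ a, ∫⁻ z', g a ^ 2 * h z' ^ 2 * M ∂μ = g a ^ 2 * ((∫⁻ z', h z' ^ 2 ∂μ) * M) := by
        intro a
        simp_rw [mul_assoc]
        rw [lintegral_const_mul _ (by fun_prop), lintegral_mul_const _ (by fun_prop)]
      simp_rw [this]
      rw [lintegral_mul_const _ (by fun_prop)]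
      ring

/-- Transfer of the correlation estimate to the convolution by duality. -/
theorem lintegral_lconv_sq_le_of_correlation {f g : G → ℝ≥0∞} (hf : Measurable f)
    (hg : Measurable g) {E : Set G} (hE : MeasurableSet E) {M : ℝ≥0∞}
    (hfin : ∫⁻ z in E, lconv μ f g z ^ 2 ∂μ ≠ ⊤)
    (hM : ∀ h : G → ℝ≥0∞, Measurable h → (∀ z, z ∉ E → h z = 0) →
      ∫⁻ w, (∫⁻ z, g (z - w) * h z ∂μ) ^ 2 ∂μ ≤
        M * ((∫⁻ z, g z ^ 2 ∂μ) * ∫⁻ z, h z ^ 2 ∂μ)) :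
    ∫⁻ z in E, lconv μ f g z ^ 2 ∂μ ≤ M * ((∫⁻ z, f z ^ 2 ∂μ) * ∫⁻ z, g z ^ 2 ∂μ) := by
  set h : G → ℝ≥0∞ := E.indicator (lconv μ f g) with hh
  have hmh : Measurable h := (measurable_lconv hf hg).indicator hE
  set I := ∫⁻ z in E, lconv μ f g z ^ 2 ∂μ with hI
  have e0 : ∫⁻ z, h z ^ 2 ∂μ = I := by
    rw [hI, ← lintegral_indicator hE]
    refine lintegral_congr fun z => ?_
    by_cases hz : z ∈ E <;> simp [hh, hz]
  have e1 : I = ∫⁻ w, f w * ∫⁻ z, g (z - w) * h z ∂μ ∂μ := by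
    rw [← e0]
    calc ∫⁻ z, h z ^ 2 ∂μ = ∫⁻ z, ∫⁻ w, f w * g (z - w) * h z ∂μ ∂μ := by
          refine lintegral_congr fun z => ?_
          rw [lintegral_mul_const _ (by fun_prop)]
          by_cases hz : z ∈ E
          · simp [hh, hz, lconv, sq]
          · simp [hh, hz]
      _ = ∫⁻ w, ∫⁻ z, f w * g (z - w) * h z ∂μ ∂μ := by
          rw [lintegral_lintegral_swap]
          exact Measurable.aemeasurable (by fun_prop)
      _ = _ := by
          refine lintegral_congr fun w => ?_
          simp_rw [mul_assoc]
          rw [lintegral_const_mul _ (by fun_prop)]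
  have hc : Measurable fun w => ∫⁻ z, g (z - w) * h z ∂μ := by
    apply Measurable.lintegral_prod_right' (f := fun p : G × G => g (p.2 - p.1) * h p.2)
    fun_prop
  have e2 : I ^ 2 ≤ (M * ((∫⁻ z, f z ^ 2 ∂μ) * ∫⁻ z, g z ^ 2 ∂μ)) * I := by
    calc I ^ 2 ≤ (∫⁻ z, f z ^ 2 ∂μ) * ∫⁻ w, (∫⁻ z, g (z - w) * h z ∂μ) ^ 2 ∂μ := by
          conv_lhs => rw [e1]
          exact sq_lintegral_mul_le hf hc
      _ ≤ (∫⁻ z, f z ^ 2 ∂μ) * (M * ((∫⁻ z, g z ^ 2 ∂μ) * I)) := by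
          rw [← e0]
          exact mul_le_mul_right (hM h hmh fun z hz => by simp [hh, hz]) _
      _ = _ := by ring
  -- The inequality I² ≤ K·I is divided by I; this is where finiteness of I is indispensable.
  rcases eq_or_ne I 0 with h0 | h0
  · rw [h0]; exact zero_le
  · rw [sq] at e2
    exact (ENNReal.mul_le_mul_iff_left h0 hfin).1 e2

/-- The trilinear counting estimate: a bilinear form restricted to a relation `R` is bounded on `L²`
if for all `a` and `b` the set of `z ∈ E` with `(a, z - a)` and `(z - b, b)` in the support of the
form is small. -/
theorem lintegral_lconv_restrict_sq_le {f g : G → ℝ≥0∞} (hf : Measurable f) (hg : Measurable g)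
    {R : Set (G × G)} (hR : MeasurableSet R) {E : Set G} (hE : MeasurableSet E) {M : ℝ≥0∞}
    (hM : ∀ a b, f a ≠ 0 → g b ≠ 0 →
      μ {z | z ∈ E ∧ g (z - a) ≠ 0 ∧ f (z - b) ≠ 0 ∧ (a, z - a) ∈ R ∧ (z - b, b) ∈ R} ≤ M) :
    ∫⁻ z in E, (∫⁻ w, f w * g (z - w) * R.indicator 1 (w, z - w) ∂μ) ^ 2 ∂μ ≤
      M * ((∫⁻ z, f z ^ 2 ∂μ) * ∫⁻ z, g z ^ 2 ∂μ) := by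
  have hSf : MeasurableSet {z | f z ≠ 0} := hf (measurableSet_singleton 0).compl
  have hSg : MeasurableSet {z | g z ≠ 0} := hg (measurableSet_singleton 0).compl
  set jf : G → ℝ≥0∞ := {z | f z ≠ 0}.indicator 1 with hjf
  set jg : G → ℝ≥0∞ := {z | g z ≠ 0}.indicator 1 with hjg
  set jE : G → ℝ≥0∞ := E.indicator 1 with hjE
  set jR : G × G → ℝ≥0∞ := R.indicator 1 with hjR
  have mf : Measurable jf := measurable_one.indicator hSf
  have mg : Measurable jg := measurable_one.indicator hSg
  have mE : Measurable jE := measurable_one.indicator hE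
  have mR : Measurable jR := measurable_one.indicator hR
  have ef : ∀ z, f z = f z * jf z := by
    intro z; by_cases hz : f z = 0 <;> simp [hjf, hz]
  have eg : ∀ z, g z = g z * jg z := by
    intro z; by_cases hz : g z = 0 <;> simp [hjg, hz]
  have if2 : ∀ z, jf z ^ 2 = jf z := by
    intro z; by_cases hz : f z = 0 <;> simp [hjf, hz]
  have ig2 : ∀ z, jg z ^ 2 = jg z := by
    intro z; by_cases hz : g z = 0 <;> simp [hjg, hz]
  have iE2 : ∀ z, jE z ^ 2 = jE z := by
    intro z; by_cases hz : z ∈ E <;> simp [hjE, hz]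
  have iR2 : ∀ z, jR z ^ 2 = jR z := by
    intro z; by_cases hz : z ∈ R <;> simp [hjR, hz]
  -- One copy of the form is parametrized by the argument a of f, the other by the argument b of g.
  -- The integrand f(a)g(z-a)f(z-b)g(b) pairs f(a)g(b) with its image under the involution (a,b) ↦
  -- (z-b,z-a), which preserves the measure. After Cauchy-Schwarz the variable z occurs only in
  -- indicators and is integrated first.
  set A : G → G → G → ℝ≥0∞ := fun z a b => f a * g b *
    (jE z * jg (z - a) * jf (z - b) * jR (a, z - a) * jR (z - b, b)) with hA
  have mA : Measurable fun p : G × G × G => A p.1 p.2.1 p.2.2 := by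
    simp only [hA]; fun_prop
  have key : ∀ z, 2 * (jE z * (∫⁻ w, f w * g (z - w) * jR (w, z - w) ∂μ) ^ 2) ≤
      2 * ∫⁻ a, ∫⁻ b, A z a b ^ 2 ∂μ ∂μ := by
    intro z
    have m1 : Measurable fun p : G × G => A z p.1 p.2 := by simp only [hA]; fun_prop
    have m2 : Measurable fun p : G × G => A z (z - p.2) (z - p.1) := by simp only [hA]; fun_prop
    have m1' : ∀ a, Measurable fun b => A z a b := fun a => by simp only [hA]; fun_prop
    have m2' : ∀ a, Measurable fun b => A z (z - b) (z - a) := fun a => by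
      simp only [hA]; fun_prop
    have e1 : jE z * (∫⁻ w, f w * g (z - w) * jR (w, z - w) ∂μ) ^ 2 =
        ∫⁻ a, ∫⁻ b, A z a b * A z (z - b) (z - a) ∂μ ∂μ := by
      have e2 : ∫⁻ w, f w * g (z - w) * jR (w, z - w) ∂μ =
          ∫⁻ b, f (z - b) * g b * jR (z - b, b) ∂μ := by
        rw [← lintegral_sub_left_eq_self _ z]; simp
      conv_lhs => rw [sq]; enter [2, 2]; rw [e2]
      rw [← lintegral_mul_const _ (by fun_prop), ← lintegral_const_mul _ (by fun_prop)]
      refine lintegral_congr fun a => ?_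
      rw [← lintegral_const_mul _ (by fun_prop), ← lintegral_const_mul _ (by fun_prop)]
      refine lintegral_congr fun b => ?_
      simp only [hA, sub_sub_cancel]
      calc jE z * (f a * g (z - a) * jR (a, z - a) * (f (z - b) * g b * jR (z - b, b)))
          = jE z ^ 2 * ((f a * jf a) * (g (z - a) * jg (z - a)) * jR (a, z - a) ^ 2 *
              ((f (z - b) * jf (z - b)) * (g b * jg b) * jR (z - b, b) ^ 2)) := by
            simp only [← ef, ← eg, iE2, iR2]
        _ = _ := by ring
    rw [e1, ← lintegral_const_mul _ (Measurable.lintegral_prod_right'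
      (f := fun p : G × G => A z p.1 p.2 * A z (z - p.2) (z - p.1)) (m1.mul m2))]
    calc ∫⁻ a, 2 * ∫⁻ b, A z a b * A z (z - b) (z - a) ∂μ ∂μ
        ≤ ∫⁻ a, ((∫⁻ b, A z a b ^ 2 ∂μ) + ∫⁻ b, A z (z - b) (z - a) ^ 2 ∂μ) ∂μ := by
          refine lintegral_mono fun a => ?_
          rw [← lintegral_const_mul _ (show Measurable fun b => A z a b * A z (z - b) (z - a) from
            (m1' a).mul (m2' a)),
            ← lintegral_add_left ((m1' a).pow_const 2)]
          exact lintegral_mono fun b => two_mul_le_sq_add_sq _ _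
      _ = (∫⁻ a, ∫⁻ b, A z a b ^ 2 ∂μ ∂μ) + ∫⁻ a, ∫⁻ b, A z (z - b) (z - a) ^ 2 ∂μ ∂μ :=
          lintegral_add_left (Measurable.lintegral_prod_right'
            (f := fun p : G × G => A z p.1 p.2 ^ 2) (m1.pow_const 2)) _
      _ = _ := by
          have : ∫⁻ a, ∫⁻ b, A z (z - b) (z - a) ^ 2 ∂μ ∂μ = ∫⁻ a, ∫⁻ b, A z a b ^ 2 ∂μ ∂μ := by
            rw [lintegral_sub_left_eq_self (fun a => ∫⁻ b, A z (z - b) a ^ 2 ∂μ) z]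
            have : ∀ a, ∫⁻ b, A z (z - b) a ^ 2 ∂μ = ∫⁻ b, A z b a ^ 2 ∂μ := fun a =>
              lintegral_sub_left_eq_self (fun b => A z b a ^ 2) z
            simp_rw [this]
            rw [lintegral_lintegral_swap]
            exact Measurable.aemeasurable (by simp only [hA]; fun_prop)
          rw [this, two_mul]
  have key' : ∀ z, jE z * (∫⁻ w, f w * g (z - w) * jR (w, z - w) ∂μ) ^ 2 ≤
      ∫⁻ a, ∫⁻ b, A z a b ^ 2 ∂μ ∂μ := fun z =>
    (ENNReal.mul_le_mul_iff_right (by norm_num) (by norm_num)).1 (key z)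
  calc ∫⁻ z in E, (∫⁻ w, f w * g (z - w) * jR (w, z - w) ∂μ) ^ 2 ∂μ
      = ∫⁻ z, jE z * (∫⁻ w, f w * g (z - w) * jR (w, z - w) ∂μ) ^ 2 ∂μ := by
        rw [← lintegral_indicator hE]
        refine lintegral_congr fun z => ?_
        by_cases hz : z ∈ E <;> simp [hjE, hz]
    _ ≤ ∫⁻ z, ∫⁻ a, ∫⁻ b, A z a b ^ 2 ∂μ ∂μ ∂μ := lintegral_mono key'
    _ = ∫⁻ a, ∫⁻ z, ∫⁻ b, A z a b ^ 2 ∂μ ∂μ ∂μ := by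
      rw [lintegral_lintegral_swap]
      apply Measurable.aemeasurable
      apply Measurable.lintegral_prod_right'
        (f := fun p : (G × G) × G => A p.1.1 p.1.2 p.2 ^ 2)
      simp only [hA]; fun_prop
    _ = ∫⁻ a, ∫⁻ b, ∫⁻ z, A z a b ^ 2 ∂μ ∂μ ∂μ := by
      refine lintegral_congr fun a => ?_
      rw [lintegral_lintegral_swap]
      apply Measurable.aemeasurable
      simp only [hA]; fun_prop
    _ ≤ ∫⁻ a, ∫⁻ b, f a ^ 2 * g b ^ 2 * M ∂μ ∂μ := by
      refine lintegral_mono fun a => lintegral_mono fun b => ?_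
      by_cases ha : f a = 0
      · simp [hA, ha]
      by_cases hb : g b = 0
      · simp [hA, hb]
      set S : Set G := {z | z ∈ E ∧ g (z - a) ≠ 0 ∧ f (z - b) ≠ 0 ∧ (a, z - a) ∈ R ∧ (z - b, b) ∈ R}
        with hS
      have hs : MeasurableSet S := by
        refine hE.inter (((measurable_id.sub_const a) hSg).inter
          (((measurable_id.sub_const b) hSf).inter (MeasurableSet.inter ?_ ?_)))
        · exact (measurable_const.prodMk (measurable_id.sub_const a)) hR
        · exact ((measurable_id.sub_const b).prodMk measurable_const) hR
      calc ∫⁻ z, A z a b ^ 2 ∂μ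
          = ∫⁻ z, f a ^ 2 * g b ^ 2 * S.indicator 1 z ∂μ := by
            refine lintegral_congr fun z => ?_
            have hind : (S.indicator 1 z : ℝ≥0∞) =
                jE z * jg (z - a) * jf (z - b) * jR (a, z - a) * jR (z - b, b) := by
              by_cases h1 : z ∈ E <;> by_cases h2 : g (z - a) = 0 <;>
                by_cases h3 : f (z - b) = 0 <;> by_cases h4 : (a, z - a) ∈ R <;>
                by_cases h5 : (z - b, b) ∈ R <;>
                simp [hjE, hjf, hjg, hjR, hS, h1, h2, h3, h4, h5]
            rw [hind]
            simp only [hA, mul_pow, if2, ig2, iE2, iR2]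
        _ = f a ^ 2 * g b ^ 2 * μ S := by
            rw [lintegral_const_mul _ (measurable_one.indicator hs), lintegral_indicator_one hs]
        _ ≤ _ := mul_le_mul_right (hM a b ha hb) _
    _ = _ := by
      have : ∀ a, ∫⁻ b, f a ^ 2 * g b ^ 2 * M ∂μ = f a ^ 2 * ((∫⁻ b, g b ^ 2 ∂μ) * M) := by
        intro a
        simp_rw [mul_assoc]
        rw [lintegral_const_mul _ (by fun_prop), lintegral_mul_const _ (by fun_prop)]
      simp_rw [this]
      rw [lintegral_mul_const _ (by fun_prop)]
      ring

end Conv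

/-! ### Measures of planar sets -/

theorem measurableSet_and {α : Type*} [MeasurableSpace α] {p q : α → Prop}
    (hp : MeasurableSet {a | p a}) (hq : MeasurableSet {a | q a}) :
    MeasurableSet {a | p a ∧ q a} := hp.inter hq

theorem volume_le_of_abs_sub_le {T : Set ℝ} {d : ℝ} (h : ∀ a ∈ T, ∀ b ∈ T, |a - b| ≤ d) :
    volume T ≤ ENNReal.ofReal d := by
  refine (Real.volume_le_diam T).trans (Metric.ediam_le fun a ha b hb => ?_)
  rw [edist_dist, Real.dist_eq]
  exact ENNReal.ofReal_le_ofReal (h a ha b hb)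

theorem volume_le_mul_of_fiber {A S : Set (ℝ × ℝ)} (hA : MeasurableSet A) (hS : MeasurableSet S)
    {K : ℝ≥0∞} (h : ∀ᵐ x : ℝ, volume (Prod.mk x ⁻¹' A) ≤ K * volume (Prod.mk x ⁻¹' S)) :
    volume A ≤ K * volume S := by
  rw [Measure.volume_eq_prod, Measure.prod_apply hA, Measure.prod_apply hS,
    ← lintegral_const_mul _ (measurable_measure_prodMk_left hS)]
  exact lintegral_mono_ae h

theorem volume_affine_preimage {κ : ℝ} (hκ : 0 < κ) (s : ℝ) (T : Set ℝ) :
    volume {y : ℝ | (y - s) / κ ∈ T} = ENNReal.ofReal κ * volume T := by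
  have : {y : ℝ | (y - s) / κ ∈ T} = (fun y => y + -s) ⁻¹' ((fun y => y * κ⁻¹) ⁻¹' T) := by
    ext y; simp [div_eq_mul_inv, sub_eq_add_neg]
  rw [this, measure_preimage_add_right, Real.volume_preimage_mul_right (inv_ne_zero hκ.ne'), inv_inv,
    abs_of_pos hκ]

/-- The inverse of Φ on its image is L-Lipschitz, and on ℝ×ℝ with the sup metric the two-dimensional
Hausdorff measure is Lebesgue measure. This replaces a change of variables and needs neither
differentiability of Φ nor measurability of S. -/
theorem volume_le_of_antilipschitz {S B : Set (ℝ × ℝ)} {Φ : ℝ × ℝ → ℝ × ℝ} {L : NNReal}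
    (h : ∀ z ∈ S, ∀ z' ∈ S, dist z z' ≤ L * dist (Φ z) (Φ z')) (hB : MapsTo Φ S B) :
    volume S ≤ (L : ℝ≥0∞) ^ 2 * volume B := by
  classical
  have hinj : InjOn Φ S := by
    intro z hz z' hz' he
    have := h z hz z' hz'
    rw [he, dist_self, mul_zero] at this
    exact dist_le_zero.1 this
  have hl : LipschitzOnWith L (Function.invFunOn Φ S) (Φ '' S) := by
    refine LipschitzOnWith.of_dist_le_mul ?_
    rintro _ ⟨z, hz, rfl⟩ _ ⟨z', hz', rfl⟩
    rw [hinj.leftInvOn_invFunOn hz, hinj.leftInvOn_invFunOn hz']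
    exact h z hz z' hz'
  have := hl.hausdorffMeasure_image_le (d := 2) (by norm_num)
  rw [hinj.leftInvOn_invFunOn.image_image, hausdorffMeasure_prod_real, ENNReal.rpow_ofNat] at this
  exact this.trans (mul_le_mul_right (measure_mono hB.image_subset) _)

/-- The area of an annulus is π times the difference of the squared radii, here at most 2r; the
bound is therefore uniform in the size c of the circle. -/
theorem volume_annulus_le (c : ℝ) {r : ℝ} (hr : 0 ≤ r) :
    volume {p : ℝ × ℝ | |p.1 ^ 2 + p.2 ^ 2 - c| ≤ r} ≤ ENNReal.ofReal (2 * Real.pi * r) := by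
  have hm : MeasurableSet {p : ℝ × ℝ | |p.1 ^ 2 + p.2 ^ 2 - c| ≤ r} :=
    measurableSet_le (by fun_prop) (by fun_prop)
  rw [← Complex.volume_preserving_equiv_real_prod.measure_preimage hm.nullMeasurableSet]
  rcases lt_or_ge (c + r) 0 with hneg | hpos
  · have : Complex.measurableEquivRealProd ⁻¹' {p : ℝ × ℝ | |p.1 ^ 2 + p.2 ^ 2 - c| ≤ r} = ∅ := by
      ext z
      simp only [mem_preimage, mem_ofPred_eq, Complex.measurableEquivRealProd_apply,
        mem_empty_iff_false, iff_false, not_le]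
      rw [lt_abs]; left
      nlinarith [sq_nonneg z.re, sq_nonneg z.im]
    rw [this]; simp
  set b := max (c - r) 0 with hb
  have hb0 : 0 ≤ b := le_max_right _ _
  have hbc : b ≤ c + r := max_le (by linarith) hpos
  have hsub : Complex.measurableEquivRealProd ⁻¹' {p : ℝ × ℝ | |p.1 ^ 2 + p.2 ^ 2 - c| ≤ r} ⊆
      Metric.closedBall (0 : ℂ) (√(c + r)) \ Metric.ball 0 (√b) := by
    intro z hz
    simp only [mem_preimage, mem_ofPred_eq, Complex.measurableEquivRealProd_apply] at hz
    have hn : ‖z‖ ^ 2 = z.re ^ 2 + z.im ^ 2 := by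
      rw [← Complex.normSq_eq_norm_sq, Complex.normSq_apply]; ring
    rw [abs_le] at hz
    refine ⟨?_, ?_⟩
    · rw [mem_closedBall_zero_iff]
      exact Real.le_sqrt_of_sq_le (by linarith)
    · rw [mem_ball_zero_iff, not_lt]
      rw [Real.sqrt_le_left (norm_nonneg z)]
      exact max_le (by linarith) (sq_nonneg _)
  refine (measure_mono hsub).trans ?_
  rw [measure_sdiff (Metric.ball_subset_closedBall.trans' (Metric.ball_subset_ball
    (Real.sqrt_le_sqrt hbc))) measurableSet_ball.nullMeasurableSet measure_ball_lt_top.ne,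
    Complex.volume_closedBall, Complex.volume_ball, ← ENNReal.ofReal_pow (Real.sqrt_nonneg _),
    ← ENNReal.ofReal_pow (Real.sqrt_nonneg _), Real.sq_sqrt hpos, Real.sq_sqrt hb0,
    show ((NNReal.pi : NNReal) : ℝ≥0∞) = ENNReal.ofReal Real.pi by
      rw [← NNReal.coe_real_pi, ENNReal.ofReal_coe_nnreal],
    ← ENNReal.ofReal_mul hpos, ← ENNReal.ofReal_mul hb0,
    ← ENNReal.ofReal_sub _ (by positivity)]
  refine ENNReal.ofReal_le_ofReal ?_
  have : c - r ≤ b := le_max_left _ _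
  nlinarith [Real.pi_pos]

/-! ### Coordinates on space-time -/

theorem measurable_omega : Measurable fun p : ℝ × ℝ => omega p.1 p.2 := by
  unfold omega; fun_prop

@[fun_prop]
theorem Measurable.omega {α : Type*} [MeasurableSpace α] {f g : α → ℝ} (hf : Measurable f)
    (hg : Measurable g) : Measurable fun a => omega (f a) (g a) :=
  measurable_omega.comp (hf.prodMk hg)

/-- The modulation `τ - ω(ξ, μ)`. -/
def sig (z : E3) : ℝ := z 2 - omega (z 0) (z 1)

@[fun_prop]
theorem measurable_coord (i : Fin 3) : Measurable fun z : E3 => z i :=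
  (EuclideanSpace.proj (𝕜 := ℝ) i).continuous.measurable

@[fun_prop]
theorem measurable_sig : Measurable sig := by unfold sig; fun_prop

theorem lintegral_E3 {F : ℝ × ℝ × ℝ → ℝ≥0∞} (hF : Measurable F) :
    ∫⁻ z : E3, F (z 0, z 1, z 2) = ∫⁻ p : ℝ × ℝ, ∫⁻ t : ℝ, F (p.1, p.2, t) := by
  have h1 := EuclideanSpace.volume_preserving_symm_measurableEquiv_toLp (Fin 3)
  have h2 := volume_preserving_piFinSuccAbove (fun _ : Fin 3 => ℝ) 0
  have h3 := (MeasurePreserving.id (volume : Measure ℝ)).prod (volume_preserving_finTwoArrow ℝ)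
  have h := (h3.comp h2).comp h1
  have e : ∫⁻ z : E3, F (z 0, z 1, z 2) = ∫⁻ q : ℝ × ℝ × ℝ, F q := by
    have h' := h.lintegral_comp hF
    rw [← Measure.volume_eq_prod] at h'
    rw [← h']
    rfl
  rw [e, Measure.volume_eq_prod, lintegral_prod _ hF.aemeasurable, Measure.volume_eq_prod,
    lintegral_prod _ (Measurable.aemeasurable ?_)]
  · refine lintegral_congr fun x => ?_
    rw [lintegral_prod _ (Measurable.aemeasurable (by fun_prop))]
  · exact Measurable.lintegral_prod_right' (f := fun q : (ℝ × ℝ) × ℝ => F (q.1.1, q.1.2, q.2))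
      (by fun_prop)

/-- The measure of a set of points of modulation at most `r`, computed by slices of constant
modulation. -/
theorem volume_modulation_le {Q : Set (ℝ × ℝ × ℝ)} (hQ : MeasurableSet Q) {r : ℝ} {M : ℝ≥0∞}
    (hM : ∀ T : ℝ, |T| ≤ r → volume {p : ℝ × ℝ | (p.1, p.2, T) ∈ Q} ≤ M) :
    volume {z : E3 | |sig z| ≤ r ∧ (z 0, z 1, sig z) ∈ Q} ≤ ENNReal.ofReal (2 * r) * M := by
  set J : Set ℝ := Icc (-r) r with hJ
  have hJm : MeasurableSet J := measurableSet_Icc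
  have hS : MeasurableSet {z : E3 | |sig z| ≤ r ∧ (z 0, z 1, sig z) ∈ Q} :=
    measurableSet_and (measurableSet_le (by fun_prop) measurable_const)
      ((show Measurable fun z : E3 => (z 0, z 1, sig z) by fun_prop) hQ)
  set H : ℝ × ℝ × ℝ → ℝ≥0∞ := fun q => J.indicator 1 q.2.2 * Q.indicator 1 q with hH
  have mJ : Measurable (J.indicator (1 : ℝ → ℝ≥0∞)) := measurable_one.indicator hJm
  have mQ : Measurable (Q.indicator (1 : ℝ × ℝ × ℝ → ℝ≥0∞)) := measurable_one.indicator hQ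
  have mH : Measurable H := by simp only [hH]; fun_prop
  calc volume {z : E3 | |sig z| ≤ r ∧ (z 0, z 1, sig z) ∈ Q}
      = ∫⁻ z : E3, H (z 0, z 1, z 2 - omega (z 0) (z 1)) := by
        rw [← lintegral_indicator_one hS]
        refine lintegral_congr fun z => ?_
        change _ = H (z 0, z 1, sig z)
        simp only [hH, indicator, hJ, mem_Icc, ← abs_le, Pi.one_apply]
        by_cases h1 : |sig z| ≤ r <;> by_cases h2 : (z 0, z 1, sig z) ∈ Q <;> simp [h1, h2]
    _ = ∫⁻ p : ℝ × ℝ, ∫⁻ t : ℝ, H (p.1, p.2, t - omega p.1 p.2) :=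
        lintegral_E3 (F := fun q => H (q.1, q.2.1, q.2.2 - omega q.1 q.2.1)) (by fun_prop)
    _ = ∫⁻ p : ℝ × ℝ, ∫⁻ t : ℝ, H (p.1, p.2, t) := by
        refine lintegral_congr fun p => ?_
        exact lintegral_sub_right_eq_self (fun t => H (p.1, p.2, t)) _
    _ = ∫⁻ t : ℝ, ∫⁻ p : ℝ × ℝ, H (p.1, p.2, t) :=
        lintegral_lintegral_swap (Measurable.aemeasurable (by fun_prop))
    _ ≤ ∫⁻ t : ℝ, J.indicator 1 t * M := by
        refine lintegral_mono fun t => ?_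
        have hT : MeasurableSet {p : ℝ × ℝ | (p.1, p.2, t) ∈ Q} :=
          (show Measurable fun p : ℝ × ℝ => (p.1, p.2, t) by fun_prop) hQ
        have e : ∫⁻ p : ℝ × ℝ, H (p.1, p.2, t) =
            J.indicator 1 t * volume {p : ℝ × ℝ | (p.1, p.2, t) ∈ Q} := by
          simp only [hH]
          rw [lintegral_const_mul _ (by fun_prop), ← lintegral_indicator_one hT]
          rfl
        rw [e]
        by_cases ht : t ∈ J
        · exact mul_le_mul_right (hM t (abs_le.2 ht)) _
        · simp [ht]
    _ = _ := by
        rw [lintegral_mul_const _ mJ, lintegral_indicator_one hJm, hJ, Real.volume_Icc]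
        congr 2; ring

/-! ### The sum of two dispersion relations -/

/-- Completion of the square in y; the critical point y = xμ/ξ is where both factors have the same
slope. The sign of x(ξ-x)/ξ decides the sign of the quadratic term. -/
theorem omega_add_omega {x ξ : ℝ} (hx : x ≠ 0) (hξ : ξ ≠ 0) (hxξ : ξ - x ≠ 0) (y μ : ℝ) :
    omega x y + omega (ξ - x) (μ - y) =
      omega ξ μ - 3 * x * (ξ - x) * ξ + (y - x * μ / ξ) ^ 2 / (x * (ξ - x) / ξ) := by
  unfold omega
  field_simp
  ring

/-- The level sets of `ω(P₁) + ω(P - P₁)`, both `x`-frequencies being positive. -/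
theorem volume_omega_add_pos_le (ξ μ c : ℝ) {r : ℝ} (hr : 0 ≤ r) :
    volume {p : ℝ × ℝ | (0 < p.1 ∧ p.1 < ξ) ∧
      |omega p.1 p.2 + omega (ξ - p.1) (μ - p.2) - c| ≤ r} ≤ ENNReal.ofReal (2 * r) := by
  rcases le_or_gt ξ 0 with hξ | hξ
  · have : {p : ℝ × ℝ | (0 < p.1 ∧ p.1 < ξ) ∧
        |omega p.1 p.2 + omega (ξ - p.1) (μ - p.2) - c| ≤ r} = ∅ := by
      ext p
      simp only [mem_ofPred_eq, mem_empty_iff_false, iff_false]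
      rintro ⟨⟨h1, h2⟩, -⟩
      linarith
    rw [this]; simp
  -- Since -3x(ξ-x)ξ = 3ξ(x-ξ/2)² - 3ξ³/4, completing the square in x too makes both squares
  -- positive. After rescaling y by κ and then x by (3ξ)^{-1/2}, the level set lies in a circular
  -- annulus.
  set c' : ℝ := c - omega ξ μ + 3 / 4 * ξ ^ 3 with hc'
  set S : Set (ℝ × ℝ) := {p | |3 * ξ * (p.1 - ξ / 2) ^ 2 + p.2 ^ 2 - c'| ≤ r} with hS
  have mS : MeasurableSet S := measurableSet_le (by fun_prop) (by fun_prop)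
  have mA : MeasurableSet {p : ℝ × ℝ | (0 < p.1 ∧ p.1 < ξ) ∧
      |omega p.1 p.2 + omega (ξ - p.1) (μ - p.2) - c| ≤ r} :=
    measurableSet_and (measurableSet_and (measurableSet_lt (by fun_prop) (by fun_prop))
      (measurableSet_lt (by fun_prop) (by fun_prop)))
      (measurableSet_le (by fun_prop) (by fun_prop))
  have h1 : volume S ≤ ENNReal.ofReal (√(3 * ξ))⁻¹ * ENNReal.ofReal (2 * Real.pi * r) := by
    have hs : 0 < √(3 * ξ) := by positivity
    set T : Set (ℝ × ℝ) := {p : ℝ × ℝ | |p.1 ^ 2 + p.2 ^ 2 - c'| ≤ r} with hT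
    have mT : MeasurableSet T := measurableSet_le (by fun_prop) (by fun_prop)
    have mS' : MeasurableSet (Prod.swap ⁻¹' S) := measurable_swap mS
    have e1 : volume (Prod.swap ⁻¹' S) = volume S :=
      (Measure.measurePreserving_swap (μ := (volume : Measure ℝ)) (ν := (volume : Measure ℝ)))
        |>.measure_preimage mS.nullMeasurableSet
    rw [← e1]
    refine (volume_le_mul_of_fiber mS' mT (Filter.Eventually.of_forall fun m => ?_)).trans
      (mul_le_mul_right (volume_annulus_le c' hr) _)
    have : Prod.mk m ⁻¹' (Prod.swap ⁻¹' S) =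
        {x : ℝ | (x - ξ / 2) / (√(3 * ξ))⁻¹ ∈ Prod.mk m ⁻¹' T} := by
      ext x
      have e2 : ((x - ξ / 2) / (√(3 * ξ))⁻¹) ^ 2 = 3 * ξ * (x - ξ / 2) ^ 2 := by
        rw [div_inv_eq_mul, mul_pow, Real.sq_sqrt (by positivity)]; ring
      simp only [hS, hT, mem_preimage, mem_ofPred_eq, Prod.swap_prod_mk, e2]
      rw [add_comm (m ^ 2)]
    rw [this, volume_affine_preimage (by positivity)]
  refine (volume_le_mul_of_fiber (K := ENNReal.ofReal (√ξ / 2)) mA mS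
    (Filter.Eventually.of_forall fun x => ?_)).trans ((mul_le_mul_right h1 _).trans ?_)
  · by_cases hx : 0 < x ∧ x < ξ
    · have hq : 0 < x * (ξ - x) / ξ := div_pos (mul_pos hx.1 (by linarith [hx.2])) hξ
      set κ := √(x * (ξ - x) / ξ) with hκ
      have hκ0 : 0 < κ := Real.sqrt_pos.2 hq
      have hκ1 : κ ≤ √ξ / 2 := by
        rw [hκ, show √ξ / 2 = √(ξ / 4) by
          rw [Real.sqrt_div hξ.le, show (4 : ℝ) = 2 ^ 2 by norm_num,
            Real.sqrt_sq (by norm_num : (0:ℝ) ≤ 2)]]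
        apply Real.sqrt_le_sqrt
        rw [div_le_iff₀ hξ]
        nlinarith [sq_nonneg (ξ - 2 * x)]
      have hsub : Prod.mk x ⁻¹' {p : ℝ × ℝ | (0 < p.1 ∧ p.1 < ξ) ∧
          |omega p.1 p.2 + omega (ξ - p.1) (μ - p.2) - c| ≤ r} ⊆
          {y : ℝ | (y - x * μ / ξ) / κ ∈ Prod.mk x ⁻¹' S} := by
        rintro y ⟨-, hy⟩
        simp only at hy
        rw [omega_add_omega hx.1.ne' hξ.ne' (by linarith [hx.2])] at hy
        simp only [hS, mem_preimage, mem_ofPred_eq, hc']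
        rw [div_pow, hκ, Real.sq_sqrt hq.le]
        convert hy using 2
        ring
      refine (measure_mono hsub).trans ?_
      rw [volume_affine_preimage hκ0]
      exact mul_le_mul_left (ENNReal.ofReal_le_ofReal hκ1) _
    · have : Prod.mk x ⁻¹' {p : ℝ × ℝ | (0 < p.1 ∧ p.1 < ξ) ∧
          |omega p.1 p.2 + omega (ξ - p.1) (μ - p.2) - c| ≤ r} = ∅ := by
        ext y
        simp only [mem_preimage, mem_ofPred_eq, mem_empty_iff_false, iff_false]
        exact fun h => hx h.1
      rw [this]; simp
  -- The Jacobians √ξ/2 and (3ξ)^{-1/2} cancel their dependence on ξ, leaving πr/√3 ≤ 2r.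
  · rw [← ENNReal.ofReal_mul (by positivity), ← ENNReal.ofReal_mul (by positivity)]
    refine ENNReal.ofReal_le_ofReal ?_
    have h3 : √(3 * ξ) = √3 * √ξ := Real.sqrt_mul (by norm_num) _
    have h4 : 0 < √ξ := Real.sqrt_pos.2 hξ
    have h5 : (1.7 : ℝ) ≤ √3 := Real.le_sqrt_of_sq_le (by norm_num)
    have h6 := Real.pi_lt_d2
    rw [h3, show √ξ / 2 * ((√3 * √ξ)⁻¹ * (2 * Real.pi * r)) = Real.pi / √3 * r by
      field_simp]
    refine mul_le_mul_of_nonneg_right ?_ hr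
    rw [div_le_iff₀ (by linarith)]
    linarith

/-- The level sets of `ω(P₁) + ω(P - P₁)`, the first `x`-frequency being much smaller than the
second. -/
theorem volume_omega_add_low_le {ξ D : ℝ} (hD : 0 < D) (hξ : 4 * D ≤ |ξ|) (μ c : ℝ) {r : ℝ}
    (hr : 0 ≤ r) :
    volume {p : ℝ × ℝ | |p.1| ≤ D ∧
      |omega p.1 p.2 + omega (ξ - p.1) (μ - p.2) - c| ≤ r} ≤
      ENNReal.ofReal (20 * (r * D / |ξ|)) := by
  have hξ0 : 0 < |ξ| := by linarith
  have hξ1 : ξ ≠ 0 := abs_pos.1 hξ0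
  set c' : ℝ := c - omega ξ μ with hc'
  set h : ℝ → ℝ := fun x => -3 * x * (ξ - x) * ξ with hh
  have mh : Measurable h := by simp only [hh]; fun_prop
  -- As |x| ≤ |ξ|/4, the coefficient x(1-x/ξ) of the square has the sign of x; after rescaling y the
  -- condition reads |h(x) ± m² - c'| ≤ r.
  set ε : ℝ → ℝ := fun x => if 0 < x then 1 else -1 with hε
  have mε : Measurable ε := Measurable.ite measurableSet_Ioi measurable_const measurable_const
  set S : Set (ℝ × ℝ) := {p | |p.1| ≤ D ∧ |h p.1 + ε p.1 * p.2 ^ 2 - c'| ≤ r} with hS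
  have mS : MeasurableSet S := measurableSet_and (measurableSet_le (by fun_prop) (by fun_prop))
    (measurableSet_le (by fun_prop) (by fun_prop))
  have mA : MeasurableSet {p : ℝ × ℝ | |p.1| ≤ D ∧
      |omega p.1 p.2 + omega (ξ - p.1) (μ - p.2) - c| ≤ r} :=
    measurableSet_and (measurableSet_le (by fun_prop) (by fun_prop))
      (measurableSet_le (by fun_prop) (by fun_prop))
  -- Below the threshold M the function h is used, whose derivative is of size ξ², giving area about
  -- M·r/ξ². Above it m² is used, giving about D·r/M. The choice of M balances both at r√D/|ξ|.
  set M : ℝ := √D * |ξ| with hM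
  have hM0 : 0 < M := by positivity
  -- the part where the second variable is small
  set S1 : Set (ℝ × ℝ) := {p | |p.2| ≤ M ∧ p ∈ S} with hS1
  set S2 : Set (ℝ × ℝ) := {p | M < |p.2| ∧ p ∈ S} with hS2
  have mS1 : MeasurableSet S1 :=
    measurableSet_and (measurableSet_le (by fun_prop) (by fun_prop)) mS
  have mS2 : MeasurableSet S2 :=
    measurableSet_and (measurableSet_lt (by fun_prop) (by fun_prop)) mS
  have hdiff : ∀ x y : ℝ, |x| ≤ D → |y| ≤ D → 3 / 2 * ξ ^ 2 * |x - y| ≤ |h x - h y| := by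
    intro x y hx hy
    have e : h x - h y = -(3 * (x - y) * ξ * (ξ - x - y)) := by simp only [hh]; ring
    rw [e, abs_neg, abs_mul, abs_mul, abs_mul, abs_of_pos (by norm_num : (0:ℝ) < 3), ← sq_abs ξ]
    have h1 : |ξ| / 2 ≤ |ξ - x - y| := by
      have h2 : |ξ| ≤ |ξ - x - y| + |x| + |y| := by
        calc |ξ| = |(ξ - x - y) + x + y| := by congr 1; ring
          _ ≤ _ := abs_add_three _ _ _
      linarith
    nlinarith [mul_nonneg (abs_nonneg (x - y)) hξ0.le]
  have hv1 : volume S1 ≤ ENNReal.ofReal (16 / 3 * (r * √D / |ξ|)) := by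
    have e1 : volume (Prod.swap ⁻¹' S1) = volume S1 :=
      (Measure.measurePreserving_swap (μ := (volume : Measure ℝ)) (ν := (volume : Measure ℝ)))
        |>.measure_preimage mS1.nullMeasurableSet
    rw [← e1]
    have mT : MeasurableSet (Icc (-M) M ×ˢ Icc (0 : ℝ) 1) :=
      measurableSet_Icc.prod measurableSet_Icc
    refine (volume_le_mul_of_fiber (K := ENNReal.ofReal (8 * r / (3 * ξ ^ 2)))
      (measurable_swap mS1) mT (Filter.Eventually.of_forall fun m => ?_)).trans ?_
    · by_cases hm : |m| ≤ M
      · have hm' : m ∈ Icc (-M) M := abs_le.1 hm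
        have e2 : Prod.mk m ⁻¹' (Icc (-M) M ×ˢ Icc (0 : ℝ) 1) = Icc (0 : ℝ) 1 := by
          ext x; simp only [mem_preimage, mem_prod, hm', true_and]
        rw [e2, Real.volume_Icc]
        norm_num only [sub_zero, ENNReal.ofReal_one, mul_one]
        set U : Set ℝ := Prod.mk m ⁻¹' (Prod.swap ⁻¹' S1) with hU
        -- The sign ε jumps at x = 0, so fibres are measured separately on either side.
        have key : ∀ V : Set ℝ, V ⊆ U → (∀ x ∈ V, ∀ y ∈ V, ε x = ε y) →
            volume V ≤ ENNReal.ofReal (4 * r / (3 * ξ ^ 2)) := by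
          intro V hV hVε
          refine volume_le_of_abs_sub_le fun x hx y hy => ?_
          obtain ⟨-, hx1, hx2⟩ := hV hx
          obtain ⟨-, hy1, hy2⟩ := hV hy
          simp only [Prod.swap_prod_mk] at hx1 hx2 hy1 hy2
          have h1 := hdiff x y hx1 hy1
          have h2 : |h x - h y| ≤ 2 * r := by
            rw [hVε x hx y hy] at hx2
            calc |h x - h y| = |(h x + ε y * m ^ 2 - c') - (h y + ε y * m ^ 2 - c')| := by
                  congr 1; ring
              _ ≤ _ := (abs_sub _ _).trans (by linarith)
          rw [le_div_iff₀ (by positivity)]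
          nlinarith
        have hU1 : U = (U ∩ Ioi 0) ∪ (U \ Ioi 0) := (inter_union_sdiff _ _).symm
        rw [hU1]
        refine (measure_union_le _ _).trans ?_
        have k1 := key (U ∩ Ioi 0) inter_subset_left (by
          rintro x ⟨-, hx⟩ y ⟨-, hy⟩
          simp only [hε, if_pos (mem_Ioi.1 hx), if_pos (mem_Ioi.1 hy)])
        have k2 := key (U \ Ioi 0) sdiff_subset (by
          rintro x ⟨-, hx⟩ y ⟨-, hy⟩
          rw [mem_Ioi] at hx hy
          simp only [hε, if_neg hx, if_neg hy])
        refine (add_le_add k1 k2).trans ?_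
        rw [← ENNReal.ofReal_add (by positivity) (by positivity)]
        exact ENNReal.ofReal_le_ofReal (le_of_eq (by ring))
      · have : Prod.mk m ⁻¹' (Prod.swap ⁻¹' S1) = ∅ := by
          ext x
          simp only [mem_preimage, Prod.swap_prod_mk, hS1, mem_ofPred_eq, mem_empty_iff_false,
            iff_false]
          exact fun h => hm h.1
        rw [this]; simp
    · rw [Measure.volume_eq_prod, Measure.prod_prod, Real.volume_Icc, Real.volume_Icc,
        ← ENNReal.ofReal_mul (by linarith), ← ENNReal.ofReal_mul (by positivity)]
      refine ENNReal.ofReal_le_ofReal (le_of_eq ?_)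
      rw [hM, ← sq_abs ξ]
      field_simp
      ring
  have hv2 : volume S2 ≤ ENNReal.ofReal (4 * (r * √D / |ξ|)) := by
    have mT : MeasurableSet (Icc (-D) D ×ˢ Icc (0 : ℝ) 1) :=
      measurableSet_Icc.prod measurableSet_Icc
    refine (volume_le_mul_of_fiber (K := ENNReal.ofReal (2 * r / M)) mS2 mT
      (Filter.Eventually.of_forall fun x => ?_)).trans ?_
    · by_cases hx : |x| ≤ D
      · have hx' : x ∈ Icc (-D) D := abs_le.1 hx
        have e2 : Prod.mk x ⁻¹' (Icc (-D) D ×ˢ Icc (0 : ℝ) 1) = Icc (0 : ℝ) 1 := by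
          ext y; simp only [mem_preimage, mem_prod, hx', true_and]
        rw [e2, Real.volume_Icc]
        norm_num only [sub_zero, ENNReal.ofReal_one, mul_one]
        set U : Set ℝ := Prod.mk x ⁻¹' S2 with hU
        have key : ∀ V : Set ℝ, V ⊆ U → (∀ m ∈ V, ∀ n ∈ V, 0 ≤ m * n) →
            volume V ≤ ENNReal.ofReal (r / M) := by
          intro V hV hs
          refine volume_le_of_abs_sub_le fun m hm n hn => ?_
          obtain ⟨hm0, -, hm2⟩ := hV hm
          obtain ⟨hn0, -, hn2⟩ := hV hn
          simp only at hm0 hm2 hn0 hn2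
          have hε1 : |ε x| = 1 := by simp only [hε]; split_ifs <;> simp
          have h2 : |m ^ 2 - n ^ 2| ≤ 2 * r := by
            calc |m ^ 2 - n ^ 2| = |ε x| * |m ^ 2 - n ^ 2| := by rw [hε1, one_mul]
              _ = |(h x + ε x * m ^ 2 - c') - (h x + ε x * n ^ 2 - c')| := by
                  rw [← abs_mul]; congr 1; ring
              _ ≤ _ := (abs_sub _ _).trans (by linarith)
          have h3 : |m ^ 2 - n ^ 2| = |m - n| * |m + n| := by rw [← abs_mul]; congr 1; ring
          have h4 : 2 * M ≤ |m + n| := by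
            have : |m + n| = |m| + |n| := by
              rw [abs_add_eq_add_abs_iff]
              rcases le_or_gt 0 m with h | h
              · rcases h.eq_or_lt with h | h
                · rw [← h, abs_zero] at hm0; linarith
                · left; exact ⟨h.le, nonneg_of_mul_nonneg_right (hs m hm n hn) h⟩
              · right
                refine ⟨h.le, ?_⟩
                by_contra hn'
                push Not at hn'
                have := hs m hm n hn
                nlinarith
            rw [this]; linarith
          rw [le_div_iff₀ hM0]
          nlinarith [abs_nonneg (m - n)]
        have hU1 : U = (U ∩ Ioi 0) ∪ (U \ Ioi 0) := (inter_union_sdiff _ _).symm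
        rw [hU1]
        refine (measure_union_le _ _).trans ?_
        have k1 := key (U ∩ Ioi 0) inter_subset_left (by
          rintro x ⟨-, hx⟩ y ⟨-, hy⟩
          exact (mul_pos hx hy).le)
        have k2 := key (U \ Ioi 0) sdiff_subset (by
          rintro x ⟨-, hx⟩ y ⟨-, hy⟩
          rw [mem_Ioi, not_lt] at hx hy
          exact mul_nonneg_of_nonpos_of_nonpos hx hy)
        refine (add_le_add k1 k2).trans ?_
        rw [← ENNReal.ofReal_add (by positivity) (by positivity)]
        exact ENNReal.ofReal_le_ofReal (le_of_eq (by ring))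
      · have : Prod.mk x ⁻¹' S2 = ∅ := by
          ext y
          simp only [mem_preimage, hS2, hS, mem_ofPred_eq, mem_empty_iff_false, iff_false]
          exact fun h => hx h.2.1
        rw [this]; simp
    · rw [Measure.volume_eq_prod, Measure.prod_prod, Real.volume_Icc, Real.volume_Icc,
        ← ENNReal.ofReal_mul (by linarith), ← ENNReal.ofReal_mul (by positivity)]
      refine ENNReal.ofReal_le_ofReal (le_of_eq ?_)
      rw [hM]
      have := Real.sq_sqrt hD.le
      have h0 : √D ≠ 0 := (Real.sqrt_pos.2 hD).ne'
      field_simp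
      rw [this]; ring
  have hvS : volume S ≤ ENNReal.ofReal (10 * (r * √D / |ξ|)) := by
    have : S ⊆ S1 ∪ S2 := fun p hp => (le_or_gt |p.2| M).imp (fun h => ⟨h, hp⟩) fun h => ⟨h, hp⟩
    refine (measure_mono this).trans ((measure_union_le _ _).trans ((add_le_add hv1 hv2).trans ?_))
    rw [← ENNReal.ofReal_add (by positivity) (by positivity)]
    refine ENNReal.ofReal_le_ofReal ?_
    have : 0 ≤ r * √D / |ξ| := by positivity
    linarith
  -- The rescaling of y by κ degenerates at x = 0, a null set of fibres.
  have hae : ∀ᵐ x : ℝ, x ≠ 0 := by simp [ae_iff]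
  refine (volume_le_mul_of_fiber (K := ENNReal.ofReal (2 * √D)) mA mS (hae.mono fun x hx0 => ?_)).trans
    ((mul_le_mul_right hvS _).trans ?_)
  · by_cases hx : |x| ≤ D
    · have hq1 : x * (ξ - x) / ξ = x * (1 - x / ξ) := by field_simp
      have hxξ : |x / ξ| ≤ 1 / 4 := by
        rw [abs_div, div_le_iff₀ hξ0]; linarith
      have hxξ' := abs_le.1 hxξ
      have h1 : 0 < 1 - x / ξ := by linarith [hxξ'.2]
      have hne : ξ - x ≠ 0 := by
        intro h0
        have : x / ξ = 1 := by rw [show x = ξ by linarith, div_self hξ1]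
        linarith
      set κ := √(|x| * (1 - x / ξ)) with hκ
      have hk : 0 < |x| * (1 - x / ξ) := mul_pos (abs_pos.2 hx0) h1
      have hκ0 : 0 < κ := Real.sqrt_pos.2 hk
      have hκ1 : κ ≤ 2 * √D := by
        rw [hκ, show 2 * √D = √(4 * D) by
          rw [Real.sqrt_mul (by norm_num), show (4 : ℝ) = 2 ^ 2 by norm_num,
            Real.sqrt_sq (by norm_num : (0:ℝ) ≤ 2)]]
        apply Real.sqrt_le_sqrt
        nlinarith [abs_nonneg x]
      have hsub : Prod.mk x ⁻¹' {p : ℝ × ℝ | |p.1| ≤ D ∧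
          |omega p.1 p.2 + omega (ξ - p.1) (μ - p.2) - c| ≤ r} ⊆
          {y : ℝ | (y - x * μ / ξ) / κ ∈ Prod.mk x ⁻¹' S} := by
        rintro y ⟨-, hy⟩
        simp only at hy
        rw [omega_add_omega hx0 hξ1 hne, hq1] at hy
        simp only [hS, mem_preimage, mem_ofPred_eq, hc', hh]
        refine ⟨hx, ?_⟩
        have e3 : ε x * ((y - x * μ / ξ) / κ) ^ 2 = (y - x * μ / ξ) ^ 2 / (x * (1 - x / ξ)) := by
          rw [div_pow, hκ, Real.sq_sqrt hk.le]
          simp only [hε]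
          split_ifs with h0
          · rw [abs_of_pos h0, one_mul]
          · rw [abs_of_neg (lt_of_le_of_ne (not_lt.1 h0) hx0), neg_mul x, div_neg]; ring
        rw [e3]
        convert hy using 2
        ring
      refine (measure_mono hsub).trans ?_
      rw [volume_affine_preimage hκ0]
      exact mul_le_mul_left (ENNReal.ofReal_le_ofReal hκ1) _
    · have : Prod.mk x ⁻¹' {p : ℝ × ℝ | |p.1| ≤ D ∧
          |omega p.1 p.2 + omega (ξ - p.1) (μ - p.2) - c| ≤ r} = ∅ := by
        ext y
        simp only [mem_preimage, mem_ofPred_eq, mem_empty_iff_false, iff_false]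
        exact fun h => hx h.1
      rw [this]; simp
  · rw [← ENNReal.ofReal_mul (by positivity)]
    refine ENNReal.ofReal_le_ofReal (le_of_eq ?_)
    have := Real.sq_sqrt hD.le
    field_simp
    rw [this]; ring

/-! ### The resonant interaction -/

/-- The resonance function in terms of slopes. Unlike for KP-II it can vanish with all frequencies
nonzero, precisely when the quotient equals ±√3; each sign is one resonant sheet. -/
theorem omega_sub_sub {x a : ℝ} (hxa : x - a ≠ 0) (n m : ℝ) :
    omega x (x * n) - omega a (a * m) - omega (x - a) (x * n - a * m) =
      a * x * (x - a) * (3 - ((n - m) / (x - a)) ^ 2) := by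
  unfold omega
  field_simp
  ring

/-- Expansion of the resonance coordinates, one variable. -/
theorem resonance_expansion {c x x' e e' X X' : ℝ} (he : e ≠ 0) (he' : e' ≠ 0)
    (hee : e - e' = x - x') :
    x * X * (2 * c - X / e) - x' * X' * (2 * c - X' / e') =
      (X - X') * (x * (2 * c - X / e) - x * (X' / e)) +
        (x - x') * (x * (X' / e) * (X' / e') + X' * (2 * c - X' / e')) := by
  have h : x = x' + (e - e') := by linarith
  subst h
  field_simp
  ring

/-- Near a sheet X/e is small and x·X·(2c - X/e) is close to 2c·x·X. In `resonance_expansion` the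
coefficient of X - X' is thus at least 1.3N in size, while that of x - x' is at most 0.2N because it
carries a factor X' or X'/e'. -/
theorem resonance_lower {c x x' e e' X X' N : ℝ} (hN : 0 < N) (hc : c ^ 2 = 3)
    (hx : N / 2 ≤ x) (hx2 : x ≤ 2 * N)
    (he : e ≠ 0) (he' : |e'| ≤ 4 * N) (he0 : e' ≠ 0) (hee' : |e'| ≤ 16 * |e|)
    (hee : e - e' = x - x')
    (hX : |X / e| ≤ 1 / 100) (hX' : |X' / e'| ≤ 1 / 100) :
    1.3 * N * |X - X'| ≤
      |x * X * (2 * c - X / e) - x' * X' * (2 * c - X' / e')| + 0.2 * N * |x - x'| := by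
  rw [resonance_expansion he he0 hee]
  set r := X / e with hr
  set r' := X' / e' with hr'
  have hXr : X' = e' * r' := by rw [hr']; field_simp
  have hc1 : |c| ≤ 1.75 := by
    rw [← Real.sqrt_sq_eq_abs, hc]
    exact Real.sqrt_le_iff.2 ⟨by norm_num, by norm_num⟩
  have hc2 : 1.7 ≤ |c| := by
    rw [← Real.sqrt_sq_eq_abs, hc]
    exact Real.le_sqrt_of_sq_le (by norm_num)
  have hq : |X' / e| ≤ 0.16 := by
    rw [abs_div, div_le_iff₀ (abs_pos.2 he), hXr, abs_mul]
    nlinarith [abs_nonneg r', abs_nonneg e', abs_nonneg e]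
  have hX1 : |X'| ≤ 0.04 * N := by
    rw [hXr, abs_mul]
    nlinarith [abs_nonneg r', abs_nonneg e']
  have hx0 : 0 < x := by linarith
  set A := x * (2 * c - r) - x * (X' / e) with hA
  set B := x * (X' / e) * r' + X' * (2 * c - r') with hB
  have hA1 : 1.3 * N ≤ |A| := by
    have e1 : A = x * (2 * c - r - X' / e) := by rw [hA]; ring
    rw [e1, abs_mul, abs_of_pos hx0]
    have : 2 * |c| ≤ |2 * c - r - X' / e| + |r| + |X' / e| := by
      calc 2 * |c| = |(2 * c - r - X' / e) + r + X' / e| := by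
            rw [show (2 * c - r - X' / e) + r + X' / e = 2 * c by ring, abs_mul]; norm_num
        _ ≤ _ := abs_add_three _ _ _
    have h1 : 3 ≤ |2 * c - r - X' / e| := by norm_num at *; linarith
    nlinarith
  have hB1 : |B| ≤ 0.2 * N := by
    have h1 : |x * (X' / e) * r'| ≤ 0.0032 * N := by
      rw [abs_mul, abs_mul, abs_of_pos hx0]
      calc x * |X' / e| * |r'| ≤ (2 * N) * 0.16 * (1 / 100) := by gcongr
        _ = _ := by ring
    have h2 : |X' * (2 * c - r')| ≤ 0.1404 * N := by
      rw [abs_mul]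
      have : |2 * c - r'| ≤ 3.51 := by
        calc |2 * c - r'| ≤ |2 * c| + |r'| := abs_sub _ _
          _ ≤ 2 * 1.75 + 1 / 100 := by
            rw [abs_mul, abs_of_pos (by norm_num : (0 : ℝ) < 2)]
            gcongr
          _ = _ := by norm_num
      calc |X'| * |2 * c - r'| ≤ (0.04 * N) * 3.51 := by gcongr
        _ = _ := by ring
    calc |B| ≤ _ := abs_add_le _ _
      _ ≤ 0.0032 * N + 0.1404 * N := add_le_add h1 h2
      _ ≤ _ := by linarith
  have h3 : |(X - X') * A| ≤ |(X - X') * A + (x - x') * B| + |(x - x') * B| := by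
    calc |(X - X') * A| = |((X - X') * A + (x - x') * B) - (x - x') * B| := by congr 1; ring
      _ ≤ _ := abs_sub _ _
  rw [abs_mul, abs_mul (x - x')] at h3
  nlinarith [abs_nonneg (X - X'), abs_nonneg (x - x')]

set_option maxHeartbeats 1000000 in
/-- The planar set cut out by two resonance conditions is small. -/
theorem volume_resonance_plane_le {N d c ε x₁ n₁ x₂ n₂ : ℝ} (hd : 0 < d) (hdN : d ≤ N / 32)
    (hc : c ^ 2 = 3) (hε : ε = 1 ∨ ε = -1) (a₀ b₀ : ℝ) {A B : ℝ} (hA : 0 ≤ A) :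
    volume {p : ℝ × ℝ | (N / 2 ≤ p.1 ∧ p.1 ≤ 2 * N) ∧ (N / 4 ≤ p.1 - x₁ ∧ p.1 - x₁ ≤ 4 * N) ∧
      (d / 2 ≤ ε * (p.1 - x₂) ∧ ε * (p.1 - x₂) ≤ 2 * d) ∧
      |(p.2 - n₁) / (p.1 - x₁) + c| ≤ 1 / 100 ∧ |(p.2 - n₂) / (p.1 - x₂) - c| ≤ 1 / 100 ∧
      |p.1 * (p.1 - x₁) * (3 - ((p.2 - n₁) / (p.1 - x₁)) ^ 2) - a₀| ≤ A ∧
      |p.1 * (p.1 - x₂) * (3 - ((p.2 - n₂) / (p.1 - x₂)) ^ 2) - b₀| ≤ B} ≤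
      ENNReal.ofReal (64 / N ^ 2 * (A * B)) := by
  have hN : 0 < N := by linarith
  set S := {p : ℝ × ℝ | (N / 2 ≤ p.1 ∧ p.1 ≤ 2 * N) ∧ (N / 4 ≤ p.1 - x₁ ∧ p.1 - x₁ ≤ 4 * N) ∧
      (d / 2 ≤ ε * (p.1 - x₂) ∧ ε * (p.1 - x₂) ≤ 2 * d) ∧
      |(p.2 - n₁) / (p.1 - x₁) + c| ≤ 1 / 100 ∧ |(p.2 - n₂) / (p.1 - x₂) - c| ≤ 1 / 100 ∧
      |p.1 * (p.1 - x₁) * (3 - ((p.2 - n₁) / (p.1 - x₁)) ^ 2) - a₀| ≤ A ∧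
      |p.1 * (p.1 - x₂) * (3 - ((p.2 - n₂) / (p.1 - x₂)) ^ 2) - b₀| ≤ B} with hS
  set Φ : ℝ × ℝ → ℝ × ℝ := fun p =>
    (p.1 * (p.1 - x₁) * (3 - ((p.2 - n₁) / (p.1 - x₁)) ^ 2),
      p.1 * (p.1 - x₂) * (3 - ((p.2 - n₂) / (p.1 - x₂)) ^ 2)) with hΦ
  have hc1 : |c| ≤ 1.75 := by
    rw [← Real.sqrt_sq_eq_abs, hc]
    exact Real.sqrt_le_iff.2 ⟨by norm_num, by norm_num⟩
  have hc2 : 1.7 ≤ |c| := by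
    rw [← Real.sqrt_sq_eq_abs, hc]
    exact Real.le_sqrt_of_sq_le (by norm_num)
  have hanti : ∀ p ∈ S, ∀ q ∈ S,
      dist p q ≤ ((4 / N).toNNReal : ℝ) * dist (Φ p) (Φ q) := by
    rintro ⟨x, n⟩ ⟨⟨hx1, hx2⟩, ⟨he1, he2⟩, ⟨hf1, hf2⟩, hr, hs, -, -⟩ ⟨x', n'⟩
      ⟨⟨hx1', hx2'⟩, ⟨he1', he2'⟩, ⟨hf1', hf2'⟩, hr', hs', -, -⟩
    simp only at hx1 hx2 he1 he2 hf1 hf2 hr hs hx1' hx2' he1' he2' hf1' hf2' hr' hs'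
    rw [Real.coe_toNNReal _ (by positivity)]
    set e := x - x₁ with he
    set e' := x' - x₁ with he'
    set f := x - x₂ with hf
    set f' := x' - x₂ with hf'
    have e0 : 0 < e := by linarith
    have e0' : 0 < e' := by linarith
    have hεf : ∀ y : ℝ, 0 < ε * y → |y| = ε * y := by
      intro y hy
      rcases hε with h | h
      · rw [h, one_mul] at hy ⊢; exact abs_of_pos hy
      · rw [h, neg_one_mul] at hy ⊢; exact abs_of_neg (by linarith)
    have fa : |f| = ε * f := hεf f (by linarith)
    have fa' : |f'| = ε * f' := hεf f' (by linarith)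
    have f0 : f ≠ 0 := abs_pos.1 (by linarith)
    have f0' : f' ≠ 0 := abs_pos.1 (by linarith)
    -- X and Y vanish on the resonant lines, of slopes -c and c in the (frequency, slope) plane.
    -- Their increments differ by 2c(x - x'), so together they control both x and n. This is the
    -- transversality, and it absorbs the 0.2N error of `resonance_lower`.
    set X := n - n₁ + c * e with hX
    set X' := n' - n₁ + c * e' with hX'
    set Y := n - n₂ - c * f with hY
    set Y' := n' - n₂ - c * f' with hY'
    have r1 : (n - n₁) / e = X / e - c := by rw [hX]; field_simp; ring
    have r1' : (n' - n₁) / e' = X' / e' - c := by rw [hX']; field_simp; ring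
    have s1 : (n - n₂) / f = Y / f + c := by rw [hY]; field_simp; ring
    have s1' : (n' - n₂) / f' = Y' / f' + c := by rw [hY']; field_simp; ring
    have hα : (Φ (x, n)).1 = x * X * (2 * c - X / e) := by
      simp only [hΦ, ← he, r1]
      field_simp
      linear_combination (-(x * e ^ 2)) * hc
    have hα' : (Φ (x', n')).1 = x' * X' * (2 * c - X' / e') := by
      simp only [hΦ, ← he', r1']
      field_simp
      linear_combination (-(x' * e' ^ 2)) * hc
    have hβ : (Φ (x, n)).2 = x * Y * (2 * (-c) - Y / f) := by
      simp only [hΦ, ← hf, s1]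
      field_simp
      linear_combination (-(x * f ^ 2)) * hc
    have hβ' : (Φ (x', n')).2 = x' * Y' * (2 * (-c) - Y' / f') := by
      simp only [hΦ, ← hf', s1']
      field_simp
      linear_combination (-(x' * f' ^ 2)) * hc
    rw [r1, sub_add_cancel] at hr
    rw [r1', sub_add_cancel] at hr'
    rw [s1, add_sub_cancel_right] at hs
    rw [s1', add_sub_cancel_right] at hs'
    have k1 := resonance_lower (c := c) hN hc hx1 hx2 e0.ne' (e' := e') (x' := x')
      (by rw [abs_of_pos e0']; linarith) e0'.ne'
      (by rw [abs_of_pos e0', abs_of_pos e0]; linarith) (by rw [he, he']; ring) hr hr'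
    have k2 := resonance_lower (c := -c) hN (by rw [neg_sq, hc]) hx1 hx2 f0 (e' := f') (x' := x')
      (by linarith) f0' (by linarith) (by rw [hf, hf']; ring) hs hs'
    rw [← hα, ← hα'] at k1
    rw [← hβ, ← hβ'] at k2
    have d1 : |(Φ (x, n)).1 - (Φ (x', n')).1| ≤ dist (Φ (x, n)) (Φ (x', n')) := by
      rw [← Real.dist_eq]; exact le_max_left _ _
    have d2 : |(Φ (x, n)).2 - (Φ (x', n')).2| ≤ dist (Φ (x, n)) (Φ (x', n')) := by
      rw [← Real.dist_eq]; exact le_max_right _ _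
    set Δ := dist (Φ (x, n)) (Φ (x', n')) with hΔ
    have hXY : (X - X') - (Y - Y') = 2 * c * (x - x') := by
      rw [hX, hX', hY, hY', he, he', hf, hf']; ring
    have h3 : 3.4 * |x - x'| ≤ |X - X'| + |Y - Y'| := by
      calc 3.4 * |x - x'| ≤ 2 * |c| * |x - x'| := by
            refine mul_le_mul_of_nonneg_right ?_ (abs_nonneg _)
            linarith
        _ = |2 * c * (x - x')| := by
            rw [abs_mul, abs_mul, abs_of_pos (by norm_num : (0 : ℝ) < 2)]
        _ ≤ _ := by rw [← hXY]; exact abs_sub _ _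
    have h3' := mul_le_mul_of_nonneg_left h3 hN.le
    have hU : 0 ≤ N * |X - X'| := mul_nonneg hN.le (abs_nonneg _)
    have hV : 0 ≤ N * |Y - Y'| := mul_nonneg hN.le (abs_nonneg _)
    have h5 : N * |x - x'| ≤ 4 * Δ := by linarith
    have h6 : |n - n'| ≤ |X - X'| + 1.75 * |x - x'| := by
      have : n - n' = (X - X') - c * (x - x') := by rw [hX, hX', he, he']; ring
      rw [this]
      refine (abs_sub _ _).trans ?_
      rw [abs_mul]
      gcongr
    have h7 : N * |n - n'| ≤ 4 * Δ := by
      have h8 := mul_le_mul_of_nonneg_left h6 hN.le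
      linarith
    rw [Prod.dist_eq, div_mul_eq_mul_div, le_div_iff₀ hN, mul_comm]
    rcases max_choice (dist (x, n).1 (x', n').1) (dist (x, n).2 (x', n').2) with h | h
    · rw [h, Real.dist_eq]; exact h5
    · rw [h, Real.dist_eq]; exact h7
  have hmaps : MapsTo Φ S (Icc (a₀ - A) (a₀ + A) ×ˢ Icc (b₀ - B) (b₀ + B)) := by
    rintro p ⟨-, -, -, -, -, ha, hb⟩
    rw [abs_le] at ha hb
    exact ⟨⟨by simp only [hΦ]; linarith [ha.1], by simp only [hΦ]; linarith [ha.2]⟩,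
      ⟨by simp only [hΦ]; linarith [hb.1], by simp only [hΦ]; linarith [hb.2]⟩⟩
  refine (volume_le_of_antilipschitz hanti hmaps).trans ?_
  rw [Measure.volume_eq_prod, Measure.prod_prod, Real.volume_Icc, Real.volume_Icc,
    ← ENNReal.ofReal_mul (by linarith)]
  change ENNReal.ofReal (4 / N) ^ 2 * _ ≤ _
  rw [← ENNReal.ofReal_pow (by positivity), ← ENNReal.ofReal_mul (by positivity)]
  refine ENNReal.ofReal_le_ofReal (le_of_eq ?_)
  field_simp
  ring

/-- In 3 - p² = (c+p)(c-p) the sign condition forces |c-p| ≥ |c| ≥ 1. The sign of the slope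
difference thus selects the sheet p ≈ -c. -/
theorem abs_add_le_of_sq_sub_le {p c ρ : ℝ} (hc : c ^ 2 = 3) (hs : c * p ≤ 0)
    (h : |3 - p ^ 2| ≤ ρ) : |p + c| ≤ ρ := by
  have hc2 : 1 ≤ |c| := by
    rw [← Real.sqrt_sq_eq_abs, hc]
    exact Real.le_sqrt_of_sq_le (by norm_num)
  have h1 : |c| ≤ |c - p| := by
    rw [← sq_le_sq]
    nlinarith [sq_nonneg p]
  have h2 : 3 - p ^ 2 = (p + c) * (c - p) := by rw [← hc]; ring
  rw [h2, abs_mul] at h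
  nlinarith [abs_nonneg (p + c)]

/-- The slope `μ / ξ`. -/
def slope (z : E3) : ℝ := z 1 / z 0

@[fun_prop]
theorem measurable_slope : Measurable slope := by unfold slope; fun_prop

-- The modulation of z ranges over an interval of length 2r₃. On each slice, passing from μ to the
-- slope costs a Jacobian at most 2N, and the two remaining modulation conditions, divided by the
-- frequencies of a and b, become boxes of half-widths r₂/|a₀| ≤ 2r₂/d and r₁/|b₀| ≤ 4r₁/N for
-- `volume_resonance_plane_le`. The smallness of r₁+r₂+r₃ places both quotients within 1/100 of ±√3.
set_option maxHeartbeats 1000000 in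
theorem volume_resonance_le {N d c ε : ℝ} (hd : 0 < d) (hdN : d ≤ N / 32) (hc : c ^ 2 = 3)
    (hε : ε = 1 ∨ ε = -1) {r₁ r₂ r₃ : ℝ} (h₁ : 0 ≤ r₁) (h₂ : 0 ≤ r₂) (h₃ : 0 ≤ r₃)
    (hr : r₁ + r₂ + r₃ ≤ d * N ^ 2 / 1600) {a b : E3} (ha : d / 2 ≤ |a 0| ∧ |a 0| ≤ 2 * d)
    (haσ : |sig a| ≤ r₁) (hbσ : |sig b| ≤ r₂) :
    volume {z : E3 | |sig z| ≤ r₃ ∧ (N / 2 ≤ z 0 ∧ z 0 ≤ 2 * N) ∧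
      (d / 2 ≤ ε * (z 0 - b 0) ∧ ε * (z 0 - b 0) ≤ 2 * d) ∧
      |sig (z - a)| ≤ r₂ ∧ |sig (z - b)| ≤ r₁ ∧
      0 ≤ c * (slope a - slope (z - a)) ∧ 0 ≤ c * (slope (z - b) - slope b)} ≤
      ENNReal.ofReal (2048 * (r₁ * r₂ * r₃ / (d * N ^ 2))) := by
  have hN : 0 < N := by linarith
  set a₀ := a 0 with ha₀
  set b₀ := b 0 with hb₀
  have ha0 : a₀ ≠ 0 := abs_pos.1 (by linarith [ha.1])
  -- Otherwise the set is empty, since z₀ ≥ N/2 and z₀ is within 2d ≤ N/16 of b₀.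
  by_cases hb : N / 4 ≤ b₀
  swap
  · have : {z : E3 | |sig z| ≤ r₃ ∧ (N / 2 ≤ z 0 ∧ z 0 ≤ 2 * N) ∧
      (d / 2 ≤ ε * (z 0 - b₀) ∧ ε * (z 0 - b₀) ≤ 2 * d) ∧
      |sig (z - a)| ≤ r₂ ∧ |sig (z - b)| ≤ r₁ ∧
      0 ≤ c * (slope a - slope (z - a)) ∧ 0 ≤ c * (slope (z - b) - slope b)} = ∅ := by
      ext z
      simp only [mem_ofPred_eq, mem_empty_iff_false, iff_false]
      rintro ⟨-, ⟨h4, h5⟩, ⟨h6, h7⟩, -⟩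
      refine hb ?_
      rcases hε with h | h <;> rw [h] at h6 h7 <;> linarith
    rw [this]; simp
  have hb0 : 0 < b₀ := by linarith
  have hae : |a₀| ≤ N / 16 := by linarith [ha.2]
  rw [abs_le] at hae
  -- the target set in the coordinates `(ξ, μ, σ)`
  set Q : Set (ℝ × ℝ × ℝ) := {q | (N / 2 ≤ q.1 ∧ q.1 ≤ 2 * N) ∧
      (d / 2 ≤ ε * (q.1 - b₀) ∧ ε * (q.1 - b₀) ≤ 2 * d) ∧
      (|q.2.2 + omega q.1 q.2.1 - a 2 - omega (q.1 - a₀) (q.2.1 - a 1)| ≤ r₂ ∧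
        |q.2.2 + omega q.1 q.2.1 - b 2 - omega (q.1 - b₀) (q.2.1 - b 1)| ≤ r₁) ∧
      0 ≤ c * (slope a - (q.2.1 - a 1) / (q.1 - a₀)) ∧
      0 ≤ c * ((q.2.1 - b 1) / (q.1 - b₀) - slope b)} with hQ
  have mQ : MeasurableSet Q := by
    refine measurableSet_and (measurableSet_and ?_ ?_) (measurableSet_and
      (measurableSet_and ?_ ?_) (measurableSet_and (measurableSet_and ?_ ?_)
      (measurableSet_and ?_ ?_))) <;>
    exact measurableSet_le (by fun_prop) (by fun_prop)
  have hset : {z : E3 | |sig z| ≤ r₃ ∧ (N / 2 ≤ z 0 ∧ z 0 ≤ 2 * N) ∧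
      (d / 2 ≤ ε * (z 0 - b₀) ∧ ε * (z 0 - b₀) ≤ 2 * d) ∧
      |sig (z - a)| ≤ r₂ ∧ |sig (z - b)| ≤ r₁ ∧
      0 ≤ c * (slope a - slope (z - a)) ∧ 0 ≤ c * (slope (z - b) - slope b)} ⊆
      {z : E3 | |sig z| ≤ r₃ ∧ (z 0, z 1, sig z) ∈ Q} := by
    rintro z ⟨h0, h1, h2, h3, h4, h5, h6⟩
    refine ⟨h0, h1, h2, ⟨?_, ?_⟩, ?_, ?_⟩
    · simp only [sig] at h3 ⊢
      convert h3 using 2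
      simp only [PiLp.sub_apply]; ring
    · simp only [sig] at h4 ⊢
      convert h4 using 2
      simp only [PiLp.sub_apply]; ring
    · simpa [slope] using h5
    · simpa [slope] using h6
  refine (measure_mono hset).trans ((volume_modulation_le mQ
    (M := ENNReal.ofReal (1024 * (r₁ * r₂ / (d * N ^ 2)))) fun T hT => ?_).trans ?_)
  swap
  · rw [← ENNReal.ofReal_mul (by linarith)]
    exact ENNReal.ofReal_le_ofReal (le_of_eq (by ring))
  -- the slices
  set n₁ := slope a with hn₁
  set n₂ := slope b with hn₂
  have ha1 : a 1 = a₀ * n₁ := by rw [hn₁, slope, ← ha₀]; field_simp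
  have hb1 : b 1 = b₀ * n₂ := by rw [hn₂, slope, ← hb₀]; field_simp
  set P : Set (ℝ × ℝ) := {p : ℝ × ℝ | (N / 2 ≤ p.1 ∧ p.1 ≤ 2 * N) ∧
      (N / 4 ≤ p.1 - a₀ ∧ p.1 - a₀ ≤ 4 * N) ∧
      (d / 2 ≤ ε * (p.1 - b₀) ∧ ε * (p.1 - b₀) ≤ 2 * d) ∧
      |(p.2 - n₁) / (p.1 - a₀) + c| ≤ 1 / 100 ∧ |(p.2 - n₂) / (p.1 - b₀) - c| ≤ 1 / 100 ∧
      |p.1 * (p.1 - a₀) * (3 - ((p.2 - n₁) / (p.1 - a₀)) ^ 2) - (sig a - T) / a₀| ≤ r₂ / |a₀| ∧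
      |p.1 * (p.1 - b₀) * (3 - ((p.2 - n₂) / (p.1 - b₀)) ^ 2) - (sig b - T) / b₀| ≤ r₁ / |b₀|}
    with hP
  have mP : MeasurableSet P := by
    refine measurableSet_and (measurableSet_and ?_ ?_) (measurableSet_and
      (measurableSet_and ?_ ?_) (measurableSet_and (measurableSet_and ?_ ?_)
      (measurableSet_and ?_ (measurableSet_and ?_ (measurableSet_and ?_ ?_))))) <;>
    exact measurableSet_le (by fun_prop) (by fun_prop)
  have hPv : volume P ≤ ENNReal.ofReal (512 * (r₁ * r₂ / (d * N ^ 3))) := by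
    refine (volume_resonance_plane_le hd hdN hc hε _ _ (by positivity)).trans ?_
    refine ENNReal.ofReal_le_ofReal ?_
    calc 64 / N ^ 2 * (r₂ / |a₀| * (r₁ / |b₀|))
        ≤ 64 / N ^ 2 * (r₂ / (d / 2) * (r₁ / (N / 4))) := by
          rw [abs_of_pos hb0]
          gcongr
          exact ha.1
      _ = _ := by field_simp; ring
  have mS : MeasurableSet {p : ℝ × ℝ | (p.1, p.2, T) ∈ Q} :=
    (show Measurable fun p : ℝ × ℝ => (p.1, p.2, T) by fun_prop) mQ
  refine (volume_le_mul_of_fiber (K := ENNReal.ofReal (2 * N)) mS mP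
    (Filter.Eventually.of_forall fun x => ?_)).trans ((mul_le_mul_right hPv _).trans ?_)
  swap
  · rw [← ENNReal.ofReal_mul (by linarith)]
    refine ENNReal.ofReal_le_ofReal (le_of_eq ?_)
    field_simp
    ring
  by_cases hx : N / 2 ≤ x ∧ x ≤ 2 * N
  swap
  · have : Prod.mk x ⁻¹' {p : ℝ × ℝ | (p.1, p.2, T) ∈ Q} = ∅ := by
      ext y
      simp only [mem_preimage, mem_ofPred_eq, mem_empty_iff_false, iff_false, hQ]
      exact fun h => hx h.1
    rw [this]; simp
  have hx0 : 0 < x := by linarith [hx.1]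
  have he1 : N / 4 ≤ x - a₀ := by linarith
  have he2 : x - a₀ ≤ 4 * N := by linarith
  have he0 : 0 < x - a₀ := by linarith
  have hsub : Prod.mk x ⁻¹' {p : ℝ × ℝ | (p.1, p.2, T) ∈ Q} ⊆
      {y : ℝ | (y - 0) / x ∈ Prod.mk x ⁻¹' P} := by
    rintro y ⟨-, hf, ⟨h3, h4⟩, h5, h6⟩
    simp only at hf h3 h4 h5 h6
    -- From here on the slope n replaces the frequency y.
    obtain ⟨n, rfl⟩ : ∃ n, y = x * n := ⟨y / x, by field_simp⟩
    have hy : (x * n - 0) / x = n := by field_simp; ring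
    have hf0 : x - b₀ ≠ 0 := by
      intro h0
      rw [h0, mul_zero] at hf
      linarith [hf.1]
    have hfa : d / 2 ≤ |x - b₀| := by
      rcases hε with h | h
      · rw [h, one_mul] at hf; exact hf.1.trans (le_abs_self _)
      · rw [h, neg_one_mul] at hf; exact hf.1.trans (neg_le_abs _)
    have r3 : T + omega x (x * n) - a 2 - omega (x - a₀) (x * n - a 1) =
        T - sig a + a₀ * (x * (x - a₀) * (3 - ((n - n₁) / (x - a₀)) ^ 2)) := by
      have := omega_sub_sub he0.ne' n n₁
      rw [← ha1] at this
      rw [sig]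
      linear_combination this
    have r4 : T + omega x (x * n) - b 2 - omega (x - b₀) (x * n - b 1) =
        T - sig b + b₀ * (x * (x - b₀) * (3 - ((n - n₂) / (x - b₀)) ^ 2)) := by
      have := omega_sub_sub hf0 n n₂
      rw [← hb1] at this
      rw [sig]
      linear_combination this
    rw [r3] at h3
    rw [r4] at h4
    set p := (n - n₁) / (x - a₀) with hp
    set q := (n - n₂) / (x - b₀) with hq
    have s1 : n₁ - (x * n - a 1) / (x - a₀) = -(x * p) := by
      rw [ha1, hp]; field_simp; ring
    have s2 : (x * n - b 1) / (x - b₀) - n₂ = x * q := by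
      rw [hb1, hq]; field_simp; ring
    have hp1 : c * p ≤ 0 := by
      rw [s1] at h5
      by_contra hh
      push Not at hh
      have := mul_pos hx0 hh
      linarith
    have hq1 : 0 ≤ c * q := by
      rw [s2] at h6
      by_contra hh
      push Not at hh
      have := mul_pos hx0 (neg_pos.2 hh)
      linarith
    have hdN : 0 < d * N ^ 2 := by positivity
    -- The product of the three frequencies is at least dN²/16, so a resonance function of size
    -- dN²/1600 forces the bracket w = 3-p² below 1/100.
    have small : ∀ u v w s R : ℝ, |s + u * (x * v * w)| ≤ R → |s| + R ≤ d * N ^ 2 / 1600 →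
        d * N / 8 ≤ |u| * |v| → |w| ≤ 1 / 100 := by
      intro u v w s R hR hsR huv
      have k1 : |u * (x * v * w)| ≤ d * N ^ 2 / 1600 := by
        calc |u * (x * v * w)| = |(s + u * (x * v * w)) - s| := by congr 1; ring
          _ ≤ _ := abs_sub _ _
          _ ≤ _ := by linarith
      have k2 : |u * (x * v * w)| = x * (|u| * |v|) * |w| := by
        rw [abs_mul, abs_mul, abs_mul, abs_of_pos hx0]; ring
      rw [k2] at k1
      have k3 : d * N ^ 2 / 16 ≤ x * (|u| * |v|) := by
        calc d * N ^ 2 / 16 = N / 2 * (d * N / 8) := by ring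
          _ ≤ _ := by gcongr; exact hx.1
      by_contra hw
      push Not at hw
      have : d * N ^ 2 / 16 * (1 / 100) < x * (|u| * |v|) * |w| :=
        mul_lt_mul' k3 hw (by norm_num) (by linarith)
      linarith
    have w1 : |3 - p ^ 2| ≤ 1 / 100 := by
      refine small a₀ (x - a₀) _ (T - sig a) r₂ h3 ?_ ?_
      · have := abs_sub T (sig a)
        linarith
      · rw [abs_of_pos he0]
        calc d * N / 8 = d / 2 * (N / 4) := by ring
          _ ≤ _ := by gcongr; exact ha.1
    have w2 : |3 - q ^ 2| ≤ 1 / 100 := by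
      refine small b₀ (x - b₀) _ (T - sig b) r₁ h4 ?_ ?_
      · have := abs_sub T (sig b)
        linarith
      · rw [abs_of_pos hb0]
        calc d * N / 8 = N / 4 * (d / 2) := by ring
          _ ≤ _ := by gcongr
    have v1 : |p + c| ≤ 1 / 100 := abs_add_le_of_sq_sub_le hc hp1 w1
    have v2 : |q - c| ≤ 1 / 100 := by
      have := abs_add_le_of_sq_sub_le (c := -c) (by rw [neg_sq, hc]) (by linarith) w2
      rwa [← sub_eq_add_neg] at this
    have box : ∀ u W s R : ℝ, u ≠ 0 → |T - s + u * W| ≤ R → |W - (s - T) / u| ≤ R / |u| := by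
      intro u W s R hu hR
      rw [le_div_iff₀ (abs_pos.2 hu), ← abs_mul, sub_mul, div_mul_cancel₀ _ hu,
        show W * u - (s - T) = T - s + u * W by ring]
      exact hR
    simp only [mem_ofPred_eq, mem_preimage, hP, hy]
    exact ⟨hx, ⟨he1, he2⟩, hf, v1, v2, box _ _ _ _ ha0 h3, box _ _ _ _ hb0.ne' h4⟩
  refine (measure_mono hsub).trans ?_
  rw [volume_affine_preimage hx0]
  exact mul_le_mul_left (ENNReal.ofReal_le_ofReal hx.2) _

/-! ### `L²` estimates for convolutions of functions of bounded modulation -/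

theorem omega_neg (x y : ℝ) : omega (-x) (-y) = -omega x y := by
  unfold omega
  rw [neg_sq, div_neg]
  ring

theorem sig_neg (z : E3) : sig (-z) = -sig z := by
  simp only [sig, PiLp.neg_apply, omega_neg]
  ring

theorem volume_low_interaction_le {D N : ℝ} (hD : 0 < D) (hDN : 8 * D ≤ N) {r₁ r₂ : ℝ}
    (h₁ : 0 ≤ r₁) (h₂ : 0 ≤ r₂) {z : E3} (hz : N / 2 ≤ |z 0|) :
    volume {w : E3 | |sig w| ≤ r₁ ∧ |w 0| ≤ D ∧ |sig (z - w)| ≤ r₂} ≤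
      ENNReal.ofReal (80 * (r₁ * r₂ * D / N)) := by
  have hN : 0 < N := by linarith
  set Q : Set (ℝ × ℝ × ℝ) := {q | |q.1| ≤ D ∧
    |omega q.1 q.2.1 + omega (z 0 - q.1) (z 1 - q.2.1) - (z 2 - q.2.2)| ≤ r₂} with hQ
  have mQ : MeasurableSet Q := measurableSet_and (measurableSet_le (by fun_prop) (by fun_prop))
    (measurableSet_le (by fun_prop) (by fun_prop))
  have hsub : {w : E3 | |sig w| ≤ r₁ ∧ |w 0| ≤ D ∧ |sig (z - w)| ≤ r₂} ⊆
      {w : E3 | |sig w| ≤ r₁ ∧ (w 0, w 1, sig w) ∈ Q} := by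
    rintro w ⟨h1, h2, h3⟩
    refine ⟨h1, h2, ?_⟩
    rw [← abs_neg]
    simp only [sig, PiLp.sub_apply] at h3 ⊢
    convert h3 using 2
    ring
  refine (measure_mono hsub).trans ((volume_modulation_le mQ
    (M := ENNReal.ofReal (40 * (r₂ * D / N))) fun T _ => ?_).trans ?_)
  · refine (volume_omega_add_low_le hD (by linarith) (z 1) (z 2 - T) h₂).trans ?_
    refine ENNReal.ofReal_le_ofReal ?_
    calc 20 * (r₂ * D / |z 0|) ≤ 20 * (r₂ * D / (N / 2)) := by gcongr
      _ = _ := by field_simp; ring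
  · rw [← ENNReal.ofReal_mul (by linarith)]
    exact ENNReal.ofReal_le_ofReal (le_of_eq (by ring))

/-- On a slice of constant modulation of w, the condition on z-w is a level-set condition for the
sum of two dispersion relations. Positivity of both frequencies makes it elliptic, so no power of
the frequencies appears. -/
theorem volume_positive_interaction_le {r₁ r₂ : ℝ} (h₁ : 0 ≤ r₁) (h₂ : 0 ≤ r₂) (z : E3) :
    volume {w : E3 | |sig w| ≤ r₁ ∧ (0 < w 0 ∧ w 0 < z 0) ∧ |sig (z - w)| ≤ r₂} ≤
      ENNReal.ofReal (4 * (r₁ * r₂)) := by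
  set Q : Set (ℝ × ℝ × ℝ) := {q | (0 < q.1 ∧ q.1 < z 0) ∧
    |omega q.1 q.2.1 + omega (z 0 - q.1) (z 1 - q.2.1) - (z 2 - q.2.2)| ≤ r₂} with hQ
  have mQ : MeasurableSet Q := measurableSet_and (measurableSet_and
    (measurableSet_lt (by fun_prop) (by fun_prop)) (measurableSet_lt (by fun_prop) (by fun_prop)))
    (measurableSet_le (by fun_prop) (by fun_prop))
  have hsub : {w : E3 | |sig w| ≤ r₁ ∧ (0 < w 0 ∧ w 0 < z 0) ∧ |sig (z - w)| ≤ r₂} ⊆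
      {w : E3 | |sig w| ≤ r₁ ∧ (w 0, w 1, sig w) ∈ Q} := by
    rintro w ⟨h1, h2, h3⟩
    refine ⟨h1, h2, ?_⟩
    rw [← abs_neg]
    simp only [sig, PiLp.sub_apply] at h3 ⊢
    convert h3 using 2
    ring
  refine (measure_mono hsub).trans ((volume_modulation_le mQ
    (M := ENNReal.ofReal (2 * r₂)) fun T _ =>
      volume_omega_add_pos_le (z 0) (z 1) (z 2 - T) h₂).trans ?_)
  rw [← ENNReal.ofReal_mul (by linarith)]
  exact ENNReal.ofReal_le_ofReal (le_of_eq (by ring))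

/-- The points with `a ≤ |ξ| ≤ b` of modulation at most `r`. -/
def shell (a b r : ℝ) : Set E3 := {z | |sig z| ≤ r ∧ a ≤ |z 0| ∧ |z 0| ≤ b}

theorem measurableSet_shell (a b r : ℝ) : MeasurableSet (shell a b r) :=
  measurableSet_and (measurableSet_le (by fun_prop) (by fun_prop)) (measurableSet_and
    (measurableSet_le (by fun_prop) (by fun_prop)) (measurableSet_le (by fun_prop) (by fun_prop)))

/-- The points of modulation at most `r`. -/
def modSet (r : ℝ) : Set E3 := {z | |sig z| ≤ r}

theorem neg_mem_shell {a b r : ℝ} {z : E3} : -z ∈ shell a b r ↔ z ∈ shell a b r := by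
  simp [shell, sig_neg]

theorem neg_mem_modSet {r : ℝ} {z : E3} : -z ∈ modSet r ↔ z ∈ modSet r := by
  simp [modSet, sig_neg]

/-- Only an upper bound on the low frequency is needed, so this estimate also serves k₁ = 0, where
the low frequency may approach zero. -/
theorem lconv_low_sq_le {D N b : ℝ} (hD : 0 < D) (hDN : 8 * D ≤ N) {r₁ r₂ r₃ : ℝ}
    (h₁ : 0 ≤ r₁) (h₂ : 0 ≤ r₂) {f g : E3 → ℝ≥0∞} (hf : Measurable f) (hg : Measurable g)
    (sf : ∀ z, f z ≠ 0 → z ∈ shell 0 D r₁) (sg : ∀ z, g z ≠ 0 → z ∈ modSet r₂) :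
    ∫⁻ z in shell (N / 2) b r₃, lconv volume f g z ^ 2 ≤
      ENNReal.ofReal (80 * (r₁ * r₂ * D / N)) * ((∫⁻ z, f z ^ 2) * ∫⁻ z, g z ^ 2) := by
  refine lintegral_lconv_sq_le hf hg (measurableSet_shell _ _ _) fun z hz => ?_
  refine (measure_mono ?_).trans (volume_low_interaction_le hD hDN h₁ h₂ hz.2.1)
  rintro w ⟨hw1, hw2⟩
  exact ⟨(sf w hw1).1, (sf w hw1).2.2, sg _ hw2⟩

theorem lconv_reflect (f g : E3 → ℝ≥0∞) (z : E3) :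
    lconv volume (fun w => f (-w)) (fun w => g (-w)) z = lconv volume f g (-z) := by
  unfold lconv
  rw [← lintegral_neg_eq_self]
  refine lintegral_congr fun w => ?_
  simp only [neg_neg]
  congr 2
  abel

/-- Reduction of a bilinear estimate with a low-frequency factor `f` to positive output frequency,
positive high frequency and a low frequency of constant sign. -/
theorem lconv_sq_le_of_signed {d N b : ℝ} (hd : 0 < d) (hdN : d ≤ N / 32) {r₁ r₂ r₃ : ℝ}
    {M : ℝ≥0∞}
    (H : ∀ (ε : ℝ) (f g : E3 → ℝ≥0∞), (ε = 1 ∨ ε = -1) → Measurable f → Measurable g →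
      (∀ z, f z ≠ 0 → z ∈ shell (d / 2) (2 * d) r₁ ∧ |z 0| = ε * z 0) →
      (∀ z, g z ≠ 0 → z ∈ modSet r₂ ∧ 0 < z 0) → ∫⁻ z, f z ^ 2 ≠ ⊤ → ∫⁻ z, g z ^ 2 ≠ ⊤ →
      ∫⁻ z in shell (N / 2) b r₃ ∩ {z | 0 < z 0}, lconv volume f g z ^ 2 ≤
        M * ((∫⁻ z, f z ^ 2) * ∫⁻ z, g z ^ 2))
    {f g : E3 → ℝ≥0∞} (hf : Measurable f) (hg : Measurable g)
    (sf : ∀ z, f z ≠ 0 → z ∈ shell (d / 2) (2 * d) r₁) (sg : ∀ z, g z ≠ 0 → z ∈ modSet r₂)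
    (hf2 : ∫⁻ z, f z ^ 2 ≠ ⊤) (hg2 : ∫⁻ z, g z ^ 2 ≠ ⊤) :
    ∫⁻ z in shell (N / 2) b r₃, lconv volume f g z ^ 2 ≤
      4 * M * ((∫⁻ z, f z ^ 2) * ∫⁻ z, g z ^ 2) := by
  have hN : 0 < N := by linarith
  have mpos : MeasurableSet {z : E3 | 0 < z 0} := measurableSet_lt (by fun_prop) (by fun_prop)
  -- positive output
  have Hpos : ∀ f g : E3 → ℝ≥0∞, Measurable f → Measurable g →
      (∀ z, f z ≠ 0 → z ∈ shell (d / 2) (2 * d) r₁) → (∀ z, g z ≠ 0 → z ∈ modSet r₂) →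
      ∫⁻ z, f z ^ 2 ≠ ⊤ → ∫⁻ z, g z ^ 2 ≠ ⊤ →
      ∫⁻ z in shell (N / 2) b r₃ ∩ {z | 0 < z 0}, lconv volume f g z ^ 2 ≤
        2 * M * ((∫⁻ z, f z ^ 2) * ∫⁻ z, g z ^ 2) := by
    intro f g hf hg sf sg hf2 hg2
    set P : Set E3 := {z | 0 < z 0} with hP
    set fp := P.indicator f with hfp
    set fm := Pᶜ.indicator f with hfm
    set gp := P.indicator g with hgp
    have mfp : Measurable fp := hf.indicator mpos
    have mfm : Measurable fm := hf.indicator mpos.compl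
    have mgp : Measurable gp := hg.indicator mpos
    have hgp2 : ∀ z, gp z ≠ 0 → z ∈ modSet r₂ ∧ 0 < z 0 := by
      intro z hz
      have hzP : z ∈ P := by by_contra h; exact hz (by simp [hgp, h])
      rw [hgp, indicator_of_mem hzP] at hz
      exact ⟨sg z hz, hzP⟩
    have hfp2 : ∫⁻ z, fp z ^ 2 ≠ ⊤ := ne_top_of_le_ne_top hf2
      (lintegral_mono fun z => pow_le_pow_left' (indicator_le_self _ _ z) 2)
    have hfm2 : ∫⁻ z, fm z ^ 2 ≠ ⊤ := ne_top_of_le_ne_top hf2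
      (lintegral_mono fun z => pow_le_pow_left' (indicator_le_self _ _ z) 2)
    have hgle : ∫⁻ z, gp z ^ 2 ≤ ∫⁻ z, g z ^ 2 :=
      lintegral_mono fun z => pow_le_pow_left' (indicator_le_self _ _ z) 2
    have hgp2' := ne_top_of_le_ne_top hg2 hgle
    have k1 := H 1 fp gp (Or.inl rfl) mfp mgp (by
      intro z hz
      have hzP : z ∈ P := by by_contra h; exact hz (by simp [hfp, h])
      rw [hfp, indicator_of_mem hzP] at hz
      exact ⟨sf z hz, by rw [one_mul]; exact abs_of_pos hzP⟩) hgp2 hfp2 hgp2'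
    have k2 := H (-1) fm gp (Or.inr rfl) mfm mgp (by
      intro z hz
      have hzP : z ∈ Pᶜ := by by_contra h; exact hz (by simp [hfm, indicator_of_notMem h])
      rw [hfm, indicator_of_mem hzP] at hz
      exact ⟨sf z hz, by rw [neg_one_mul]; exact abs_of_nonpos (not_lt.1 hzP)⟩) hgp2 hfm2 hgp2'
    have hfsum : (∫⁻ z, fp z ^ 2) + ∫⁻ z, fm z ^ 2 = ∫⁻ z, f z ^ 2 := by
      rw [← lintegral_add_left (mfp.pow_const 2)]
      refine lintegral_congr fun z => ?_
      by_cases hz : z ∈ P <;> simp [hfp, hfm, hz]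
    have mE : MeasurableSet (shell (N / 2) b r₃ ∩ P) := (measurableSet_shell _ _ _).inter mpos
    calc ∫⁻ z in shell (N / 2) b r₃ ∩ P, lconv volume f g z ^ 2
        ≤ ∫⁻ z in shell (N / 2) b r₃ ∩ P,
            (2 * lconv volume fp gp z ^ 2 + 2 * lconv volume fm gp z ^ 2) := by
          refine setLIntegral_mono' mE fun z hz => ?_
          have e : lconv volume f g z = lconv volume fp gp z + lconv volume fm gp z := by
            unfold lconv
            rw [← lintegral_add_left (by fun_prop)]
            refine lintegral_congr fun w => ?_
            by_cases hw0 : f w = 0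
            · by_cases hw : w ∈ P <;> simp [hfp, hfm, hw, hw0]
            -- The output frequency is at least N/2 and the low one at most N/16 in absolute value,
            -- so the high-frequency factor contributes only through its positive part.
            · have hzw : z - w ∈ P := by
                have h1 := (sf w hw0).2.2
                have h2 := hz.1.2.1
                rw [abs_of_pos hz.2] at h2
                have := le_abs_self (w 0)
                simp only [hP, mem_ofPred_eq, PiLp.sub_apply]
                linarith
              by_cases hw : w ∈ P <;> simp [hfp, hfm, hgp, hw, hzw]
          rw [e]
          have := two_mul_le_sq_add_sq (lconv volume fp gp z) (lconv volume fm gp z)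
          calc _ = lconv volume fp gp z ^ 2 + lconv volume fm gp z ^ 2 +
                2 * (lconv volume fp gp z * lconv volume fm gp z) := by ring
            _ ≤ lconv volume fp gp z ^ 2 + lconv volume fm gp z ^ 2 +
                (lconv volume fp gp z ^ 2 + lconv volume fm gp z ^ 2) := by gcongr
            _ = _ := by ring
      _ = 2 * (∫⁻ z in shell (N / 2) b r₃ ∩ P, lconv volume fp gp z ^ 2) +
            2 * ∫⁻ z in shell (N / 2) b r₃ ∩ P, lconv volume fm gp z ^ 2 := by
          have m1 := (measurable_lconv (μ := volume) mfp mgp).pow_const 2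
          have m2 := (measurable_lconv (μ := volume) mfm mgp).pow_const 2
          rw [lintegral_add_left (m1.const_mul 2), lintegral_const_mul _ m1,
            lintegral_const_mul _ m2]
      _ ≤ 2 * (M * ((∫⁻ z, fp z ^ 2) * ∫⁻ z, g z ^ 2)) +
            2 * (M * ((∫⁻ z, fm z ^ 2) * ∫⁻ z, g z ^ 2)) := by
          refine add_le_add (mul_le_mul_right (k1.trans ?_) _) (mul_le_mul_right (k2.trans ?_) _) <;>
            gcongr
      _ = _ := by rw [← hfsum]; ring
  have k1 := Hpos f g hf hg sf sg hf2 hg2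
  -- Since ω is odd, reflection preserves the support conditions and exchanges negative and positive
  -- output frequency.
  have k2 := Hpos (fun z => f (-z)) (fun z => g (-z)) (hf.comp measurable_neg)
    (hg.comp measurable_neg) (fun z hz => neg_mem_shell.1 (sf _ hz))
    (fun z hz => neg_mem_modSet.1 (sg _ hz))
    (by rwa [lintegral_neg_eq_self (fun z => f z ^ 2)])
    (by rwa [lintegral_neg_eq_self (fun z => g z ^ 2)])
  rw [lintegral_neg_eq_self (fun z => f z ^ 2), lintegral_neg_eq_self (fun z => g z ^ 2)] at k2
  have mS := measurableSet_shell (N / 2) b r₃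
  have k3 : ∫⁻ z in shell (N / 2) b r₃ ∩ {z | 0 < z 0},
      lconv volume (fun w => f (-w)) (fun w => g (-w)) z ^ 2 =
      ∫⁻ z in shell (N / 2) b r₃ ∩ {z | z 0 < 0}, lconv volume f g z ^ 2 := by
    rw [← lintegral_indicator (mS.inter mpos), ← lintegral_indicator (mS.inter
      (measurableSet_lt (by fun_prop) (by fun_prop))), ← lintegral_neg_eq_self]
    refine lintegral_congr fun z => ?_
    have e : -z ∈ shell (N / 2) b r₃ ∩ {z | 0 < z 0} ↔
        z ∈ shell (N / 2) b r₃ ∩ {z | z 0 < 0} := by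
      rw [mem_inter_iff, mem_inter_iff, neg_mem_shell]
      simp
    by_cases h : z ∈ shell (N / 2) b r₃ ∩ {z | z 0 < 0}
    · rw [indicator_of_mem h, indicator_of_mem (e.2 h), lconv_reflect, neg_neg]
    · rw [indicator_of_notMem h, indicator_of_notMem (mt e.1 h)]
  rw [k3] at k2
  have hcov : shell (N / 2) b r₃ ⊆ (shell (N / 2) b r₃ ∩ {z | 0 < z 0}) ∪
      (shell (N / 2) b r₃ ∩ {z | z 0 < 0}) := by
    intro z hz
    have h0 : z 0 ≠ 0 := by
      intro h
      have := hz.2.1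
      rw [h, abs_zero] at this
      linarith
    rcases lt_or_gt_of_ne h0 with h | h
    · exact Or.inr ⟨hz, h⟩
    · exact Or.inl ⟨hz, h⟩
  calc ∫⁻ z in shell (N / 2) b r₃, lconv volume f g z ^ 2
      ≤ _ := lintegral_mono_set hcov
    _ ≤ _ := lintegral_union_le _ _ _
    _ ≤ _ := add_le_add k1 k2
    _ = _ := by ring

/-- Only finiteness matters here: it licenses the division in the duality argument, and the crude
low-frequency bound supplies it. -/
theorem lconv_sq_ne_top {d N b : ℝ} (hd : 0 < d) (hdN : d ≤ N / 32) {r₁ r₂ r₃ : ℝ} (h₁ : 0 ≤ r₁)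
    (h₂ : 0 ≤ r₂) {f g : E3 → ℝ≥0∞} (hf : Measurable f) (hg : Measurable g)
    (sf : ∀ z, f z ≠ 0 → z ∈ shell (d / 2) (2 * d) r₁) (sg : ∀ z, g z ≠ 0 → z ∈ modSet r₂)
    (hf2 : ∫⁻ z, f z ^ 2 ≠ ⊤) (hg2 : ∫⁻ z, g z ^ 2 ≠ ⊤) :
    ∫⁻ z in shell (N / 2) b r₃ ∩ {z | 0 < z 0}, lconv volume f g z ^ 2 ≠ ⊤ :=
  ne_top_of_le_ne_top (ENNReal.mul_ne_top ENNReal.ofReal_ne_top (ENNReal.mul_ne_top hf2 hg2))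
    ((lintegral_mono_set inter_subset_left).trans
      (lconv_low_sq_le (D := 2 * d) (by linarith) (by linarith) h₁ h₂ hf hg
        (fun z hz => ⟨(sf z hz).1, abs_nonneg _, (sf z hz).2.2⟩) sg))

/-- The bilinear Strichartz-type estimate not using the modulation of the low-frequency factor. -/
theorem lconv_sq_le_high {d N b : ℝ} (hd : 0 < d) (hdN : d ≤ N / 32) {r₁ r₂ r₃ : ℝ} (h₁ : 0 ≤ r₁)
    (h₂ : 0 ≤ r₂) (h₃ : 0 ≤ r₃) {f g : E3 → ℝ≥0∞} (hf : Measurable f) (hg : Measurable g)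
    (sf : ∀ z, f z ≠ 0 → z ∈ shell (d / 2) (2 * d) r₁) (sg : ∀ z, g z ≠ 0 → z ∈ modSet r₂)
    (hf2 : ∫⁻ z, f z ^ 2 ≠ ⊤) (hg2 : ∫⁻ z, g z ^ 2 ≠ ⊤) :
    ∫⁻ z in shell (N / 2) b r₃, lconv volume f g z ^ 2 ≤
      4 * ENNReal.ofReal (4 * (r₃ * r₂)) * ((∫⁻ z, f z ^ 2) * ∫⁻ z, g z ^ 2) := by
  refine lconv_sq_le_of_signed hd hdN (fun ε f g _ hf hg sf sg hf2 hg2 => ?_) hf hg sf sg hf2 hg2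
  have mE : MeasurableSet (shell (N / 2) b r₃ ∩ {z : E3 | 0 < z 0}) :=
    (measurableSet_shell _ _ _).inter (measurableSet_lt (by fun_prop) (by fun_prop))
  -- Duality moves the counting from the pair (f,g) to the pair (dual function, g), both of positive
  -- frequency, where the elliptic bound applies and r₁ disappears.
  refine lintegral_lconv_sq_le_of_correlation hf hg mE
    (lconv_sq_ne_top hd hdN h₁ h₂ hf hg (fun z hz => (sf z hz).1) (fun z hz => (sg z hz).1) hf2 hg2)
    fun h hh sh => lintegral_correlation_sq_le hg hh fun z => ?_
  refine (measure_mono ?_).trans (volume_positive_interaction_le h₃ h₂ z)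
  rintro w ⟨hw1, hw2⟩
  have hwE : w ∈ shell (N / 2) b r₃ ∩ {z : E3 | 0 < z 0} := by
    by_contra hc; exact hw1 (sh w hc)
  have := (sg _ hw2).2
  rw [PiLp.sub_apply] at this
  exact ⟨hwE.1.1, ⟨hwE.2, by linarith⟩, (sg _ hw2).1⟩

/-- The bilinear Strichartz-type estimate not using the modulation of the high-frequency factor. -/
theorem lconv_sq_le_low {d N b : ℝ} (hd : 0 < d) (hdN : d ≤ N / 32) {r₁ r₂ r₃ : ℝ} (h₁ : 0 ≤ r₁)
    (h₂ : 0 ≤ r₂) (h₃ : 0 ≤ r₃) {f g : E3 → ℝ≥0∞} (hf : Measurable f) (hg : Measurable g)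
    (sf : ∀ z, f z ≠ 0 → z ∈ shell (d / 2) (2 * d) r₁) (sg : ∀ z, g z ≠ 0 → z ∈ modSet r₂)
    (hf2 : ∫⁻ z, f z ^ 2 ≠ ⊤) (hg2 : ∫⁻ z, g z ^ 2 ≠ ⊤) :
    ∫⁻ z in shell (N / 2) b r₃, lconv volume f g z ^ 2 ≤
      4 * ENNReal.ofReal (4 * (r₃ * r₁)) * ((∫⁻ z, f z ^ 2) * ∫⁻ z, g z ^ 2) := by
  refine lconv_sq_le_of_signed hd hdN (fun ε f g hε hf hg sf sg hf2 hg2 => ?_) hf hg sf sg hf2 hg2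
  have mE : MeasurableSet (shell (N / 2) b r₃ ∩ {z : E3 | 0 < z 0}) :=
    (measurableSet_shell _ _ _).inter (measurableSet_lt (by fun_prop) (by fun_prop))
  have hfin := lconv_sq_ne_top (b := b) (r₃ := r₃) hd hdN h₁ h₂ hf hg
    (fun z hz => (sf z hz).1) (fun z hz => (sg z hz).1) hf2 hg2
  have hcomm : lconv volume f g = lconv volume g f := funext fun z => lconv_comm _ _ _
  rw [hcomm] at hfin ⊢
  rw [mul_comm (∫⁻ z, f z ^ 2)]
  refine lintegral_lconv_sq_le_of_correlation hg hf mE hfin fun h hh sh => ?_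
  have hz : ∀ w, h w ≠ 0 → w ∈ shell (N / 2) b r₃ ∩ {z : E3 | 0 < z 0} := fun w hw => by
    by_contra hc; exact hw (sh w hc)
  rcases hε with rfl | rfl
  · refine lintegral_correlation_sq_le hf hh fun z => ?_
    refine (measure_mono ?_).trans (volume_positive_interaction_le h₃ h₁ z)
    rintro w ⟨hw1, hw2⟩
    obtain ⟨⟨k1, k2, -⟩, k3⟩ := sf _ hw2
    have : 0 < (z - w) 0 := by rw [one_mul] at k3; rw [← k3]; linarith
    rw [PiLp.sub_apply] at this
    exact ⟨(hz w hw1).1.1, ⟨(hz w hw1).2, by linarith⟩, k1⟩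
  -- For negative low frequency the correlation is the convolution of h with the reflection of f;
  -- that reflection has positive frequency, so the elliptic count applies directly.
  · have e : ∀ w, ∫⁻ z, f (z - w) * h z = lconv volume h (fun v => f (-v)) w := by
      intro w
      unfold lconv
      refine lintegral_congr fun z => ?_
      simp only [neg_sub]
      rw [mul_comm]
    simp_rw [e]
    have k := lintegral_lconv_sq_le (μ := volume) hh (hf.comp measurable_neg) MeasurableSet.univ
      (M := ENNReal.ofReal (4 * (r₃ * r₁))) fun w _ => ?_
    · rw [setLIntegral_univ] at k
      refine k.trans (le_of_eq ?_)
      simp only [Function.comp_apply]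
      rw [lintegral_neg_eq_self (fun z => f z ^ 2), mul_comm (∫⁻ z, h z ^ 2)]
    · refine (measure_mono ?_).trans (volume_positive_interaction_le h₃ h₁ w)
      rintro z ⟨hw1, hw2⟩
      simp only [Function.comp_apply] at hw2
      obtain ⟨⟨k1, k2, -⟩, k3⟩ := sf _ hw2
      rw [sig_neg, abs_neg] at k1
      have : (-(w - z)) 0 < 0 := by
        by_contra hc
        push Not at hc
        rw [abs_of_nonneg hc] at k3 k2
        linarith
      simp only [PiLp.neg_apply, PiLp.sub_apply] at this
      exact ⟨(hz z hw1).1.1, ⟨(hz z hw1).2, by linarith⟩, k1⟩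

/-- The resonant bilinear estimate. -/
theorem lconv_sq_le_resonant {d N : ℝ} (hd : 0 < d) (hdN : d ≤ N / 32) {r₁ r₂ r₃ : ℝ} (h₁ : 0 ≤ r₁)
    (h₂ : 0 ≤ r₂) (h₃ : 0 ≤ r₃) (hr : r₁ + r₂ + r₃ ≤ d * N ^ 2 / 1600)
    {f g : E3 → ℝ≥0∞} (hf : Measurable f) (hg : Measurable g)
    (sf : ∀ z, f z ≠ 0 → z ∈ shell (d / 2) (2 * d) r₁) (sg : ∀ z, g z ≠ 0 → z ∈ modSet r₂)
    (hf2 : ∫⁻ z, f z ^ 2 ≠ ⊤) (hg2 : ∫⁻ z, g z ^ 2 ≠ ⊤) :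
    ∫⁻ z in shell (N / 2) (2 * N) r₃, lconv volume f g z ^ 2 ≤
      4 * (4 * ENNReal.ofReal (2048 * (r₁ * r₂ * r₃ / (d * N ^ 2)))) *
        ((∫⁻ z, f z ^ 2) * ∫⁻ z, g z ^ 2) := by
  refine lconv_sq_le_of_signed hd hdN (fun ε f g hε hf hg sf sg _ _ => ?_) hf hg sf sg hf2 hg2
  set E : Set E3 := shell (N / 2) (2 * N) r₃ ∩ {z : E3 | 0 < z 0} with hE
  have mE : MeasurableSet E :=
    (measurableSet_shell _ _ _).inter (measurableSet_lt (by fun_prop) (by fun_prop))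
  -- For c = √3 and c = -√3 these relations cover all pairs. Each is compatible with only one sheet,
  -- which forces the two decompositions of z onto lines of opposite slopes.
  set R : ℝ → Set (E3 × E3) := fun c => {p | 0 ≤ c * (slope p.1 - slope p.2)} with hR
  have mR : ∀ c, MeasurableSet (R c) := fun c => measurableSet_le (by fun_prop) (by fun_prop)
  set K : ℝ → E3 → ℝ≥0∞ := fun c z =>
    ∫⁻ w, f w * g (z - w) * (R c).indicator 1 (w, z - w) with hK
  have mind : ∀ c, Measurable ((R c).indicator (1 : E3 × E3 → ℝ≥0∞)) := fun c =>
    measurable_one.indicator (mR c)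
  have mK : ∀ c, Measurable (K c) := by
    intro c
    have := mind c
    apply Measurable.lintegral_prod_right'
      (f := fun p : E3 × E3 => f p.2 * g (p.1 - p.2) * (R c).indicator 1 (p.2, p.1 - p.2))
    fun_prop
  set M := ENNReal.ofReal (2048 * (r₁ * r₂ * r₃ / (d * N ^ 2))) with hM
  have key : ∀ c : ℝ, c ^ 2 = 3 → ∫⁻ z in E, K c z ^ 2 ≤
      M * ((∫⁻ z, f z ^ 2) * ∫⁻ z, g z ^ 2) := by
    intro c hc
    refine lintegral_lconv_restrict_sq_le hf hg (mR c) mE fun a b ha hb => ?_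
    obtain ⟨⟨a1, a2, a3⟩, -⟩ := sf a ha
    obtain ⟨b1, -⟩ := sg b hb
    refine (measure_mono ?_).trans (volume_resonance_le hd hdN hc hε h₁ h₂ h₃ hr ⟨a2, a3⟩ a1 b1)
    rintro z ⟨⟨⟨z1, z2, z3⟩, z4⟩, z5, z6, z7, z8⟩
    obtain ⟨⟨k1, k2, k3⟩, k4⟩ := sf _ z6
    rw [abs_of_pos z4] at z2 z3
    rw [k4, PiLp.sub_apply] at k2 k3
    exact ⟨z1, ⟨z2, z3⟩, ⟨k2, k3⟩, (sg _ z5).1, k1, z7, z8⟩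
  have h3 : (√3) ^ 2 = (3 : ℝ) := Real.sq_sqrt (by norm_num)
  have hle : ∀ z, lconv volume f g z ≤ K (√3) z + K (-√3) z := by
    intro z
    have m1 := mind (√3)
    simp only [hK, lconv]
    rw [← lintegral_add_left (by fun_prop)]
    refine lintegral_mono fun w => ?_
    rw [← mul_add]
    refine le_mul_of_one_le_right' ?_
    rcases le_total 0 (√3 * (slope w - slope (z - w))) with h | h
    · have : (w, z - w) ∈ R (√3) := h
      rw [indicator_of_mem this]
      exact le_self_add
    · have : (w, z - w) ∈ R (-√3) := by
        simp only [hR, mem_ofPred_eq, neg_mul]; linarith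
      rw [indicator_of_mem this]
      exact le_add_self
  calc ∫⁻ z in E, lconv volume f g z ^ 2
      ≤ ∫⁻ z in E, (2 * K (√3) z ^ 2 + 2 * K (-√3) z ^ 2) := by
        refine lintegral_mono fun z => (pow_le_pow_left' (hle z) 2).trans ?_
        have := two_mul_le_sq_add_sq (K (√3) z) (K (-√3) z)
        calc _ = K (√3) z ^ 2 + K (-√3) z ^ 2 + 2 * (K (√3) z * K (-√3) z) := by ring
          _ ≤ K (√3) z ^ 2 + K (-√3) z ^ 2 + (K (√3) z ^ 2 + K (-√3) z ^ 2) := by gcongr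
          _ = _ := by ring
    _ = 2 * (∫⁻ z in E, K (√3) z ^ 2) + 2 * ∫⁻ z in E, K (-√3) z ^ 2 := by
        have m1 := (mK (√3)).pow_const 2
        have m2 := (mK (-√3)).pow_const 2
        rw [lintegral_add_left (m1.const_mul 2), lintegral_const_mul _ m1,
          lintegral_const_mul _ m2]
    _ ≤ 2 * (M * ((∫⁻ z, f z ^ 2) * ∫⁻ z, g z ^ 2)) +
          2 * (M * ((∫⁻ z, f z ^ 2) * ∫⁻ z, g z ^ 2)) :=
        add_le_add (mul_le_mul_right (key _ h3) _)
          (mul_le_mul_right (key _ (by rw [neg_sq, h3])) _)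
    _ = _ := by ring

/-! ### Dyadic summation -/

/-- The powers `2^x` in `[0, ∞]`. -/
def tw (x : ℝ) : ℝ≥0∞ := (2 : ℝ≥0∞) ^ x

theorem tw_add (x y : ℝ) : tw (x + y) = tw x * tw y :=
  ENNReal.rpow_add _ _ (by norm_num) (by norm_num)

theorem tw_mono {x y : ℝ} (h : x ≤ y) : tw x ≤ tw y :=
  ENNReal.rpow_le_rpow_of_exponent_le (by norm_num) h

theorem tw_ne_zero (x : ℝ) : tw x ≠ 0 := by
  simp [tw, ENNReal.rpow_eq_zero_iff]

theorem ofReal_two_rpow (x : ℝ) : ENNReal.ofReal ((2 : ℝ) ^ x) = tw x := by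
  rw [← ENNReal.ofReal_rpow_of_pos (by norm_num)]
  simp [tw]

theorem tw_zero : tw 0 = 1 := by simp [tw]

theorem tw_natCast (n : ℕ) : tw n = 2 ^ n := by simp [tw]

theorem tw_sq (x : ℝ) : tw x ^ 2 = tw (2 * x) := by
  rw [sq, ← tw_add, two_mul]

theorem tsum_tw_le : ∑' m : ℕ, tw (-(m : ℝ) / 2) ≤ 4 := by
  have h1 : ∀ m : ℕ, tw (-(m : ℝ) / 2) = tw (-1 / 2) ^ m := by
    intro m
    unfold tw
    rw [← ENNReal.rpow_mul_natCast]
    congr 1; ring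
  simp_rw [h1]
  rw [ENNReal.tsum_geometric, ENNReal.inv_le_iff_inv_le]
  have h2 : tw (-1 / 2) ≤ ENNReal.ofReal (3 / 4) := by
    rw [← ofReal_two_rpow]
    refine ENNReal.ofReal_le_ofReal ?_
    rw [← Real.sqrt_sq (by positivity : (0 : ℝ) ≤ 2 ^ (-1 / 2 : ℝ)), ← Real.rpow_mul_natCast
      (by norm_num)]
    apply Real.sqrt_le_iff.2
    norm_num
  refine le_trans ?_ (tsub_le_tsub_left h2 1)
  rw [← ENNReal.ofReal_one, ← ENNReal.ofReal_sub _ (by norm_num),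
    show (4 : ℝ≥0∞) = ENNReal.ofReal 4 by norm_num, ← ENNReal.ofReal_inv_of_pos (by norm_num)]
  exact ENNReal.ofReal_le_ofReal (by norm_num)

theorem l2_restrict_le {E : Set E3} {f g h : E3 → ℝ≥0∞} {K : ℝ≥0∞} {y : ℝ}
    (H : ∫⁻ z in E, h z ^ 2 ≤ K * ((∫⁻ z, f z ^ 2) * ∫⁻ z, g z ^ 2)) (hK : K ≤ tw y ^ 2) :
    l2 (volume.restrict E) h ≤ tw y * (l2 volume f * l2 volume g) := by
  refine l2_le_of_sq_le (H.trans ?_)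
  rw [mul_pow, mul_pow, l2_sq, l2_sq]
  exact mul_le_mul_left hK _

theorem abs_le_of_mem_freqSet {k : ℕ} {x : ℝ} (h : x ∈ freqSet k) : |x| ≤ 3 / 2 * 2 ^ k := by
  unfold freqSet at h
  split_ifs at h with hk
  · simp only [mem_iUnion, mem_ofPred_eq, dyadicI] at h
    obtain ⟨j, hj, hx⟩ := h
    refine hx.2.le.trans ?_
    rw [hk, pow_zero]
    refine mul_le_mul_of_nonneg_left ?_ (by norm_num)
    exact zpow_le_one_of_nonpos₀ (by norm_num) hj
  · have := h.2.le
    rwa [zpow_natCast] at this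

theorem le_abs_of_mem_freqSet {k : ℕ} (hk : k ≠ 0) {x : ℝ} (h : x ∈ freqSet k) :
    3 / 4 * 2 ^ k ≤ |x| := by
  rw [freqSet, if_neg hk] at h
  have := h.1
  rwa [zpow_natCast] at this

theorem ofReal_le_tw_sq {a y : ℝ} (h : a ≤ 2 ^ (2 * y)) : ENNReal.ofReal a ≤ tw y ^ 2 := by
  rw [tw_sq, ← ofReal_two_rpow]
  exact ENNReal.ofReal_le_ofReal h

/-! ### The bilinear bounds in powers of two and their sum over output modulations -/

section

variable {k₁ k₃ j₁ j₂ : ℕ} {f g : E3 → ℝ≥0∞}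

theorem two_rpow_eq (a b c d : ℝ) :
    (2 : ℝ) ^ (a + b + c - d) = 2 ^ a * 2 ^ b * 2 ^ c / 2 ^ d := by
  rw [Real.rpow_sub (by norm_num), Real.rpow_add (by norm_num), Real.rpow_add (by norm_num)]

theorem l2_lconv_low_le (hk : k₁ + 5 ≤ k₃) (hf : Measurable f) (hg : Measurable g)
    (sf : ∀ z, f z ≠ 0 → |sig z| ≤ 2 ^ (j₁ + 1) ∧ z 0 ∈ freqSet k₁)
    (sg : ∀ z, g z ≠ 0 → |sig z| ≤ 2 ^ (j₂ + 1)) (b r : ℝ) :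
    l2 (volume.restrict (shell (2 ^ k₃ / 2) b r)) (lconv volume f g) ≤
      tw (5 + ((j₁ : ℝ) + j₂ + k₁ - k₃) / 2) * (l2 volume f * l2 volume g) := by
  have hk' : (2 : ℝ) ^ k₁ * 32 ≤ 2 ^ k₃ := by
    calc (2 : ℝ) ^ k₁ * 32 = 2 ^ (k₁ + 5) := by rw [pow_add]; norm_num
      _ ≤ _ := pow_le_pow_right₀ (by norm_num) hk
  have hd : (0 : ℝ) < 2 ^ k₁ := by positivity
  refine l2_restrict_le (lconv_low_sq_le (D := 3 / 2 * 2 ^ k₁) (by positivity) (by linarith)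
    (by positivity) (by positivity) hf hg
    (fun z hz => ⟨(sf z hz).1, abs_nonneg _, abs_le_of_mem_freqSet (sf z hz).2⟩) sg)
    (ofReal_le_tw_sq ?_)
  rw [show 2 * (5 + ((j₁ : ℝ) + j₂ + k₁ - k₃) / 2) = ((10 : ℕ) : ℝ) + (j₁ + j₂ + k₁ - k₃) by
    push_cast; ring, Real.rpow_add (by norm_num), two_rpow_eq]
  simp only [Real.rpow_natCast, pow_succ _ j₁, pow_succ _ j₂]
  have : 0 ≤ (2 : ℝ) ^ j₁ * 2 ^ j₂ * 2 ^ k₁ / 2 ^ k₃ := by positivity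
  calc 80 * ((2 : ℝ) ^ j₁ * 2 * (2 ^ j₂ * 2) * (3 / 2 * 2 ^ k₁) / 2 ^ k₃)
      = 480 * ((2 : ℝ) ^ j₁ * 2 ^ j₂ * 2 ^ k₁ / 2 ^ k₃) := by ring
    _ ≤ _ := mul_le_mul_of_nonneg_right (by norm_num) this

theorem mem_shell_of_freqSet (hk₁ : k₁ ≠ 0) {z : E3} {r : ℝ} (h : |sig z| ≤ r ∧ z 0 ∈ freqSet k₁) :
    z ∈ shell (2 ^ k₁ / 2) (2 * 2 ^ k₁) r := by
  have h1 := abs_le_of_mem_freqSet h.2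
  have h2 := le_abs_of_mem_freqSet hk₁ h.2
  have h3 : (0 : ℝ) < 2 ^ k₁ := by positivity
  exact ⟨h.1, by linarith, by linarith⟩

/-- The first bound does not see j₁ and serves when j₁ is large; the second does not see j₂; the
third is the resonant one. The offset 14 makes each modulation at most 2^{-13} times 2^{k₁+2k₃}, and
3·2^{-13} ≤ 1/1600. -/
theorem l2_lconv_output_le (hk₁ : k₁ ≠ 0) (hk : k₁ + 5 ≤ k₃) (hf : Measurable f)
    (hg : Measurable g)
    (sf : ∀ z, f z ≠ 0 → |sig z| ≤ 2 ^ (j₁ + 1) ∧ z 0 ∈ freqSet k₁)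
    (sg : ∀ z, g z ≠ 0 → |sig z| ≤ 2 ^ (j₂ + 1))
    (hf2 : ∫⁻ z, f z ^ 2 ≠ ⊤) (hg2 : ∫⁻ z, g z ^ 2 ≠ ⊤) (j : ℕ) :
    l2 (volume.restrict (shell (2 ^ k₃ / 2) (2 * 2 ^ k₃) (2 ^ (j + 1)))) (lconv volume f g) ≤
        tw (3 + ((j : ℝ) + j₂) / 2) * (l2 volume f * l2 volume g) ∧
      l2 (volume.restrict (shell (2 ^ k₃ / 2) (2 * 2 ^ k₃) (2 ^ (j + 1)))) (lconv volume f g) ≤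
        tw (3 + ((j : ℝ) + j₁) / 2) * (l2 volume f * l2 volume g) ∧
      (j₁ + 14 ≤ k₁ + 2 * k₃ → j₂ + 14 ≤ k₁ + 2 * k₃ → j + 14 ≤ k₁ + 2 * k₃ →
        l2 (volume.restrict (shell (2 ^ k₃ / 2) (2 * 2 ^ k₃) (2 ^ (j + 1)))) (lconv volume f g) ≤
          tw (9 + ((j₁ : ℝ) + j₂ + j - (k₁ + 2 * k₃)) / 2) * (l2 volume f * l2 volume g)) := by
  have hk' : (2 : ℝ) ^ k₁ * 32 ≤ 2 ^ k₃ := by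
    calc (2 : ℝ) ^ k₁ * 32 = 2 ^ (k₁ + 5) := by rw [pow_add]; norm_num
      _ ≤ _ := pow_le_pow_right₀ (by norm_num) hk
  have hd : (0 : ℝ) < 2 ^ k₁ := by positivity
  have hdN : (2 : ℝ) ^ k₁ ≤ 2 ^ k₃ / 32 := by linarith
  have sf' := fun z hz => mem_shell_of_freqSet hk₁ (sf z hz)
  have h4 : (4 : ℝ≥0∞) = ENNReal.ofReal 4 := by norm_num
  refine ⟨l2_restrict_le (lconv_sq_le_high hd hdN (by positivity) (by positivity) (by positivity)
      hf hg sf' sg hf2 hg2) ?_, l2_restrict_le (lconv_sq_le_low hd hdN (by positivity)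
      (by positivity) (by positivity) hf hg sf' sg hf2 hg2) ?_, fun h1 h2 h3 =>
      l2_restrict_le (lconv_sq_le_resonant hd hdN (by positivity) (by positivity) (by positivity)
      ?_ hf hg sf' sg hf2 hg2) ?_⟩
  · rw [h4, ← ENNReal.ofReal_mul (by norm_num)]
    refine ofReal_le_tw_sq (le_of_eq ?_)
    rw [show 2 * (3 + ((j : ℝ) + j₂) / 2) = ((6 : ℕ) : ℝ) + j + j₂ by push_cast; ring,
      Real.rpow_add (by norm_num), Real.rpow_add (by norm_num)]
    simp only [Real.rpow_natCast, pow_succ _ j, pow_succ _ j₂]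
    ring
  · rw [h4, ← ENNReal.ofReal_mul (by norm_num)]
    refine ofReal_le_tw_sq (le_of_eq ?_)
    rw [show 2 * (3 + ((j : ℝ) + j₁) / 2) = ((6 : ℕ) : ℝ) + j + j₁ by push_cast; ring,
      Real.rpow_add (by norm_num), Real.rpow_add (by norm_num)]
    simp only [Real.rpow_natCast, pow_succ _ j, pow_succ _ j₁]
    ring
  · have key : ∀ i : ℕ, i + 14 ≤ k₁ + 2 * k₃ →
        (2 : ℝ) ^ (i + 1) ≤ 2 ^ k₁ * (2 ^ k₃) ^ 2 / 8192 := by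
      intro i hi
      rw [le_div_iff₀ (by norm_num), ← pow_mul, ← pow_add, mul_comm k₃ 2]
      calc (2 : ℝ) ^ (i + 1) * 8192 = 2 ^ (i + 14) := by rw [pow_add, pow_add]; norm_num; ring
        _ ≤ _ := pow_le_pow_right₀ (by norm_num) hi
    have := key j₁ h1
    have := key j₂ h2
    have := key j h3
    have : (0 : ℝ) < 2 ^ k₁ * (2 ^ k₃) ^ 2 := by positivity
    linarith
  · rw [h4, ← ENNReal.ofReal_mul (by norm_num), ← ENNReal.ofReal_mul (by norm_num)]
    refine ofReal_le_tw_sq (le_of_eq ?_)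
    rw [show 2 * (9 + ((j₁ : ℝ) + j₂ + j - (k₁ + 2 * k₃)) / 2) =
      ((18 : ℕ) : ℝ) + (j₁ + j₂ + j - (k₁ + k₃ + k₃)) by push_cast; ring,
      Real.rpow_add (by norm_num), two_rpow_eq, Real.rpow_add (by norm_num),
      Real.rpow_add (by norm_num)]
    simp only [Real.rpow_natCast, pow_succ _ j, pow_succ _ j₁, pow_succ _ j₂]
    ring

/-- The dyadic bilinear estimate for factors of bounded modulation, summed over the output
modulation. -/
theorem tsum_l2_lconv_le (hk : k₁ + 5 ≤ k₃) (hf : Measurable f) (hg : Measurable g)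
    (sf : ∀ z, f z ≠ 0 → |sig z| ≤ 2 ^ (j₁ + 1) ∧ z 0 ∈ freqSet k₁)
    (sg : ∀ z, g z ≠ 0 → |sig z| ≤ 2 ^ (j₂ + 1))
    (hf2 : ∫⁻ z, f z ^ 2 ≠ ⊤) (hg2 : ∫⁻ z, g z ^ 2 ≠ ⊤) :
    ∑' i : ℕ, tw (k₃ - (k₃ + i : ℕ) / 2) *
      l2 (volume.restrict (shell (2 ^ k₃ / 2) (2 * 2 ^ k₃) (2 ^ (k₃ + i + 1))))
        (lconv volume f g) ≤
      4096 * (1 + k₁) * tw (-(k₁ : ℝ) / 2) *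
        ((tw (j₁ / 2) * l2 volume f) * (tw (j₂ / 2) * l2 volume g)) := by
  set Y := l2 volume f * l2 volume g with hY
  set X := tw (((j₁ : ℝ) + j₂ - k₁) / 2) * Y with hX
  set t : ℕ → ℝ≥0∞ := fun i => tw (k₃ - (k₃ + i : ℕ) / 2) *
      l2 (volume.restrict (shell (2 ^ k₃ / 2) (2 * 2 ^ k₃) (2 ^ (k₃ + i + 1))))
        (lconv volume f g) with ht
  have step : ∀ {a y : ℝ} {b : ℝ≥0∞} (e : ℝ), b ≤ tw y * Y →
      a + y ≤ e + ((j₁ : ℝ) + j₂ - k₁) / 2 → tw a * b ≤ tw e * X := by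
    intro a y b e hb hay
    calc tw a * b ≤ tw a * (tw y * Y) := mul_le_mul_right hb _
      _ = tw (a + y) * Y := by rw [tw_add, mul_assoc]
      _ ≤ tw (e + ((j₁ : ℝ) + j₂ - k₁) / 2) * Y := mul_le_mul_left (tw_mono hay) _
      _ = _ := by rw [tw_add, mul_assoc]
  have hA := fun i : ℕ => l2_lconv_low_le hk hf hg sf sg (2 * 2 ^ k₃) (2 ^ (k₃ + i + 1))
  have hlow : ∀ i < 2 * k₁, t i ≤ tw 11 * X := by
    intro i hi
    have hk₁ : k₁ ≠ 0 := by omega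
    obtain ⟨s1, s2, s3⟩ := l2_lconv_output_le hk₁ hk hf hg sf sg hf2 hg2 (k₃ + i)
    have c1 : (i : ℝ) < 2 * k₁ := by exact_mod_cast hi
    -- Within 9 of the threshold i = 2k₁ the bound (a) still suffices, at the price of a constant.
    -- For smaller i the output modulation is automatically below the resonance size, because k₁+5 ≤
    -- k₃; only j₁ and j₂ can be too large. Then j₁ ≥ k₁+2k₃-13, or the same for j₂, compensates for
    -- the discarded modulation.
    by_cases h9 : 2 * k₁ ≤ i + 9
    · have c2 : 2 * (k₁ : ℝ) ≤ i + 9 := by exact_mod_cast h9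
      refine step 11 (hA i) ?_
      push_cast
      linarith
    by_cases h1 : j₁ + 14 ≤ k₁ + 2 * k₃
    swap
    · have c2 : (k₁ : ℝ) + 2 * k₃ + 1 ≤ j₁ + 14 := by exact_mod_cast (by omega)
      refine step 11 s1 ?_
      push_cast
      linarith
    by_cases h2 : j₂ + 14 ≤ k₁ + 2 * k₃
    swap
    · have c2 : (k₁ : ℝ) + 2 * k₃ + 1 ≤ j₂ + 14 := by exact_mod_cast (by omega)
      refine step 11 s2 ?_
      push_cast
      linarith
    refine step 11 (s3 h1 h2 (by omega)) ?_
    push_cast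
    linarith
  -- The low-frequency bound does not grow with the output modulation, whereas the weight decays
  -- like 2^{-i/2}; starting at i = 2k₁ turns the factor 2^{k₁/2} into 2^{-k₁/2}.
  have hhigh : ∀ m : ℕ, t (m + 2 * k₁) ≤ tw 5 * X * tw (-(m : ℝ) / 2) := by
    intro m
    have := step (5 - (m : ℝ) / 2) (hA (m + 2 * k₁))
      (a := k₃ - (k₃ + (m + 2 * k₁) : ℕ) / 2) (by push_cast; linarith)
    refine this.trans (le_of_eq ?_)
    rw [show (5 - (m : ℝ) / 2) = 5 + -(m : ℝ) / 2 by ring, tw_add]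
    ring
  calc ∑' i, t i = (∑ i ∈ Finset.range (2 * k₁), t i) + ∑' m, t (m + 2 * k₁) :=
        (ENNReal.summable.sum_add_tsum_nat_add' (f := t)).symm
    _ ≤ (∑ i ∈ Finset.range (2 * k₁), tw 11 * X) + ∑' m : ℕ, tw 5 * X * tw (-(m : ℝ) / 2) :=
        add_le_add (Finset.sum_le_sum fun i hi => hlow i (Finset.mem_range.1 hi))
          (ENNReal.tsum_le_tsum hhigh)
    _ ≤ (2 * k₁ : ℕ) * (tw 11 * X) + tw 5 * X * 4 := by
        rw [Finset.sum_const, Finset.card_range, nsmul_eq_mul, ENNReal.tsum_mul_left]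
        gcongr
        exact tsum_tw_le
    _ ≤ 4096 * (1 + k₁) * X := by
        rw [show (11 : ℝ) = (11 : ℕ) by norm_num, show (5 : ℝ) = (5 : ℕ) by norm_num, tw_natCast,
          tw_natCast]
        push_cast
        calc 2 * (k₁ : ℝ≥0∞) * (2 ^ 11 * X) + 2 ^ 5 * X * 4
            = 4096 * k₁ * X + 128 * X := by ring
          _ ≤ 4096 * k₁ * X + 4096 * X := by gcongr; norm_num
          _ = _ := by ring
    _ = _ := by
        rw [hX, hY, show ((j₁ : ℝ) + j₂ - k₁) / 2 = -(k₁ : ℝ) / 2 + j₁ / 2 + j₂ / 2 by ring,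
          tw_add, tw_add]
        ring

end

/-! ### The cutoffs -/

section Cutoff

variable {η₀ : ℝ → ℝ} (hη : IsCutoff η₀)

include hη

theorem IsCutoff.eq_zero {x : ℝ} (hx : 8 / 5 < |x|) : η₀ x = 0 := by
  by_contra h
  have := hη.support_subset h
  rw [Set.mem_Icc, ← abs_le] at this
  linarith

theorem IsCutoff.eq_one_of_abs_le {x : ℝ} (hx : |x| ≤ 5 / 4) : η₀ x = 1 :=
  hη.eq_one x (abs_le.1 hx)

theorem IsCutoff.abs_chi_le (k : ℤ) (x : ℝ) : |chi η₀ k x| ≤ 1 := by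
  have h1 := hη.mem_Icc (|x| / 2 ^ k)
  have h2 := hη.mem_Icc (|x| / 2 ^ (k - 1))
  rw [chi, abs_le]
  exact ⟨by linarith [h1.1, h2.2], by linarith [h1.2, h2.1]⟩

theorem IsCutoff.abs_bounds_of_chi_ne_zero {k : ℤ} {x : ℝ} (h : chi η₀ k x ≠ 0) :
    5 / 8 * 2 ^ k ≤ |x| ∧ |x| ≤ 8 / 5 * 2 ^ k := by
  have h2k : (0 : ℝ) < 2 ^ k := by positivity
  have h2k' : (0 : ℝ) < 2 ^ (k - 1) := by positivity
  have e : (2 : ℝ) ^ (k - 1) = 2 ^ k / 2 := zpow_sub_one₀ (by norm_num) k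
  by_contra hc
  apply h
  rw [chi]
  by_cases h1 : 5 / 8 * 2 ^ k ≤ |x|
  · have h3 : 8 / 5 * 2 ^ k < |x| := by
      by_contra h'; exact hc ⟨h1, not_lt.1 h'⟩
    rw [hη.eq_zero, hη.eq_zero, sub_zero]
    · rw [abs_of_nonneg (by positivity), lt_div_iff₀ h2k', e]; linarith
    · rw [abs_of_nonneg (by positivity), lt_div_iff₀ h2k]; linarith
  · rw [not_le] at h1
    rw [hη.eq_one_of_abs_le, hη.eq_one_of_abs_le, sub_self]
    · rw [abs_of_nonneg (by positivity), div_le_iff₀ h2k', e]; linarith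
    · rw [abs_of_nonneg (by positivity), div_le_iff₀ h2k]; linarith

theorem IsCutoff.abs_etaJ_le (j : ℕ) (s : ℝ) : |etaJ η₀ j s| ≤ 1 := by
  unfold etaJ
  split_ifs
  · have := hη.mem_Icc s
    rw [abs_le]; exact ⟨by linarith [this.1], this.2⟩
  · exact hη.abs_chi_le _ _

theorem IsCutoff.abs_le_of_etaJ_ne_zero {j : ℕ} {s : ℝ} (h : etaJ η₀ j s ≠ 0) :
    |s| ≤ 2 ^ (j + 1) := by
  have h2 : (0 : ℝ) < 2 ^ j := by positivity
  rw [pow_succ]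
  unfold etaJ at h
  split_ifs at h with hj
  · by_contra hc
    rw [hj, pow_zero] at hc
    exact h (hη.eq_zero (by linarith))
  · have := (hη.abs_bounds_of_chi_ne_zero h).2
    rw [zpow_natCast] at this
    linarith

theorem IsCutoff.le_abs_of_etaJ_ne_zero {j : ℕ} (hj : j ≠ 0) {s : ℝ} (h : etaJ η₀ j s ≠ 0) :
    2 ^ j / 2 ≤ |s| := by
  rw [etaJ, if_neg hj] at h
  have := (hη.abs_bounds_of_chi_ne_zero h).1
  rw [zpow_natCast] at this
  have h2 : (0 : ℝ) < 2 ^ j := by positivity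
  linarith

theorem IsCutoff.sum_etaJ (n : ℕ) (s : ℝ) :
    ∑ j ∈ Finset.range (n + 1), etaJ η₀ j s = η₀ (|s| / 2 ^ n) := by
  induction n with
  | zero =>
    rw [zero_add, Finset.sum_range_one, etaJ, if_pos rfl, pow_zero, div_one]
    rcases abs_choice s with h | h
    · rw [h]
    · rw [h, hη.even]
  | succ n ih =>
    rw [Finset.sum_range_succ, ih, etaJ, if_neg n.succ_ne_zero, chi]
    rw [show (((n + 1 : ℕ) : ℤ) - 1) = (n : ℤ) by push_cast; ring, zpow_natCast, zpow_natCast]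
    ring

theorem IsCutoff.exists_sum_etaJ (s : ℝ) :
    ∃ n : ℕ, ∑ j ∈ Finset.range (n + 1), etaJ η₀ j s = 1 := by
  obtain ⟨n, hn⟩ := pow_unbounded_of_one_lt |s| (by norm_num : (1 : ℝ) < 2)
  refine ⟨n, ?_⟩
  rw [hη.sum_etaJ]
  apply hη.eq_one_of_abs_le
  have h2 : (0 : ℝ) < 2 ^ n := by positivity
  rw [abs_of_nonneg (by positivity), div_le_iff₀ h2]
  linarith

theorem IsCutoff.measurable : Measurable η₀ := hη.smooth.continuous.measurable

theorem IsCutoff.measurable_chi (k : ℤ) : Measurable (chi η₀ k) := by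
  have := hη.measurable
  unfold chi
  fun_prop

theorem IsCutoff.measurable_etaJ (j : ℕ) : Measurable (etaJ η₀ j) := by
  unfold etaJ
  split_ifs
  · exact hη.measurable
  · exact hη.measurable_chi _

end Cutoff

/-! ### The norm of `X_k` in terms of modulation pieces -/

theorem eLpNorm_two_eq_l2 {α : Type*} [MeasurableSpace α] (μ : Measure α) (f : α → ℂ) :
    eLpNorm f 2 μ = l2 μ fun a => ‖f a‖ₑ := by
  rw [eLpNorm_eq_lintegral_rpow_enorm_toReal (by norm_num) (by norm_num), l2]
  simp

/-- The absolute value of the piece of `g` at modulation `2^j`. -/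
def modPiece (η₀ : ℝ → ℝ) (g : E3 → ℂ) (j : ℕ) (z : E3) : ℝ≥0∞ :=
  ‖(etaJ η₀ j (sig z) : ℂ)‖ₑ * ‖g z‖ₑ

theorem normX_eq (η₀ : ℝ → ℝ) (g : E3 → ℂ) :
    normX η₀ g = ∑' j : ℕ, tw (j / 2) * l2 volume (modPiece η₀ g j) := by
  unfold normX
  refine tsum_congr fun j => ?_
  rw [ofReal_two_rpow, eLpNorm_two_eq_l2]
  congr 2
  ext z
  rw [enorm_mul]
  rfl

section Pieces

variable {η₀ : ℝ → ℝ} (hη : IsCutoff η₀)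

include hη

theorem IsCutoff.measurable_modPiece {g : E3 → ℂ} (hg : Measurable g) (j : ℕ) :
    Measurable (modPiece η₀ g j) := by
  have := hη.measurable_etaJ j
  unfold modPiece
  fun_prop

theorem IsCutoff.abs_sig_le_of_modPiece_ne_zero {g : E3 → ℂ} {j : ℕ} {z : E3}
    (h : modPiece η₀ g j z ≠ 0) : |sig z| ≤ 2 ^ (j + 1) := by
  refine hη.abs_le_of_etaJ_ne_zero fun h0 => h ?_
  rw [modPiece, h0]; simp

theorem IsCutoff.enorm_le_tsum_modPiece (g : E3 → ℂ) (z : E3) :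
    ‖g z‖ₑ ≤ ∑' j, modPiece η₀ g j z := by
  obtain ⟨n, hn⟩ := hη.exists_sum_etaJ (sig z)
  calc ‖g z‖ₑ = ‖∑ j ∈ Finset.range (n + 1), (etaJ η₀ j (sig z) : ℂ) * g z‖ₑ := by
        rw [← Finset.sum_mul, ← Complex.ofReal_sum, hn, Complex.ofReal_one, one_mul]
    _ ≤ ∑ j ∈ Finset.range (n + 1), ‖(etaJ η₀ j (sig z) : ℂ) * g z‖ₑ := enorm_sum_le _ _
    _ = ∑ j ∈ Finset.range (n + 1), modPiece η₀ g j z := by simp [modPiece, enorm_mul]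
    _ ≤ _ := ENNReal.sum_le_tsum _

/-- All weights 2^{j/2} are at least 1 and the cutoffs sum to 1. Finiteness of the X norm thus gives
the square integrability used throughout the Fourier arguments. -/
theorem IsCutoff.l2_enorm_le_normX {g : E3 → ℂ} (hg : Measurable g) :
    l2 volume (fun z => ‖g z‖ₑ) ≤ normX η₀ g := by
  rw [normX_eq]
  calc l2 volume (fun z => ‖g z‖ₑ) ≤ l2 volume (fun z => ∑' j, modPiece η₀ g j z) :=
        l2_mono (hη.enorm_le_tsum_modPiece g)
    _ ≤ ∑' j, l2 volume (modPiece η₀ g j) := l2_tsum_le (hη.measurable_modPiece hg)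
    _ ≤ _ := by
      refine ENNReal.tsum_le_tsum fun j => ?_
      refine le_mul_of_one_le_left' ?_
      rw [← tw_zero]
      exact tw_mono (by positivity)

end Pieces

theorem l2_modPiece_ne_top {η₀ : ℝ → ℝ} {g : E3 → ℂ} (h : normX η₀ g ≠ ⊤) (j : ℕ) :
    l2 volume (modPiece η₀ g j) ≠ ⊤ := by
  rw [normX_eq] at h
  have := ENNReal.ne_top_of_tsum_ne_top h j
  intro h'
  rw [h', ENNReal.mul_top (tw_ne_zero _)] at this
  exact this rfl

/-! ### Convolution in the time frequency -/

/-- The unit vector of the time direction. -/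
def e2 : E3 := EuclideanSpace.single 2 1

theorem sub_smul_e2_zero (z : E3) (s : ℝ) : (z - s • e2) 0 = z 0 := by simp [e2]

theorem sub_smul_e2_one (z : E3) (s : ℝ) : (z - s • e2) 1 = z 1 := by simp [e2]

theorem sub_smul_e2_two (z : E3) (s : ℝ) : (z - s • e2) 2 = z 2 - s := by simp [e2]

theorem sig_sub_smul_e2 (z : E3) (s : ℝ) : sig (z - s • e2) = sig z - s := by
  rw [sig, sub_smul_e2_zero, sub_smul_e2_one, sub_smul_e2_two, sig]
  ring

/-- Convolution in the last variable, for functions with values in `[0, ∞]`. -/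
def tlconv (W : ℝ → ℝ≥0∞) (p : E3 → ℝ≥0∞) (z : E3) : ℝ≥0∞ := ∫⁻ s, W s * p (z - s • e2)

section TLconv

variable {W : ℝ → ℝ≥0∞} {p : E3 → ℝ≥0∞}

theorem measurable_tlconv (hW : Measurable W) (hp : Measurable p) : Measurable (tlconv W p) := by
  apply Measurable.lintegral_prod_right' (f := fun q : E3 × ℝ => W q.2 * p (q.1 - q.2 • e2))
  fun_prop

theorem lintegral_tlconv (hW : Measurable W) (hp : Measurable p) :
    ∫⁻ z, tlconv W p z = (∫⁻ s, W s) * ∫⁻ z, p z := by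
  unfold tlconv
  rw [lintegral_lintegral_swap (Measurable.aemeasurable (by fun_prop)), ← lintegral_mul_const _ hW]
  refine lintegral_congr fun s => ?_
  rw [lintegral_const_mul _ (by fun_prop), lintegral_sub_right_eq_self (fun z => p z) (s • e2)]

/-- Cauchy-Schwarz for the measure W ds; integrated in z it yields Young's inequality in the time
frequency. -/
theorem tlconv_sq_le (hW : Measurable W) (hp : Measurable p) (z : E3) :
    tlconv W p z ^ 2 ≤ (∫⁻ s, W s) * tlconv W (fun z => p z ^ 2) z := by
  set V : ℝ → ℝ≥0∞ := fun s => W s ^ (1 / 2 : ℝ) with hV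
  have mV : Measurable V := hW.pow_const _
  have hV2 : ∀ s, V s ^ 2 = W s := fun s => rpow_half_sq _
  have := sq_lintegral_mul_le (μ := volume) (f := V) (g := fun s => V s * p (z - s • e2)) mV
    (by fun_prop)
  simp only [mul_pow, hV2, ← mul_assoc, ← sq] at this
  exact this

theorem l2_tlconv_le (hW : Measurable W) (hp : Measurable p) :
    l2 volume (tlconv W p) ≤ (∫⁻ s, W s) * l2 volume p := by
  refine l2_le_of_sq_le ?_
  calc ∫⁻ z, tlconv W p z ^ 2 ≤ ∫⁻ z, (∫⁻ s, W s) * tlconv W (fun z => p z ^ 2) z :=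
        lintegral_mono (tlconv_sq_le hW hp)
    _ = (∫⁻ s, W s) * ((∫⁻ s, W s) * ∫⁻ z, p z ^ 2) := by
        rw [lintegral_const_mul _ (measurable_tlconv hW (hp.pow_const 2)),
          lintegral_tlconv hW (hp.pow_const 2)]
    _ = _ := by rw [mul_pow, l2_sq]; ring

/-- The part of a convolution at a modulation where the kernel is at most `B`. -/
theorem l2_tlconv_restrict_le (hW : Measurable W) (hp : Measurable p) {r : ℝ}
    (sp : ∀ z, p z ≠ 0 → |sig z| ≤ r) {A : Set E3} {B : ℝ≥0∞}
    (hB : ∀ z ∈ A, ∀ s, |sig z - s| ≤ r → W s ≤ B) :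
    l2 volume (A.indicator (tlconv W p)) ^ 2 ≤
      ENNReal.ofReal (2 * r) * B * (∫⁻ s, W s) * l2 volume p ^ 2 := by
  rw [l2_sq, l2_sq]
  have key : ∀ z, A.indicator (tlconv W p) z ^ 2 ≤
      ENNReal.ofReal (2 * r) * B * tlconv W (fun z => p z ^ 2) z := by
    intro z
    by_cases hz : z ∈ A
    swap
    · rw [indicator_of_notMem hz]; simp
    rw [indicator_of_mem hz]
    -- Translation by s in τ shifts σ by exactly s, so for each z only an interval of length 2r
    -- contributes. This is the source of the gain 2r·B over Young's inequality.
    have hs : ∀ s, s ∉ Icc (sig z - r) (sig z + r) → W s * p (z - s • e2) = 0 := by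
      intro s hs
      have : p (z - s • e2) = 0 := by
        by_contra h0
        have := sp _ h0
        rw [sig_sub_smul_e2, abs_le] at this
        exact hs ⟨by linarith, by linarith⟩
      rw [this, mul_zero]
    have h1 := sq_lintegral_le (μ := volume) (f := fun s => W s * p (z - s • e2)) (by fun_prop)
      measurableSet_Icc hs
    refine h1.trans ?_
    rw [Real.volume_Icc, show sig z + r - (sig z - r) = 2 * r by ring, mul_assoc]
    refine mul_le_mul_right ?_ _
    unfold tlconv
    rw [← lintegral_const_mul _ (by fun_prop)]
    refine lintegral_mono fun s => ?_
    by_cases h0 : p (z - s • e2) = 0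
    · simp [h0]
    have := sp _ h0
    rw [sig_sub_smul_e2] at this
    calc (W s * p (z - s • e2)) ^ 2 = W s * (W s * p (z - s • e2) ^ 2) := by ring
      _ ≤ _ := mul_le_mul_left (hB z hz s this) _
  refine (lintegral_mono key).trans ?_
  rw [lintegral_const_mul _ (measurable_tlconv hW (hp.pow_const 2)),
    lintegral_tlconv hW (hp.pow_const 2)]
  exact le_of_eq (by ring)

end TLconv

/-- The kernel `2^{-K} (1 + (s / 2^K)²)^{-2}`. -/
def kernelW (K : ℕ) (s : ℝ) : ℝ≥0∞ :=
  ENNReal.ofReal ((2 ^ K)⁻¹ * ((1 + (s / 2 ^ K) ^ 2) ^ 2)⁻¹)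

theorem measurable_kernelW (K : ℕ) : Measurable (kernelW K) := by
  unfold kernelW; fun_prop

theorem lintegral_kernelW_le (K : ℕ) : ∫⁻ s, kernelW K s ≤ 4 := by
  have hK : (0 : ℝ) < 2 ^ K := by positivity
  have hint : Integrable fun s : ℝ => (2 ^ K : ℝ)⁻¹ * (1 + (s / 2 ^ K) ^ 2)⁻¹ :=
    (integrable_inv_one_add_sq.comp_div hK.ne').const_mul _
  calc ∫⁻ s, kernelW K s
      ≤ ∫⁻ s, ENNReal.ofReal ((2 ^ K : ℝ)⁻¹ * (1 + (s / 2 ^ K) ^ 2)⁻¹) := by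
        refine lintegral_mono fun s => ENNReal.ofReal_le_ofReal ?_
        refine mul_le_mul_of_nonneg_left ?_ (by positivity)
        refine inv_anti₀ (by positivity) ?_
        have : 0 ≤ (s / 2 ^ K) ^ 2 := sq_nonneg _
        nlinarith
    _ = ENNReal.ofReal (∫ s : ℝ, (2 ^ K : ℝ)⁻¹ * (1 + (s / 2 ^ K) ^ 2)⁻¹) := by
        rw [ofReal_integral_eq_lintegral_ofReal hint
          (Filter.Eventually.of_forall fun s => by positivity)]
    _ ≤ ENNReal.ofReal 4 := by
        refine ENNReal.ofReal_le_ofReal ?_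
        rw [integral_const_mul, Measure.integral_comp_div (fun s : ℝ => (1 + s ^ 2)⁻¹) (2 ^ K),
          integral_univ_inv_one_add_sq, smul_eq_mul, abs_of_pos hK, ← mul_assoc,
          inv_mul_cancel₀ hK.ne', one_mul]
        exact Real.pi_le_four
    _ = 4 := by norm_num

/-- Quartic decay of the kernel outside its width 2^K; for m = 0 only its maximum 2^{-K} is used. -/
theorem kernelW_le {K m : ℕ} {s : ℝ} (h : m = 0 ∨ 2 ^ (K + m) / 2 ≤ |s|) :
    kernelW K s ≤ tw (4 - K - 4 * m) := by
  rw [← ofReal_two_rpow]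
  refine ENNReal.ofReal_le_ofReal ?_
  have hK : (0 : ℝ) < 2 ^ K := by positivity
  have e : (2 : ℝ) ^ (4 - (K : ℝ) - 4 * m) = (2 ^ K)⁻¹ * (16 * ((2 ^ m) ^ 4)⁻¹) := by
    rw [Real.rpow_sub (by norm_num), Real.rpow_sub (by norm_num), show (4 : ℝ) * m = (m * 4 : ℕ) by
      push_cast; ring, Real.rpow_natCast, Real.rpow_natCast, pow_mul]
    norm_num
    ring
  rw [e]
  refine mul_le_mul_of_nonneg_left ?_ (by positivity)
  rcases h with h | h
  · rw [h, pow_zero, one_pow, inv_one, mul_one]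
    refine (inv_le_one_of_one_le₀ ?_).trans (by norm_num)
    have : 0 ≤ (s / 2 ^ K) ^ 2 := sq_nonneg _
    nlinarith
  · have h1 : (2 ^ m / 2 : ℝ) ≤ |s / 2 ^ K| := by
      rw [abs_div, abs_of_pos hK, le_div_iff₀ hK]
      rw [pow_add] at h
      linarith
    have h2 : (2 ^ m / 2 : ℝ) ^ 2 ≤ (s / 2 ^ K) ^ 2 := by
      rw [← sq_abs (s / 2 ^ K)]
      exact pow_le_pow_left₀ (by positivity) h1 2
    have h3 : ((2 ^ m : ℝ) ^ 4) / 16 ≤ (1 + (s / 2 ^ K) ^ 2) ^ 2 := by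
      calc ((2 ^ m : ℝ) ^ 4) / 16 = ((2 ^ m / 2 : ℝ) ^ 2) ^ 2 := by ring
        _ ≤ _ := pow_le_pow_left₀ (by positivity) (by linarith) 2
    calc ((1 + (s / 2 ^ K) ^ 2) ^ 2)⁻¹ ≤ (((2 ^ m : ℝ) ^ 4) / 16)⁻¹ :=
          inv_anti₀ (by positivity) h3
      _ = _ := by rw [inv_div]; ring

/-- The sharp pieces of modulation `2^{K+m}`, the first one collecting all modulations up to
`2^{K+1}`. -/
def modShell (K m : ℕ) : Set E3 :=
  {z | (m = 0 ∨ 2 ^ (K + m) < |sig z|) ∧ |sig z| ≤ 2 ^ (K + m + 1)}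

theorem measurableSet_modShell (K m : ℕ) : MeasurableSet (modShell K m) :=
  measurableSet_and (show MeasurableSet ({_z | m = 0} ∪ {z : E3 | 2 ^ (K + m) < |sig z|}) from
    (MeasurableSet.const _).union
    (measurableSet_lt (by fun_prop) (by fun_prop))) (measurableSet_le (by fun_prop) (by fun_prop))

theorem exists_mem_modShell (K : ℕ) (z : E3) : ∃ m, z ∈ modShell K m := by
  have hex : ∃ m : ℕ, |sig z| ≤ 2 ^ (K + m + 1) := by
    obtain ⟨n, hn⟩ := pow_unbounded_of_one_lt |sig z| (by norm_num : (1 : ℝ) < 2)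
    exact ⟨n, hn.le.trans (pow_le_pow_right₀ (by norm_num) (by omega))⟩
  classical
  refine ⟨Nat.find hex, ?_, Nat.find_spec hex⟩
  rcases Nat.eq_zero_or_pos (Nat.find hex) with h | h
  · exact Or.inl h
  · right
    have := Nat.find_min hex (m := Nat.find hex - 1) (by omega)
    rw [not_le] at this
    rwa [show K + (Nat.find hex - 1) + 1 = K + Nat.find hex by omega] at this

theorem le_tsum_indicator_modShell (K : ℕ) (F : E3 → ℝ≥0∞) (z : E3) :
    F z ≤ ∑' m, (modShell K m).indicator F z := by
  obtain ⟨m, hm⟩ := exists_mem_modShell K z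
  calc F z = (modShell K m).indicator F z := by rw [indicator_of_mem hm]
    _ ≤ _ := ENNReal.le_tsum m

theorem tsum_tw_shift_le (K i : ℕ) :
    ∑' m : ℕ, (if K + m ≤ i + 1 then tw (((K + m : ℕ) - (i : ℝ)) / 2) else 0) ≤ 8 := by
  set h : ℕ → ℝ≥0∞ := fun j => if j ≤ i + 1 then tw (((j : ℕ) - (i : ℝ)) / 2) else 0 with hh
  calc ∑' m : ℕ, (if K + m ≤ i + 1 then tw (((K + m : ℕ) - (i : ℝ)) / 2) else 0)
      = ∑' m, h (K + m) := rfl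
    _ ≤ ∑' j, h j := ENNReal.tsum_comp_le_tsum_of_injective (add_right_injective K) h
    _ = ∑ j ∈ Finset.range (i + 1 + 1), h j := by
        refine tsum_eq_sum fun j hj => ?_
        rw [Finset.mem_range] at hj
        simp only [hh]; rw [if_neg (by omega)]
    _ = ∑ n ∈ Finset.range (i + 1 + 1), h (i + 1 - n) := by
        rw [← Finset.sum_range_reflect]
        exact Finset.sum_congr rfl fun n _ => by congr 1
    _ ≤ ∑ n ∈ Finset.range (i + 1 + 1), tw 1 * tw (-(n : ℝ) / 2) := by
        refine Finset.sum_le_sum fun n hn => ?_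
        rw [Finset.mem_range] at hn
        simp only [hh]
        rw [if_pos (by omega), ← tw_add]
        apply tw_mono
        rw [Nat.cast_sub (by omega)]
        push_cast
        linarith
    _ ≤ ∑' n : ℕ, tw 1 * tw (-(n : ℝ) / 2) := ENNReal.sum_le_tsum _
    _ ≤ 2 * 4 := by
        rw [ENNReal.tsum_mul_left]
        refine mul_le_mul' ?_ tsum_tw_le
        simp [tw]
    _ = 8 := by norm_num

/-- Localization in time at scale `2^{-K}` maps `X` to a space where the modulations up to `2^K` are
treated as one piece. -/
theorem tsum_l2_tlconv_le (K i : ℕ) {p : E3 → ℝ≥0∞} (hp : Measurable p)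
    (sp : ∀ z, p z ≠ 0 → |sig z| ≤ 2 ^ (i + 1)) :
    ∑' m : ℕ, tw ((K + m : ℕ) / 2) *
      l2 volume ((modShell K m).indicator (tlconv (kernelW K) p)) ≤
      160 * (tw (i / 2) * l2 volume p) := by
  have hW := measurable_kernelW K
  have key : ∀ m : ℕ, tw ((K + m : ℕ) / 2) *
      l2 volume ((modShell K m).indicator (tlconv (kernelW K) p)) ≤
      (32 * tw (-(m : ℝ) / 2) + 4 * (if K + m ≤ i + 1 then tw (((K + m : ℕ) - (i : ℝ)) / 2) else 0)) *
        (tw (i / 2) * l2 volume p) := by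
    intro m
    -- Target modulations not above that of p cost only Young's inequality, and their weights sum
    -- geometrically up to 2^{i/2}. For larger ones, and for m = 0 when i is well below K, the
    -- restricted estimate gains 2^{(i-K)/2}, which offsets the enlarged weight 2^{K/2}; the kernel
    -- tail makes the sum in m converge.
    by_cases hm : K + m ≤ i + 1
    · rw [if_pos hm]
      calc tw ((K + m : ℕ) / 2) * l2 volume ((modShell K m).indicator (tlconv (kernelW K) p))
          ≤ tw ((K + m : ℕ) / 2) * (4 * l2 volume p) := by
            refine mul_le_mul_right ((l2_mono fun z => indicator_le_self _ _ z).trans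
              ((l2_tlconv_le hW hp).trans ?_)) _
            exact mul_le_mul_left (lintegral_kernelW_le K) _
        _ = 4 * tw (((K + m : ℕ) - (i : ℝ)) / 2) * (tw (i / 2) * l2 volume p) := by
            rw [show (((K + m : ℕ) : ℝ) / 2) = ((K + m : ℕ) - (i : ℝ)) / 2 + i / 2 by ring, tw_add]
            ring
        _ ≤ _ := mul_le_mul_left le_add_self _
    · rw [if_neg hm, mul_zero, add_zero]
      have h1 : l2 volume ((modShell K m).indicator (tlconv (kernelW K) p)) ≤
          tw (5 + (i : ℝ) / 2 - K / 2 - 2 * m) * l2 volume p := by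
        have h2 := l2_tlconv_restrict_le hW hp sp (A := modShell K m)
          (B := tw (4 - K - 4 * m)) (by
          intro z hz s hs
          refine kernelW_le (hz.1.imp id fun h => ?_)
          have h3 : (2 : ℝ) ^ (i + 1) ≤ 2 ^ (K + m) / 2 := by
            rw [le_div_iff₀ (by norm_num), ← pow_succ]
            exact pow_le_pow_right₀ (by norm_num) (by omega)
          have h4 := abs_sub_abs_le_abs_sub (sig z) s
          linarith)
        rw [← ENNReal.pow_le_pow_left_iff two_ne_zero]
        refine h2.trans ?_
        rw [mul_pow]
        refine mul_le_mul_left ?_ _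
        calc ENNReal.ofReal (2 * 2 ^ (i + 1)) * tw (4 - K - 4 * m) * ∫⁻ s, kernelW K s
            ≤ tw (i + 2) * tw (4 - K - 4 * m) * tw 2 := by
              refine mul_le_mul' (mul_le_mul' ?_ le_rfl) ?_
              · rw [← ofReal_two_rpow, show ((i : ℝ) + 2) = (i + 2 : ℕ) by push_cast; ring,
                  Real.rpow_natCast]
                exact ENNReal.ofReal_le_ofReal (le_of_eq (by ring))
              · refine (lintegral_kernelW_le K).trans (le_of_eq ?_)
                rw [show (2 : ℝ) = (2 : ℕ) by norm_num, tw_natCast]; norm_num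
          _ ≤ _ := by
              rw [← tw_add, ← tw_add, tw_sq]
              exact tw_mono (by linarith)
      calc tw ((K + m : ℕ) / 2) * l2 volume ((modShell K m).indicator (tlconv (kernelW K) p))
          ≤ tw ((K + m : ℕ) / 2) * (tw (5 + (i : ℝ) / 2 - K / 2 - 2 * m) * l2 volume p) :=
            mul_le_mul_right h1 _
        _ = tw ((K + m : ℕ) / 2 + (5 + (i : ℝ) / 2 - K / 2 - 2 * m)) * l2 volume p := by
            rw [tw_add, mul_assoc]
        _ ≤ tw ((5 : ℕ) + -(m : ℝ) / 2 + i / 2) * l2 volume p := by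
            refine mul_le_mul_left (tw_mono ?_) _
            push_cast
            have : (0 : ℝ) ≤ m := by positivity
            linarith
        _ = _ := by
            rw [tw_add, tw_add, tw_natCast]
            norm_num
            ring
  refine (ENNReal.tsum_le_tsum key).trans ?_
  rw [ENNReal.tsum_mul_right, ENNReal.tsum_add, ENNReal.tsum_mul_left, ENNReal.tsum_mul_left]
  refine mul_le_mul_left ?_ _
  calc _ ≤ (32 : ℝ≥0∞) * 4 + 4 * 8 :=
        add_le_add (mul_le_mul_right tsum_tw_le _) (mul_le_mul_right (tsum_tw_shift_le K i) _)
    _ = 160 := by norm_num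

/-! ### The estimate on the frequency side -/

theorem l2_le_const_mul_restrict {α : Type*} [MeasurableSpace α] {μ : Measure α} {f h : α → ℝ≥0∞}
    {c : ℝ≥0∞} {S : Set α} (hS : MeasurableSet S) (hh : Measurable h)
    (hf : ∀ᵐ a ∂μ, f a ≤ c * S.indicator h a) : l2 μ f ≤ c * l2 (μ.restrict S) h := by
  refine (l2_mono_ae hf).trans ?_
  rw [l2_const_mul _ (hh.indicator hS)]
  refine mul_le_mul_right (le_of_eq ?_) _
  unfold l2
  rw [← lintegral_indicator hS]
  congr 2
  ext a
  by_cases ha : a ∈ S <;> simp [ha]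

/-- The sum over modulations bounding the `N_k` norm of a function supported at `|ξ| ∼ 2^k`. -/
def outputSum (k : ℕ) (H : E3 → ℝ≥0∞) : ℝ≥0∞ :=
  ∑' i : ℕ, tw (k - (k + i : ℕ) / 2) *
    l2 (volume.restrict (shell (2 ^ k / 2) (2 * 2 ^ k) (2 ^ (k + i + 1)))) H

theorem enorm_inv_le {a b : ℝ} (ha : 0 < a) {c : ℝ} (h : a ≤ |b| ∨ a ≤ |c|) :
    ‖((b : ℂ) + Complex.I * c)⁻¹‖ₑ ≤ ENNReal.ofReal a⁻¹ := by
  rw [← ofReal_norm, norm_inv]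
  refine ENNReal.ofReal_le_ofReal (inv_anti₀ ha ?_)
  rcases h with h | h
  · have := Complex.abs_re_le_norm ((b : ℂ) + Complex.I * c)
    simp only [Complex.add_re, Complex.ofReal_re, Complex.mul_re, Complex.I_re, Complex.I_im,
      Complex.ofReal_im, zero_mul, mul_zero, sub_zero, add_zero] at this
    exact h.trans this
  · have := Complex.abs_im_le_norm ((b : ℂ) + Complex.I * c)
    simp only [Complex.add_im, Complex.ofReal_im, Complex.mul_im, Complex.I_re, Complex.I_im,
      Complex.ofReal_re, zero_mul, one_mul, zero_add] at this
    exact h.trans this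

/-- The symbol is at most 2^{k+1}, and the resolvent is bounded by 2^{-k} always and by about 2^{-j}
at modulation 2^j. Together with the weight 2^{j/2} this gives 2^{k-j/2} for j ≥ k. -/
theorem IsCutoff.normX_resolvent_le {η₀ : ℝ → ℝ} (hη : IsCutoff η₀) (k : ℕ) {G : E3 → ℂ}
    {H : E3 → ℝ≥0∞} (hH : Measurable H)
    (hG : ∀ᵐ z, ‖G z‖ₑ ≤ ‖((z 0 * chi η₀ k (z 0) : ℝ) : ℂ)‖ₑ * H z) :
    normX η₀ (fun ζ : E3 =>
      (((ζ 2 - omega (ζ 0) (ζ 1) : ℝ) : ℂ) + Complex.I * (2 : ℂ) ^ k)⁻¹ * G ζ) ≤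
      20 * outputSum k H := by
  set T : ℕ → ℝ≥0∞ := fun i => tw (k - (k + i : ℕ) / 2) *
    l2 (volume.restrict (shell (2 ^ k / 2) (2 * 2 ^ k) (2 ^ (k + i + 1)))) H with hT
  set R : E3 → ℂ := fun ζ => (((ζ 2 - omega (ζ 0) (ζ 1) : ℝ) : ℂ) + Complex.I * (2 : ℂ) ^ k)⁻¹ * G ζ
  have h2k : (0 : ℝ) < 2 ^ k := by positivity
  have piece : ∀ (j i : ℕ) (a : ℝ), j ≤ k + i →
      (∀ z, etaJ η₀ j (sig z) ≠ 0 → (2 : ℝ) ^ a ≤ |sig z| ∨ (2 : ℝ) ^ a ≤ |(2 : ℝ) ^ k|) →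
      l2 volume (modPiece η₀ R j) ≤ tw (k + 1 - a) *
        l2 (volume.restrict (shell (2 ^ k / 2) (2 * 2 ^ k) (2 ^ (k + i + 1)))) H := by
    intro j i a hj ha
    refine l2_le_const_mul_restrict (measurableSet_shell _ _ _) hH ?_
    filter_upwards [hG] with z hz
    by_cases h1 : etaJ η₀ j (sig z) = 0
    · simp [modPiece, h1]
    by_cases h2 : chi η₀ k (z 0) = 0
    · rw [h2, mul_zero] at hz
      have hz0 : G z = 0 := by simpa using hz
      simp [modPiece, R, hz0]
    have hb := hη.abs_bounds_of_chi_ne_zero h2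
    rw [zpow_natCast] at hb
    have hmem : z ∈ shell (2 ^ k / 2) (2 * 2 ^ k) (2 ^ (k + i + 1)) :=
      ⟨(hη.abs_le_of_etaJ_ne_zero h1).trans (pow_le_pow_right₀ (by norm_num) (by omega)),
        by linarith [hb.1], by linarith [hb.2]⟩
    rw [indicator_of_mem hmem]
    have e1 : ‖(etaJ η₀ j (sig z) : ℂ)‖ₑ ≤ 1 := by
      rw [← ofReal_norm, Complex.norm_real]
      exact (ENNReal.ofReal_le_ofReal (hη.abs_etaJ_le _ _)).trans (by simp)
    have e2 : ‖((z 0 * chi η₀ k (z 0) : ℝ) : ℂ)‖ₑ ≤ tw (k + 1) := by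
      rw [← ofReal_norm, Complex.norm_real, ← ofReal_two_rpow,
        show ((k : ℝ) + 1) = (k + 1 : ℕ) by push_cast; ring, Real.rpow_natCast]
      refine ENNReal.ofReal_le_ofReal ?_
      rw [Real.norm_eq_abs, abs_mul, pow_succ]
      calc |z 0| * |chi η₀ k (z 0)| ≤ |z 0| * 1 :=
            mul_le_mul_of_nonneg_left (hη.abs_chi_le _ _) (abs_nonneg _)
        _ ≤ _ := by linarith [hb.2]
    have e3 : ‖(((z 2 - omega (z 0) (z 1) : ℝ) : ℂ) + Complex.I * (2 : ℂ) ^ k)⁻¹‖ₑ ≤ tw (-a) := by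
      have := enorm_inv_le (a := (2 : ℝ) ^ a) (by positivity) (b := sig z) (c := (2 : ℝ) ^ k) (ha z h1)
      rw [← Real.rpow_neg (by norm_num), ofReal_two_rpow] at this
      simpa [sig] using this
    calc modPiece η₀ R j z
        = ‖(etaJ η₀ j (sig z) : ℂ)‖ₑ *
          (‖(((z 2 - omega (z 0) (z 1) : ℝ) : ℂ) + Complex.I * (2 : ℂ) ^ k)⁻¹‖ₑ * ‖G z‖ₑ) := by
          rw [modPiece, enorm_mul]
      _ ≤ 1 * (tw (-a) * (tw (k + 1) * H z)) :=
          mul_le_mul' e1 (mul_le_mul' e3 (hz.trans (mul_le_mul_left e2 _)))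
      _ = _ := by rw [one_mul, ← mul_assoc, ← tw_add]; congr 2; ring
  -- Every piece with j < k lies in the first shell; the weights 2^{j/2} sum to a multiple of
  -- 2^{k/2}, so together they cost no more than the piece i = 0.
  have hlow : ∀ j ∈ Finset.range k, tw (j / 2) * l2 volume (modPiece η₀ R j) ≤
      2 * (if 0 + j ≤ k + 1 then tw (((0 + j : ℕ) - (k : ℝ)) / 2) else 0) * T 0 := by
    intro j hj
    rw [Finset.mem_range] at hj
    rw [if_pos (by omega), zero_add]
    refine (mul_le_mul_right (piece j 0 k (by omega) fun z _ => Or.inr ?_) _).trans (le_of_eq ?_)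
    · rw [Real.rpow_natCast, abs_of_pos h2k]
    · rw [hT]
      simp only
      rw [← mul_assoc, ← mul_assoc, ← tw_add, mul_assoc 2, ← tw_add]
      have e : ∀ x, 2 * tw x = tw (1 + x) := fun x => by rw [tw_add]; simp [tw]
      rw [e]
      congr 2
      push_cast
      ring
  have hhigh : ∀ i : ℕ, tw ((i + k : ℕ) / 2) * l2 volume (modPiece η₀ R (i + k)) ≤ 4 * T i := by
    intro i
    refine (mul_le_mul_right (piece (i + k) i ((i + k : ℕ) - 1) (by omega) fun z hz => ?_) _).trans
      (le_of_eq ?_)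
    · by_cases h0 : i + k = 0
      · right
        rw [h0, abs_of_pos h2k, show k = 0 by omega, pow_zero]
        exact Real.rpow_le_one_of_one_le_of_nonpos (by norm_num) (by simp)
      · left
        rw [Real.rpow_sub (by norm_num), Real.rpow_natCast, Real.rpow_one]
        exact hη.le_abs_of_etaJ_ne_zero h0 hz
    · rw [hT]
      simp only
      rw [← mul_assoc, ← mul_assoc, ← tw_add]
      have e : ∀ x, 4 * tw x = tw ((2 : ℕ) + x) := fun x => by rw [tw_add, tw_natCast]; norm_num
      rw [e]
      congr 2
      push_cast
      ring
  rw [normX_eq, ← ENNReal.summable.sum_add_tsum_nat_add' (k := k)]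
  calc _ ≤ 16 * T 0 + 4 * ∑' i, T i := by
        refine add_le_add ?_ ?_
        · refine (Finset.sum_le_sum hlow).trans ?_
          rw [← Finset.sum_mul, ← Finset.mul_sum]
          refine mul_le_mul_left ?_ _
          calc _ ≤ (2 : ℝ≥0∞) * 8 :=
                mul_le_mul_right ((ENNReal.sum_le_tsum _).trans (tsum_tw_shift_le 0 k)) _
            _ = 16 := by norm_num
        · rw [← ENNReal.tsum_mul_left]
          exact ENNReal.tsum_le_tsum hhigh
    _ ≤ 16 * ∑' i, T i + 4 * ∑' i, T i :=
        add_le_add (mul_le_mul_right (ENNReal.le_tsum 0) _) le_rfl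
    _ = 20 * outputSum k H := by
        rw [← add_mul, outputSum, show (16 : ℝ≥0∞) + 4 = 20 by norm_num]

/-! ### Subadditivity of the output sum, and convolutions of countable sums -/

section OutputSum

variable {k : ℕ}

theorem outputSum_mono {f g : E3 → ℝ≥0∞} (h : ∀ z, f z ≤ g z) : outputSum k f ≤ outputSum k g :=
  ENNReal.tsum_le_tsum fun _ => mul_le_mul_right (l2_mono h) _

theorem outputSum_const_mul (c : ℝ≥0∞) {f : E3 → ℝ≥0∞} (hf : Measurable f) :
    outputSum k (fun z => c * f z) = c * outputSum k f := by
  unfold outputSum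
  rw [← ENNReal.tsum_mul_left]
  refine tsum_congr fun i => ?_
  rw [l2_const_mul _ hf]
  ring

theorem outputSum_tsum_le {f : ℕ → E3 → ℝ≥0∞} (hf : ∀ a, Measurable (f a)) :
    outputSum k (fun z => ∑' a, f a z) ≤ ∑' a, outputSum k (f a) := by
  unfold outputSum
  rw [ENNReal.tsum_comm]
  refine ENNReal.tsum_le_tsum fun i => ?_
  rw [ENNReal.tsum_mul_left]
  exact mul_le_mul_right (l2_tsum_le hf) _

theorem outputSum_finset_sum_le {ι : Type*} (s : Finset ι) {f : ι → E3 → ℝ≥0∞}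
    (hf : ∀ a, Measurable (f a)) :
    outputSum k (fun z => ∑ a ∈ s, f a z) ≤ ∑ a ∈ s, outputSum k (f a) := by
  unfold outputSum
  rw [← Summable.tsum_finsetSum fun _ _ => ENNReal.summable]
  refine ENNReal.tsum_le_tsum fun i => ?_
  rw [← Finset.mul_sum]
  exact mul_le_mul_right (l2_finset_sum_le s hf) _

end OutputSum

theorem lconv_mono {f f' g g' : E3 → ℝ≥0∞} (hf : ∀ z, f z ≤ f' z) (hg : ∀ z, g z ≤ g' z) (z : E3) :
    lconv volume f g z ≤ lconv volume f' g' z :=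
  lintegral_mono fun _ => mul_le_mul' (hf _) (hg _)

theorem lconv_tsum_left {f : ℕ → E3 → ℝ≥0∞} {g : E3 → ℝ≥0∞} (hf : ∀ a, Measurable (f a))
    (hg : Measurable g) (z : E3) :
    lconv volume (fun w => ∑' a, f a w) g z = ∑' a, lconv volume (f a) g z := by
  unfold lconv
  rw [← lintegral_tsum fun a => Measurable.aemeasurable (by have := hf a; fun_prop)]
  exact lintegral_congr fun w => ENNReal.tsum_mul_right.symm

theorem lconv_tsum_right {f : E3 → ℝ≥0∞} {g : ℕ → E3 → ℝ≥0∞} (hf : Measurable f)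
    (hg : ∀ b, Measurable (g b)) (z : E3) :
    lconv volume f (fun w => ∑' b, g b w) z = ∑' b, lconv volume f (g b) z := by
  unfold lconv
  rw [← lintegral_tsum fun a => Measurable.aemeasurable (by have := hg a; fun_prop)]
  exact lintegral_congr fun w => ENNReal.tsum_mul_left.symm

theorem tlconv_tsum {W : ℝ → ℝ≥0∞} {p : ℕ → E3 → ℝ≥0∞} (hW : Measurable W)
    (hp : ∀ a, Measurable (p a)) (z : E3) :
    tlconv W (fun w => ∑' a, p a w) z = ∑' a, tlconv W (p a) z := by
  unfold tlconv
  rw [← lintegral_tsum fun a => Measurable.aemeasurable (by have := hp a; fun_prop)]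
  exact lintegral_congr fun w => ENNReal.tsum_mul_left.symm

theorem outputSum_lconv_tsum_left_le {k : ℕ} {f : ℕ → E3 → ℝ≥0∞} {g : E3 → ℝ≥0∞}
    (hf : ∀ a, Measurable (f a)) (hg : Measurable g) :
    outputSum k (lconv volume (fun w => ∑' a, f a w) g) ≤
      ∑' a, outputSum k (lconv volume (f a) g) :=
  (outputSum_mono fun z => (lconv_tsum_left hf hg z).le).trans
    (outputSum_tsum_le fun a => measurable_lconv (hf a) hg)

theorem outputSum_lconv_tsum_right_le {k : ℕ} {f : E3 → ℝ≥0∞} {g : ℕ → E3 → ℝ≥0∞}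
    (hf : Measurable f) (hg : ∀ b, Measurable (g b)) :
    outputSum k (lconv volume f (fun w => ∑' b, g b w)) ≤
      ∑' b, outputSum k (lconv volume f (g b)) :=
  (outputSum_mono fun z => (lconv_tsum_right hf hg z).le).trans
    (outputSum_tsum_le fun a => measurable_lconv hf (hg a))

theorem exists_ne_zero_of_tlconv_ne_zero {W : ℝ → ℝ≥0∞} {p : E3 → ℝ≥0∞} {z : E3}
    (h : tlconv W p z ≠ 0) : ∃ s : ℝ, p (z - s • e2) ≠ 0 := by
  by_contra! hc
  apply h
  unfold tlconv
  simp [hc]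

/-- The bilinear estimate for the absolute values of the Fourier transforms. -/
theorem IsCutoff.outputSum_lconv_le {η₀ : ℝ → ℝ} (hη : IsCutoff η₀) {k₁ k₃ : ℕ} (hk : k₁ + 5 ≤ k₃)
    {gu gv : E3 → ℂ} (hu : Measurable gu) (hv : Measurable gv)
    (su : ∀ z, gu z ≠ 0 → z 0 ∈ freqSet k₁) (fu : normX η₀ gu ≠ ⊤) (fv : normX η₀ gv ≠ ⊤) :
    outputSum k₃ (lconv volume (tlconv (kernelW k₃) fun z => ‖gu z‖ₑ) fun z => ‖gv z‖ₑ) ≤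
      655360 * (1 + k₁) * tw (-(k₁ : ℝ) / 2) * (normX η₀ gu * normX η₀ gv) := by
  have hW := measurable_kernelW k₃
  set p := modPiece η₀ gu
  set q := modPiece η₀ gv
  have mp : ∀ a, Measurable (p a) := hη.measurable_modPiece hu
  have mq : ∀ b, Measurable (q b) := hη.measurable_modPiece hv
  -- Here a records the modulation before the smearing in time frequency and m the modulation after
  -- it. The bilinear bound is applied with j₁ = k₃+m, and `tsum_l2_tlconv_le` then sums over m for
  -- each a.
  set f : ℕ → ℕ → E3 → ℝ≥0∞ := fun a m => (modShell k₃ m).indicator (tlconv (kernelW k₃) (p a))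
  have mt : ∀ a, Measurable (tlconv (kernelW k₃) (p a)) := fun a => measurable_tlconv hW (mp a)
  have mf : ∀ a m, Measurable (f a m) := fun a m => (mt a).indicator (measurableSet_modShell _ _)
  set c : ℝ≥0∞ := 4096 * (1 + k₁) * tw (-(k₁ : ℝ) / 2) with hc
  have key : ∀ a m b, outputSum k₃ (lconv volume (f a m) (q b)) ≤
      c * ((tw ((k₃ + m : ℕ) / 2) * l2 volume (f a m)) * (tw (b / 2) * l2 volume (q b))) := by
    intro a m b
    refine tsum_l2_lconv_le hk (mf a m) (mq b) ?_ ?_ ?_ ?_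
    · intro z hz
      have hz1 : z ∈ modShell k₃ m := mem_of_indicator_ne_zero hz
      refine ⟨hz1.2, ?_⟩
      simp only [f] at hz
      rw [indicator_of_mem hz1] at hz
      obtain ⟨s, hs⟩ := exists_ne_zero_of_tlconv_ne_zero hz
      have := su (z - s • e2) fun h0 => hs (by simp [p, modPiece, h0])
      rwa [sub_smul_e2_zero] at this
    · exact fun z hz => hη.abs_sig_le_of_modPiece_ne_zero hz
    · rw [← l2_sq]
      refine ENNReal.pow_ne_top (ne_top_of_le_ne_top ?_
        ((l2_mono fun z => indicator_le_self _ _ z).trans (l2_tlconv_le hW (mp a))))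
      exact ENNReal.mul_ne_top (ne_top_of_le_ne_top (by norm_num) (lintegral_kernelW_le k₃))
        (l2_modPiece_ne_top fu a)
    · rw [← l2_sq]
      exact ENNReal.pow_ne_top (l2_modPiece_ne_top fv b)
  have hF : ∀ z, tlconv (kernelW k₃) (fun z => ‖gu z‖ₑ) z ≤ ∑' a, ∑' m, f a m z := by
    intro z
    calc tlconv (kernelW k₃) (fun z => ‖gu z‖ₑ) z
        ≤ tlconv (kernelW k₃) (fun z => ∑' a, p a z) z :=
          lintegral_mono fun s => mul_le_mul_right (hη.enorm_le_tsum_modPiece gu _) _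
      _ = ∑' a, tlconv (kernelW k₃) (p a) z := tlconv_tsum hW mp z
      _ ≤ _ := ENNReal.tsum_le_tsum fun a => le_tsum_indicator_modShell k₃ _ z
  have mfa : ∀ a, Measurable fun z => ∑' m, f a m z := fun a => Measurable.tsum (mf a)
  calc _ ≤ outputSum k₃ (lconv volume (fun z => ∑' a, ∑' m, f a m z) fun z => ∑' b, q b z) :=
        outputSum_mono (lconv_mono hF (hη.enorm_le_tsum_modPiece gv))
    _ ≤ ∑' a, outputSum k₃ (lconv volume (fun z => ∑' m, f a m z) fun z => ∑' b, q b z) :=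
        outputSum_lconv_tsum_left_le mfa (Measurable.tsum mq)
    _ ≤ ∑' a, ∑' m, outputSum k₃ (lconv volume (f a m) fun z => ∑' b, q b z) :=
        ENNReal.tsum_le_tsum fun a =>
          outputSum_lconv_tsum_left_le (mf a) (Measurable.tsum mq)
    _ ≤ ∑' a, ∑' m, ∑' b, outputSum k₃ (lconv volume (f a m) (q b)) :=
        ENNReal.tsum_le_tsum fun a => ENNReal.tsum_le_tsum fun m =>
          outputSum_lconv_tsum_right_le (mf a m) mq
    _ ≤ ∑' a : ℕ, ∑' m : ℕ, ∑' b : ℕ, c * ((tw ((k₃ + m : ℕ) / 2) * l2 volume (f a m)) *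
          (tw (b / 2) * l2 volume (q b))) :=
        ENNReal.tsum_le_tsum fun a => ENNReal.tsum_le_tsum fun m => ENNReal.tsum_le_tsum (key a m)
    _ = c * ((∑' a : ℕ, ∑' m : ℕ, tw ((k₃ + m : ℕ) / 2) * l2 volume (f a m)) * normX η₀ gv) := by
        rw [normX_eq]
        simp only [ENNReal.tsum_mul_left, ENNReal.tsum_mul_right]
        rfl
    _ ≤ c * ((∑' a : ℕ, 160 * (tw (a / 2) * l2 volume (p a))) * normX η₀ gv) := by
        refine mul_le_mul_right (mul_le_mul_left (ENNReal.tsum_le_tsum fun a => ?_) _) _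
        exact tsum_l2_tlconv_le k₃ a (mp a) fun z hz => hη.abs_sig_le_of_modPiece_ne_zero hz
    _ = _ := by
        rw [ENNReal.tsum_mul_left, ← normX_eq, hc]
        ring

/-! ### Functions as tempered distributions -/

section Tempered

variable {f f' : E3 → ℂ}

theorem IsTemperedFun.congr (hf : IsTemperedFun f) (h : f =ᵐ[volume] f') : IsTemperedFun f' := by
  obtain ⟨hm, N, hN⟩ := hf
  refine ⟨hm.congr h, N, hN.congr ?_⟩
  filter_upwards [h] with z hz
  rw [hz]

theorem integrable_inv_one_add_norm_pow : Integrable (fun z : E3 => ((1 + ‖z‖) ^ 4)⁻¹) volume := by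
  have := integrable_one_add_norm (E := E3) (μ := volume) (r := (4 : ℕ)) (by simp; norm_num)
  refine this.congr (Filter.Eventually.of_forall fun z => ?_)
  simp only
  rw [Real.rpow_neg (by positivity), Real.rpow_natCast]

/-- With the integrable weight w = (1+‖z‖)^{-4} ≤ 1 one has w|f| ≤ w + |f|². -/
theorem _root_.MeasureTheory.MemLp.isTemperedFun (hf : MemLp f 2 volume) : IsTemperedFun f := by
  refine ⟨hf.1, 4, ?_⟩
  refine (integrable_inv_one_add_norm_pow.add (hf.integrable_norm_pow (by norm_num))).mono'
    ((Continuous.aestronglyMeasurable (by fun_prop (disch := intros; positivity))).mul hf.1.norm)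
    (Filter.Eventually.of_forall fun z => ?_)
  rw [Real.norm_of_nonneg (by positivity)]
  have h0 : 0 ≤ ((1 + ‖z‖) ^ 4)⁻¹ := by positivity
  have h1 : ((1 + ‖z‖) ^ 4)⁻¹ ≤ 1 := inv_le_one_of_one_le₀ (one_le_pow₀ (by linarith [norm_nonneg z]))
  simp only [Pi.add_apply]
  nlinarith [sq_nonneg (((1 + ‖z‖) ^ 4)⁻¹ - ‖f z‖), norm_nonneg (f z)]

theorem _root_.MeasureTheory.Integrable.isTemperedFun (hf : Integrable f volume) :
    IsTemperedFun f :=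
  ⟨hf.1, 0, by simpa using hf.norm⟩

theorem IsTemperedFun.of_norm_le (hf : AEStronglyMeasurable f volume) {B : ℝ}
    (h : ∀ z, ‖f z‖ ≤ B) : IsTemperedFun f := by
  refine ⟨hf, 4, ?_⟩
  refine (integrable_inv_one_add_norm_pow.mul_const B).mono'
    ((Continuous.aestronglyMeasurable (by fun_prop (disch := intros; positivity))).mul hf.norm)
    (Filter.Eventually.of_forall fun z => ?_)
  rw [Real.norm_of_nonneg (by positivity)]
  exact mul_le_mul_of_nonneg_left (h z) (by positivity)

theorem IsTemperedFun.bdd_mul (hf : IsTemperedFun f) {g : E3 → ℂ}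
    (hg : AEStronglyMeasurable g volume) {B : ℝ} (h : ∀ z, ‖g z‖ ≤ B) :
    IsTemperedFun fun z => g z * f z := by
  obtain ⟨hm, N, hN⟩ := hf
  refine ⟨hg.mul hm, N, (hN.const_mul B).mono' ?_ (Filter.Eventually.of_forall fun z => ?_)⟩
  · exact (Continuous.aestronglyMeasurable (by fun_prop (disch := intros; positivity))).mul
      (hg.mul hm).norm
  · rw [Real.norm_of_nonneg (by positivity), norm_mul]
    have : ((1 + ‖z‖) ^ N)⁻¹ * (‖g z‖ * ‖f z‖) = ‖g z‖ * (((1 + ‖z‖) ^ N)⁻¹ * ‖f z‖) := by ring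
    rw [this]
    exact mul_le_mul_of_nonneg_right (h z) (by positivity)

theorem IsTemperedFun.locallyIntegrable (hf : IsTemperedFun f) : LocallyIntegrable f volume := by
  obtain ⟨hm, N, hN⟩ := hf
  rw [locallyIntegrable_iff]
  intro K hK
  obtain ⟨R, hR⟩ := hK.isBounded.exists_norm_le
  refine ((hN.const_mul ((1 + R) ^ N)).integrableOn (s := K)).mono' hm.restrict ?_
  filter_upwards [ae_restrict_mem hK.measurableSet] with z hz
  have h1 : (1 + ‖z‖) ^ N ≤ (1 + R) ^ N := pow_le_pow_left₀ (by positivity) (by linarith [hR z hz]) N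
  rw [← mul_assoc, ← div_eq_mul_inv]
  refine le_mul_of_one_le_left (norm_nonneg _) ?_
  rwa [one_le_div (by positivity)]

theorem ae_eq_of_forall_integral_schwartz_eq (hf : IsTemperedFun f) (hf' : IsTemperedFun f')
    (h : ∀ φ : 𝓢(E3, ℂ), ∫ z, φ z * f z = ∫ z, φ z * f' z) : f =ᵐ[volume] f' := by
  refine ae_eq_of_integral_contDiff_smul_eq hf.locallyIntegrable hf'.locallyIntegrable
    fun g hg hc => ?_
  have hg₁ : HasCompactSupport (Complex.ofRealCLM ∘ g) := hc.comp_left rfl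
  have hg₂ : ContDiff ℝ ∞ (Complex.ofRealCLM ∘ g) := by fun_prop
  simpa using h (hg₁.toSchwartzMap hg₂)

end Tempered

/-- `G` is the Fourier transform of `f`, in Mathlib's normalization, where both are functions
defining tempered distributions. -/
structure HasFT (f G : E3 → ℂ) : Prop where
  left : IsTemperedFun f
  right : IsTemperedFun G
  integral_eq : ∀ φ : 𝓢(E3, ℂ), ∫ z, φ z * G z = ∫ z, (𝓕 φ) z * f z

section HasFT

variable {f f' G G' : E3 → ℂ}

theorem hasFT_of_fourier_toTD (hf : IsTemperedFun f) (hG : IsTemperedFun G)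
    (h : 𝓕 (toTD f) = toTD G) : HasFT f G where
  left := hf
  right := hG
  integral_eq φ := by
    rw [← toTD_apply hf, ← toTD_apply hG, ← h, TemperedDistribution.fourier_apply]

theorem HasFT.congr (h : HasFT f G) (hf : f =ᵐ[volume] f') (hG : G =ᵐ[volume] G') :
    HasFT f' G' where
  left := h.left.congr hf
  right := h.right.congr hG
  integral_eq φ := by
    calc ∫ z, φ z * G' z = ∫ z, φ z * G z :=
          integral_congr_ae (by filter_upwards [hG] with z hz; rw [hz])
      _ = ∫ z, (𝓕 φ) z * f z := h.integral_eq φ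
      _ = _ := integral_congr_ae (by filter_upwards [hf] with z hz; rw [hz])

theorem HasFT.integral_fourierInv (h : HasFT f G) (φ : 𝓢(E3, ℂ)) :
    ∫ z, (𝓕⁻ φ) z * G z = ∫ z, φ z * f z := by
  rw [h.integral_eq, FourierTransform.fourier_fourierInv_eq]

theorem HasFT.unique (h : HasFT f G) (h' : HasFT f G') : G =ᵐ[volume] G' :=
  ae_eq_of_forall_integral_schwartz_eq h.right h'.right fun φ => by
    rw [h.integral_eq, h'.integral_eq]

theorem HasFT.unique_left (h : HasFT f G) (h' : HasFT f' G) : f =ᵐ[volume] f' :=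
  ae_eq_of_forall_integral_schwartz_eq h.left h'.left fun φ => by
    rw [← h.integral_fourierInv, ← h'.integral_fourierInv]

theorem HasFT.sum {ι : Type*} (s : Finset ι) {f G : ι → E3 → ℂ} (h : ∀ i ∈ s, HasFT (f i) (G i))
    (hf : IsTemperedFun fun z => ∑ i ∈ s, f i z) (hG : IsTemperedFun fun z => ∑ i ∈ s, G i z) :
    HasFT (fun z => ∑ i ∈ s, f i z) (fun z => ∑ i ∈ s, G i z) where
  left := hf
  right := hG
  integral_eq φ := by
    simp_rw [Finset.mul_sum]
    rw [integral_finsetSum _ fun i hi => (h i hi).right.integrable_mul φ,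
      integral_finsetSum _ fun i hi => (h i hi).left.integrable_mul (𝓕 φ)]
    exact Finset.sum_congr rfl fun i hi => (h i hi).integral_eq φ

theorem hasFT_Lp (F : Lp ℂ 2 (volume : Measure E3)) : HasFT F (𝓕 F : Lp ℂ 2 (volume : Measure E3)) where
  left := (Lp.memLp F).isTemperedFun
  right := (Lp.memLp _).isTemperedFun
  integral_eq φ := by
    have := congrArg (fun T : 𝓢'(E3, ℂ) => T φ) (Lp.fourier_toTemperedDistribution_eq F)
    simp only [TemperedDistribution.fourier_apply, Lp.toTemperedDistribution_apply,
      smul_eq_mul] at this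
    exact this.symm

/-- The candidate is the inverse Plancherel transform of G. Injectivity of the Fourier transform on
tempered distributions identifies it with f almost everywhere, so the `L²` theory becomes available
for f. -/
theorem HasFT.exists_Lp (h : HasFT f G) (hG : MemLp G 2 volume) :
    ∃ F : Lp ℂ 2 (volume : Measure E3), F =ᵐ[volume] f ∧
      (𝓕 F : Lp ℂ 2 (volume : Measure E3)) =ᵐ[volume] G := by
  set F : Lp ℂ 2 (volume : Measure E3) := 𝓕⁻ hG.toLp with hF
  have e : (𝓕 F : Lp ℂ 2 (volume : Measure E3)) =ᵐ[volume] G := by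
    rw [hF, FourierTransform.fourier_fourierInv_eq]
    exact hG.coeFn_toLp
  exact ⟨F, ((hasFT_Lp F).congr (Filter.EventuallyEq.refl _ _) e).unique_left h, e⟩

theorem HasFT.memLp (h : HasFT f G) (hG : MemLp G 2 volume) : MemLp f 2 volume := by
  obtain ⟨F, hF, -⟩ := h.exists_Lp hG
  exact (memLp_congr_ae hF).1 (Lp.memLp F)

/-- Plancherel's identity. -/
theorem HasFT.eLpNorm_eq (h : HasFT f G) (hG : MemLp G 2 volume) :
    eLpNorm f 2 volume = eLpNorm G 2 volume := by
  obtain ⟨F, hF, hFG⟩ := h.exists_Lp hG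
  rw [← eLpNorm_congr_ae hF, ← eLpNorm_congr_ae hFG, ← ENNReal.toReal_eq_toReal_iff'
    (Lp.memLp F).eLpNorm_ne_top (Lp.memLp _).eLpNorm_ne_top, ← Lp.norm_def, ← Lp.norm_def,
    Lp.norm_fourier_eq]

end HasFT

theorem continuous_integral_mul_Lp {q : E3 → ℂ} (hq : MemLp q 2 volume) :
    Continuous fun F : Lp ℂ 2 (volume : Measure E3) => ∫ z, q z * F z := by
  have hq' : MemLp (fun z => (starRingEnd ℂ) (q z)) 2 volume := hq.star
  have : (fun F : Lp ℂ 2 (volume : Measure E3) => ∫ z, q z * F z) =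
      fun F => inner ℂ hq'.toLp F := by
    ext F
    rw [L2.inner_def]
    refine integral_congr_ae ?_
    filter_upwards [hq'.coeFn_toLp] with z hz
    rw [hz, RCLike.inner_apply, RCLike.conj_conj, mul_comm]
  rw [this]
  fun_prop

/-- Two continuous bilinear pairings of `F` and of its Fourier transform agree if they agree for
Schwartz functions. -/
theorem integral_mul_eq_integral_mul_fourier {q Q : E3 → ℂ} (hq : MemLp q 2 volume)
    (hQ : MemLp Q 2 volume)
    (h : ∀ S : 𝓢(E3, ℂ), ∫ z, q z * S z = ∫ z, Q z * (𝓕 S) z) {f G : E3 → ℂ} (hf : HasFT f G)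
    (hG : MemLp G 2 volume) : ∫ z, q z * f z = ∫ z, Q z * G z := by
  obtain ⟨F, hF, hFG⟩ := hf.exists_Lp hG
  have key : ∫ z, q z * F z = ∫ z, Q z * (𝓕 F : Lp ℂ 2 (volume : Measure E3)) z := by
    apply DenseRange.induction_on
      (p := fun F : Lp ℂ 2 (volume : Measure E3) =>
        ∫ z, q z * F z = ∫ z, Q z * (𝓕 F : Lp ℂ 2 (volume : Measure E3)) z)
      (SchwartzMap.denseRange_toLpCLM (p := 2) ENNReal.ofNat_ne_top) F
    · exact isClosed_eq (continuous_integral_mul_Lp hq) ((continuous_integral_mul_Lp hQ).comp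
        (FourierTransform.continuous_fourier (E := Lp ℂ 2 (volume : Measure E3))))
    · intro S
      rw [SchwartzMap.toLpCLM_apply, SchwartzMap.toLp_fourier_eq]
      calc _ = ∫ z, q z * S z := integral_congr_ae (by
            filter_upwards [S.coeFn_toLp 2 volume] with z hz; rw [hz])
        _ = _ := h S
        _ = _ := integral_congr_ae (by
            filter_upwards [(𝓕 S).coeFn_toLp 2 volume] with z hz; rw [hz])
  calc ∫ z, q z * f z = ∫ z, q z * F z :=
        integral_congr_ae (by filter_upwards [hF] with z hz; rw [hz])
    _ = _ := key
    _ = _ := integral_congr_ae (by filter_upwards [hFG] with z hz; rw [hz])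

/-! ### Fourier transforms of products -/

theorem integral_integral_swap_of_lintegral {α β : Type*} [MeasurableSpace α] [MeasurableSpace β]
    {μ : Measure α} {ν : Measure β} [SFinite μ] [SFinite ν] {F : α → β → ℂ}
    (hF : Measurable (Function.uncurry F)) (h : ∫⁻ a, ∫⁻ b, ‖F a b‖ₑ ∂ν ∂μ ≠ ⊤) :
    ∫ a, ∫ b, F a b ∂ν ∂μ = ∫ b, ∫ a, F a b ∂μ ∂ν := by
  refine integral_integral_swap ⟨hF.aestronglyMeasurable, ?_⟩
  rw [HasFiniteIntegral, lintegral_prod _ hF.enorm.aemeasurable]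
  exact h.lt_top

theorem memLp_two_of_l2 {f : E3 → ℂ} (hf : Measurable f) (h : l2 volume (fun z => ‖f z‖ₑ) ≠ ⊤) :
    MemLp f 2 volume :=
  ⟨hf.aestronglyMeasurable, by rw [eLpNorm_two_eq_l2]; exact h.lt_top⟩

theorem _root_.MeasureTheory.MemLp.l2_ne_top {f : E3 → ℂ} (hf : MemLp f 2 volume) :
    l2 volume (fun z => ‖f z‖ₑ) ≠ ⊤ := by
  rw [← eLpNorm_two_eq_l2]
  exact hf.eLpNorm_ne_top

section Product

variable {G H : E3 → ℂ}

/-- Convolution on `ℝ³`. -/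
def vconv (G H : E3 → ℂ) (z : E3) : ℂ := ∫ w, G w * H (z - w)

theorem enorm_vconv_le (G H : E3 → ℂ) (z : E3) :
    ‖vconv G H z‖ₑ ≤ lconv volume (fun w => ‖G w‖ₑ) (fun w => ‖H w‖ₑ) z := by
  refine (enorm_integral_le_lintegral_enorm _).trans (le_of_eq ?_)
  exact lintegral_congr fun w => enorm_mul _ _

theorem measurable_vconv (hG : Measurable G) (hH : Measurable H) : Measurable (vconv G H) := by
  have : StronglyMeasurable fun q : E3 × E3 => G q.2 * H (q.1 - q.2) :=
    Measurable.stronglyMeasurable (by fun_prop)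
  exact this.integral_prod_right'.measurable

theorem lconv_le_l2 {f g : E3 → ℝ≥0∞} (hf : Measurable f) (hg : Measurable g) (z : E3) :
    lconv volume f g z ≤ l2 volume f * l2 volume g := by
  refine (lintegral_mul_le_l2 hf (by fun_prop)).trans (le_of_eq ?_)
  congr 1
  unfold l2
  congr 1
  exact lintegral_sub_left_eq_self (fun w => g w ^ 2) z

theorem isTemperedFun_vconv (hG : Measurable G) (hH : Measurable H) (hG2 : MemLp G 2 volume)
    (hH2 : MemLp H 2 volume) : IsTemperedFun (vconv G H) := by
  refine IsTemperedFun.of_norm_le (measurable_vconv hG hH).aestronglyMeasurable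
    (B := (l2 volume (fun w => ‖G w‖ₑ) * l2 volume (fun w => ‖H w‖ₑ)).toReal) fun z => ?_
  rw [← toReal_enorm]
  exact ENNReal.toReal_mono (ENNReal.mul_ne_top hG2.l2_ne_top hH2.l2_ne_top)
    ((enorm_vconv_le G H z).trans (lconv_le_l2 hG.enorm hH.enorm z))

/-- Correlation with a Schwartz function. -/
def corr (φ : 𝓢(E3, ℂ)) (G : E3 → ℂ) (y : E3) : ℂ := ∫ w, G w * φ (y + w)

theorem lintegral_enorm_schwartz_ne_top (φ : 𝓢(E3, ℂ)) : ∫⁻ z, ‖φ z‖ₑ ≠ ⊤ :=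
  φ.integrable.2.ne

/-- Young's inequality L¹ * L² ⊂ L², with absolute values inside the integral so that it also
justifies Fubini. -/
theorem l2_corr_ne_top (φ : 𝓢(E3, ℂ)) (hG : Measurable G) (hG2 : MemLp G 2 volume) :
    l2 volume (fun y => ∫⁻ w, ‖G w * φ (y + w)‖ₑ) ≠ ⊤ := by
  have mφ : Measurable φ := φ.continuous.measurable
  have key : l2 volume (fun y => ∫⁻ w, ‖G w * φ (y + w)‖ₑ) ≤
      (∫⁻ z, ‖φ z‖ₑ) * l2 volume (fun z => ‖G z‖ₑ) := by
    refine l2_le_of_sq_le ?_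
    have h1 : ∀ y, (∫⁻ w, ‖G w * φ (y + w)‖ₑ) ^ 2 ≤
        (∫⁻ z, ‖φ z‖ₑ) * ∫⁻ w, ‖φ (y + w)‖ₑ * ‖G w‖ₑ ^ 2 := by
      intro y
      have := sq_lintegral_mul_le (μ := volume) (f := fun w => ‖φ (y + w)‖ₑ ^ (1 / 2 : ℝ))
        (g := fun w => ‖φ (y + w)‖ₑ ^ (1 / 2 : ℝ) * ‖G w‖ₑ) (by fun_prop) (by fun_prop)
      simp only [← mul_assoc, ← sq, mul_pow, rpow_half_sq] at this
      rw [lintegral_add_left_eq_self (fun w => ‖φ w‖ₑ) y] at this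
      refine le_trans (le_of_eq ?_) this
      congr 1
      exact lintegral_congr fun w => by rw [enorm_mul, mul_comm]
    calc _ ≤ ∫⁻ y, (∫⁻ z, ‖φ z‖ₑ) * ∫⁻ w, ‖φ (y + w)‖ₑ * ‖G w‖ₑ ^ 2 := lintegral_mono h1
      _ = (∫⁻ z, ‖φ z‖ₑ) * ∫⁻ w, ∫⁻ y, ‖φ (y + w)‖ₑ * ‖G w‖ₑ ^ 2 := by
          rw [lintegral_const_mul, lintegral_lintegral_swap (Measurable.aemeasurable (by fun_prop))]
          apply Measurable.lintegral_prod_right'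
            (f := fun q : E3 × E3 => ‖φ (q.1 + q.2)‖ₑ * ‖G q.2‖ₑ ^ 2)
          fun_prop
      _ = (∫⁻ z, ‖φ z‖ₑ) * ∫⁻ w, (∫⁻ z, ‖φ z‖ₑ) * ‖G w‖ₑ ^ 2 := by
          congr 1
          refine lintegral_congr fun w => ?_
          rw [lintegral_mul_const _ (by fun_prop),
            lintegral_add_right_eq_self (fun w => ‖φ w‖ₑ) w]
      _ = _ := by
          rw [lintegral_const_mul _ (by fun_prop), mul_pow, l2_sq]
          ring
  exact ne_top_of_le_ne_top
    (ENNReal.mul_ne_top (lintegral_enorm_schwartz_ne_top φ) hG2.l2_ne_top) key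

theorem memLp_corr (φ : 𝓢(E3, ℂ)) (hG : Measurable G) (hG2 : MemLp G 2 volume) :
    MemLp (corr φ G) 2 volume := by
  have mφ : Measurable φ := φ.continuous.measurable
  refine memLp_two_of_l2 ?_ (ne_top_of_le_ne_top (l2_corr_ne_top φ hG hG2)
    (l2_mono fun y => enorm_integral_le_lintegral_enorm _))
  have : StronglyMeasurable fun q : E3 × E3 => G q.2 * φ (q.1 + q.2) :=
    Measurable.stronglyMeasurable (by fun_prop)
  exact this.integral_prod_right'.measurable

theorem integral_corr_mul (φ : 𝓢(E3, ℂ)) (hG : Measurable G) (hH : Measurable H)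
    (hG2 : MemLp G 2 volume) (hH2 : MemLp H 2 volume) :
    ∫ y, corr φ G y * H y = ∫ w, G w * ∫ y, φ (y + w) * H y := by
  have mφ : Measurable φ := φ.continuous.measurable
  have hfin : ∫⁻ y, ∫⁻ w, ‖G w * φ (y + w) * H y‖ₑ ≠ ⊤ := by
    have e : ∀ y, ∫⁻ w, ‖G w * φ (y + w) * H y‖ₑ = (∫⁻ w, ‖G w * φ (y + w)‖ₑ) * ‖H y‖ₑ := by
      intro y
      rw [← lintegral_mul_const _ (by fun_prop)]
      exact lintegral_congr fun w => enorm_mul _ _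
    simp_rw [e]
    refine ne_top_of_le_ne_top (ENNReal.mul_ne_top (l2_corr_ne_top φ hG hG2) hH2.l2_ne_top)
      (lintegral_mul_le_l2 ?_ hH.enorm)
    apply Measurable.lintegral_prod_right' (f := fun q : E3 × E3 => ‖G q.2 * φ (q.1 + q.2)‖ₑ)
    fun_prop
  calc ∫ y, corr φ G y * H y = ∫ y, ∫ w, G w * φ (y + w) * H y := by
        refine integral_congr_ae (Filter.Eventually.of_forall fun y => ?_)
        exact (integral_mul_const _ _).symm
    _ = ∫ w, ∫ y, G w * φ (y + w) * H y := by
        refine integral_integral_swap_of_lintegral ?_ hfin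
        fun_prop
    _ = _ := by
        refine integral_congr_ae (Filter.Eventually.of_forall fun w => ?_)
        simp only [mul_assoc]
        exact integral_const_mul _ _

theorem integral_mul_vconv (φ : 𝓢(E3, ℂ)) (hG : Measurable G) (hH : Measurable H)
    (hG2 : MemLp G 2 volume) (hH2 : MemLp H 2 volume) :
    ∫ z, φ z * vconv G H z = ∫ y, corr φ G y * H y := by
  have mφ : Measurable φ := φ.continuous.measurable
  rw [integral_corr_mul φ hG hH hG2 hH2]
  have hfin : ∫⁻ z, ∫⁻ w, ‖φ z * (G w * H (z - w))‖ₑ ≠ ⊤ := by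
    have e : ∀ z, ∫⁻ w, ‖φ z * (G w * H (z - w))‖ₑ ≤
        ‖φ z‖ₑ * (l2 volume (fun w => ‖G w‖ₑ) * l2 volume (fun w => ‖H w‖ₑ)) := by
      intro z
      simp_rw [enorm_mul]
      rw [lintegral_const_mul _ (by fun_prop)]
      exact mul_le_mul_right (lconv_le_l2 hG.enorm hH.enorm z) _
    refine ne_top_of_le_ne_top ?_ (lintegral_mono e)
    rw [lintegral_mul_const _ (by fun_prop)]
    exact ENNReal.mul_ne_top (lintegral_enorm_schwartz_ne_top φ)
      (ENNReal.mul_ne_top hG2.l2_ne_top hH2.l2_ne_top)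
  calc ∫ z, φ z * vconv G H z = ∫ z, ∫ w, φ z * (G w * H (z - w)) := by
        refine integral_congr_ae (Filter.Eventually.of_forall fun y => ?_)
        exact (integral_const_mul _ _).symm
    _ = ∫ w, ∫ z, φ z * (G w * H (z - w)) := by
        refine integral_integral_swap_of_lintegral ?_ hfin
        fun_prop
    _ = ∫ w, ∫ y, φ (y + w) * (G w * H y) := by
        refine integral_congr_ae (Filter.Eventually.of_forall fun w => ?_)
        simp only
        rw [← integral_add_right_eq_self (fun z => φ z * (G w * H (z - w))) w]
        simp only [add_sub_cancel_right]
    _ = _ := by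
        refine integral_congr_ae (Filter.Eventually.of_forall fun w => ?_)
        simp only
        rw [← integral_const_mul]
        refine integral_congr_ae (Filter.Eventually.of_forall fun y => ?_)
        simp only
        ring

/-- The multiplication formula ∫ f̂ g = ∫ f ĝ, applied to S and a translate of φ: the translation
becomes the character of the inverse transform. -/
theorem fourierInv_mul_fourier_apply (φ S : 𝓢(E3, ℂ)) (w : E3) :
    (𝓕⁻ (SchwartzMap.smulLeftCLM ℂ (𝓕 φ : 𝓢(E3, ℂ)) S)) w = ∫ y, φ (y + w) * (𝓕 S) y := by
  have hint : Integrable (fun y => φ (y + w)) volume := φ.integrable.comp_add_right w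
  have h := VectorFourier.integral_fourierIntegral_smul_eq_flip (μ := volume) (ν := volume)
    (L := innerₗ E3) Real.continuous_fourierChar continuous_inner S.integrable hint
  have e := VectorFourier.fourierIntegral_comp_add_right Real.fourierChar volume (innerₗ E3) φ w
  rw [SchwartzMap.fourierInv_coe, Real.fourierInv_eq']
  calc _ = ∫ x, S x • VectorFourier.fourierIntegral Real.fourierChar volume (innerₗ E3).flip
          (fun y => φ (y + w)) x := by
        refine integral_congr_ae (Filter.Eventually.of_forall fun x => ?_)
        simp only
        rw [SchwartzMap.smulLeftCLM_apply_apply (𝓕 φ).hasTemperateGrowth, flip_innerₗ]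
        have e' := congrFun e x
        simp only [Function.comp_def] at e'
        rw [e', innerₗ_apply_apply, Circle.smul_def, Real.fourierChar_apply, real_inner_comm x w,
          SchwartzMap.fourier_coe]
        simp only [smul_eq_mul]
        rw [show VectorFourier.fourierIntegral Real.fourierChar volume (innerₗ E3) φ x =
          𝓕 (φ : E3 → ℂ) x from rfl]
        ring_nf
    _ = ∫ y, (𝓕 S) y • φ (y + w) := h.symm
    _ = _ := by
        refine integral_congr_ae (Filter.Eventually.of_forall fun x => ?_)
        simp only [smul_eq_mul]
        ring

/-- The Fourier transform of a product of square integrable functions. -/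
theorem HasFT.mul {U V : E3 → ℂ} (hU : HasFT U G) (hV : HasFT V H) (hG : Measurable G)
    (hH : Measurable H) (hG2 : MemLp G 2 volume) (hH2 : MemLp H 2 volume) :
    HasFT (fun z => U z * V z) (vconv G H) where
  left := ((hU.memLp hG2).integrable_mul (hV.memLp hH2)).isTemperedFun
  right := isTemperedFun_vconv hG hH hG2 hH2
  integral_eq φ := by
    rw [integral_mul_vconv φ hG hH hG2 hH2]
    have hq : MemLp (fun z => (𝓕 φ) z * U z) 2 volume :=
      (hU.memLp hG2).mul (r := 2) ((𝓕 φ).memLp ⊤ volume)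
    -- Tested against φ, the claim says that ∫ (φ̂U)V equals the pairing of the correlation of φ and
    -- G with the transform of V. Both sides are continuous in V ∈ L², so V may be taken Schwartz;
    -- then the claim is the relation between U and G, tested on φ̂·V.
    rw [← integral_mul_eq_integral_mul_fourier hq (memLp_corr φ hG hG2) ?_ hV hH2]
    · exact integral_congr_ae (Filter.Eventually.of_forall fun z => mul_assoc _ _ _)
    · intro S
      rw [integral_corr_mul φ hG (𝓕 S).continuous.measurable hG2 ((𝓕 S).memLp 2 volume)]
      have := hU.integral_fourierInv (SchwartzMap.smulLeftCLM ℂ (𝓕 φ : 𝓢(E3, ℂ)) S)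
      simp_rw [fourierInv_mul_fourier_apply,
        SchwartzMap.smulLeftCLM_apply_apply (𝓕 φ).hasTemperateGrowth] at this
      calc _ = ∫ z, (𝓕 φ) z • S z * U z :=
            integral_congr_ae (Filter.Eventually.of_forall fun z => by simp only [smul_eq_mul]; ring)
        _ = _ := this.symm
        _ = _ := integral_congr_ae (Filter.Eventually.of_forall fun z => mul_comm _ _)

end Product

/-! ### Multiplication by functions of time -/

section Time

variable {κ : ℝ → ℂ} {h : ℝ → ℂ} {G : E3 → ℂ}

/-- The function h is a superposition of characters in t, and each character translates the inverse
transform along the time-frequency axis; the rest is Fubini. -/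
theorem fourierInv_timeMul_apply (hκ : Integrable κ) (mκ : Measurable κ)
    (hh : ∀ t : ℝ, h t = ∫ s, κ s * Complex.exp ((2 * Real.pi * (s * t) : ℝ) * Complex.I))
    (hg : (fun z : E3 => h (z 2)).HasTemperateGrowth) (ψ : 𝓢(E3, ℂ)) (w : E3) :
    (𝓕⁻ (SchwartzMap.smulLeftCLM ℂ (fun z : E3 => h (z 2)) ψ)) w =
      ∫ s, κ s * (𝓕⁻ ψ) (w + s • e2) := by
  have mψ : Measurable ψ := ψ.continuous.measurable
  rw [SchwartzMap.fourierInv_coe, Real.fourierInv_eq', SchwartzMap.fourierInv_coe]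
  simp_rw [Real.fourierInv_eq', SchwartzMap.smulLeftCLM_apply_apply hg, hh, smul_eq_mul]
  have enorm_exp : ∀ x : ℝ, ‖Complex.exp (x * Complex.I)‖ₑ = 1 := fun x => by
    rw [← ofReal_norm, Complex.norm_exp_ofReal_mul_I, ENNReal.ofReal_one]
  calc _ = ∫ v : E3, ∫ s, Complex.exp ((2 * Real.pi * inner ℝ v w : ℝ) * Complex.I) *
        (κ s * Complex.exp ((2 * Real.pi * (s * v 2) : ℝ) * Complex.I) * ψ v) := by
        refine integral_congr_ae (Filter.Eventually.of_forall fun v => ?_)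
        simp only
        rw [integral_const_mul, integral_mul_const]
    _ = ∫ s, ∫ v : E3, Complex.exp ((2 * Real.pi * inner ℝ v w : ℝ) * Complex.I) *
        (κ s * Complex.exp ((2 * Real.pi * (s * v 2) : ℝ) * Complex.I) * ψ v) := by
        refine integral_integral_swap_of_lintegral (by fun_prop) ?_
        simp_rw [enorm_mul, enorm_exp, one_mul, mul_one]
        have : ∀ v, ∫⁻ s, ‖κ s‖ₑ * ‖ψ v‖ₑ = (∫⁻ s, ‖κ s‖ₑ) * ‖ψ v‖ₑ := fun v =>
          lintegral_mul_const _ mκ.enorm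
        simp_rw [this]
        rw [lintegral_const_mul _ mψ.enorm]
        exact ENNReal.mul_ne_top hκ.2.ne (lintegral_enorm_schwartz_ne_top ψ)
    _ = _ := by
        refine integral_congr_ae (Filter.Eventually.of_forall fun s => ?_)
        simp only
        rw [← integral_const_mul]
        refine integral_congr_ae (Filter.Eventually.of_forall fun v => ?_)
        simp only
        have e : inner ℝ v (w + s • e2) = inner ℝ v w + s * v 2 := by
          rw [inner_add_right, inner_smul_right, e2, EuclideanSpace.inner_single_right]
          simp
        rw [e, mul_add, Complex.ofReal_add, add_mul, Complex.exp_add]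
        ring

/-- Convolution in the last variable. -/
def tconv (κ : ℝ → ℂ) (G : E3 → ℂ) (z : E3) : ℂ := ∫ s, κ s * G (z - s • e2)

theorem enorm_tconv_le (κ : ℝ → ℂ) (G : E3 → ℂ) (z : E3) :
    ‖tconv κ G z‖ₑ ≤ tlconv (fun s => ‖κ s‖ₑ) (fun w => ‖G w‖ₑ) z := by
  refine (enorm_integral_le_lintegral_enorm _).trans (le_of_eq ?_)
  exact lintegral_congr fun w => enorm_mul _ _

theorem measurable_tconv (mκ : Measurable κ) (hG : Measurable G) : Measurable (tconv κ G) := by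
  have : StronglyMeasurable fun q : E3 × ℝ => κ q.2 * G (q.1 - q.2 • e2) :=
    Measurable.stronglyMeasurable (by fun_prop)
  exact this.integral_prod_right'.measurable

theorem memLp_tconv (hκ : Integrable κ) (mκ : Measurable κ) (hG : Measurable G)
    (hG2 : MemLp G 2 volume) : MemLp (tconv κ G) 2 volume :=
  memLp_two_of_l2 (measurable_tconv mκ hG) (ne_top_of_le_ne_top
    (ENNReal.mul_ne_top hκ.2.ne hG2.l2_ne_top)
    ((l2_mono (enorm_tconv_le κ G)).trans (l2_tlconv_le mκ.enorm hG.enorm)))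

theorem integral_mul_tconv (hκ : Integrable κ) (mκ : Measurable κ) (hG : Measurable G)
    (hG2 : MemLp G 2 volume) (φ : 𝓢(E3, ℂ)) :
    ∫ z, φ z * tconv κ G z = ∫ z, (∫ s, κ s * φ (z + s • e2)) * G z := by
  have mφ : Measurable φ := φ.continuous.measurable
  have hφ2 : MemLp φ 2 volume := φ.memLp 2 volume
  have bound : ∀ s : ℝ, ∫⁻ z, ‖φ (z + s • e2) * (κ s * G z)‖ₑ ≤
      ‖κ s‖ₑ * (l2 volume (fun z => ‖φ z‖ₑ) * l2 volume (fun z => ‖G z‖ₑ)) := by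
    intro s
    calc _ = ∫⁻ z, ‖κ s‖ₑ * (‖φ (z + s • e2)‖ₑ * ‖G z‖ₑ) :=
          lintegral_congr fun z => by simp_rw [enorm_mul]; ring
      _ = ‖κ s‖ₑ * ∫⁻ z, ‖φ (z + s • e2)‖ₑ * ‖G z‖ₑ := lintegral_const_mul _ (by fun_prop)
      _ ≤ ‖κ s‖ₑ * (l2 volume (fun z => ‖φ (z + s • e2)‖ₑ) * l2 volume (fun z => ‖G z‖ₑ)) :=
          mul_le_mul_right (lintegral_mul_le_l2 (by fun_prop) hG.enorm) _
      _ = _ := by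
          congr 2
          unfold l2
          congr 1
          exact lintegral_add_right_eq_self (fun w => ‖φ w‖ₑ ^ 2) (s • e2)
  have hfin : ∫⁻ s, ∫⁻ z, ‖φ (z + s • e2) * (κ s * G z)‖ₑ ≠ ⊤ := by
    refine ne_top_of_le_ne_top ?_ (lintegral_mono bound)
    rw [lintegral_mul_const _ mκ.enorm]
    exact ENNReal.mul_ne_top hκ.2.ne (ENNReal.mul_ne_top hφ2.l2_ne_top hG2.l2_ne_top)
  have hshift : ∀ s : ℝ, ∫ z, φ (z + s • e2) * (κ s * G z) =
      ∫ z, φ z * (κ s * G (z - s • e2)) := by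
    intro s
    rw [← integral_add_right_eq_self (fun z => φ z * (κ s * G (z - s • e2))) (s • e2)]
    simp only [add_sub_cancel_right]
  have hfin' : ∫⁻ s, ∫⁻ z, ‖φ z * (κ s * G (z - s • e2))‖ₑ ≠ ⊤ := by
    convert hfin using 3 with s
    rw [← lintegral_add_right_eq_self (fun z => ‖φ z * (κ s * G (z - s • e2))‖ₑ) (s • e2)]
    simp only [add_sub_cancel_right]
  calc _ = ∫ z, ∫ s, φ z * (κ s * G (z - s • e2)) := by
        refine integral_congr_ae (Filter.Eventually.of_forall fun z => ?_)
        exact (integral_const_mul _ _).symm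
    _ = ∫ s, ∫ z, φ z * (κ s * G (z - s • e2)) :=
        (integral_integral_swap_of_lintegral (by fun_prop) hfin').symm
    _ = ∫ s, ∫ z, φ (z + s • e2) * (κ s * G z) := by simp_rw [hshift]
    _ = ∫ z, ∫ s, φ (z + s • e2) * (κ s * G z) :=
        integral_integral_swap_of_lintegral (by fun_prop) hfin
    _ = _ := by
        refine integral_congr_ae (Filter.Eventually.of_forall fun z => ?_)
        simp only
        rw [← integral_mul_const]
        refine integral_congr_ae (Filter.Eventually.of_forall fun s => ?_)
        simp only
        ring

/-- The Fourier transform of the product with a function of time. -/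
theorem HasFT.timeMul {f : E3 → ℂ} (hf : HasFT f G) (hκ : Integrable κ) (mκ : Measurable κ)
    (hh : ∀ t : ℝ, h t = ∫ s, κ s * Complex.exp ((2 * Real.pi * (s * t) : ℝ) * Complex.I))
    (hg : (fun z : E3 => h (z 2)).HasTemperateGrowth) {B : ℝ} (hB : ∀ t, ‖h t‖ ≤ B)
    (hG : Measurable G) (hG2 : MemLp G 2 volume) :
    HasFT (fun z => h (z 2) * f z) (tconv κ G) where
  left := hf.left.bdd_mul hg.1.continuous.aestronglyMeasurable fun z => hB (z 2)
  right := (memLp_tconv hκ mκ hG hG2).isTemperedFun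
  integral_eq φ := by
    rw [integral_mul_tconv hκ mκ hG hG2]
    have := hf.integral_fourierInv (SchwartzMap.smulLeftCLM ℂ (fun z : E3 => h (z 2)) (𝓕 φ))
    simp_rw [fourierInv_timeMul_apply hκ mκ hh hg, FourierTransform.fourierInv_fourier_eq,
      SchwartzMap.smulLeftCLM_apply_apply hg] at this
    rw [this]
    refine integral_congr_ae (Filter.Eventually.of_forall fun z => ?_)
    simp only [smul_eq_mul]
    ring

end Time

/-! ### Kernels of time cutoffs -/

/-- The Fourier transform of the time cutoff `γ(2^K (t - t₀))`. -/
def timeKernel (γ : 𝓢(ℝ, ℂ)) (K : ℕ) (t₀ : ℝ) (s : ℝ) : ℂ :=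
  ((2 : ℝ) ^ K : ℝ)⁻¹ * (𝓕 γ) (s / 2 ^ K) * Complex.exp ((2 * Real.pi * (s * -t₀) : ℝ) * Complex.I)

theorem measurable_timeKernel (γ : 𝓢(ℝ, ℂ)) (K : ℕ) (t₀ : ℝ) : Measurable (timeKernel γ K t₀) := by
  have := (𝓕 γ).continuous.measurable
  unfold timeKernel
  fun_prop

theorem norm_timeKernel (γ : 𝓢(ℝ, ℂ)) (K : ℕ) (t₀ s : ℝ) :
    ‖timeKernel γ K t₀ s‖ = (2 ^ K)⁻¹ * ‖(𝓕 γ) (s / 2 ^ K)‖ := by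
  rw [timeKernel, norm_mul, norm_mul, Complex.norm_exp_ofReal_mul_I, mul_one,
    Complex.norm_real, Real.norm_of_nonneg (by positivity)]

theorem integrable_timeKernel (γ : 𝓢(ℝ, ℂ)) (K : ℕ) (t₀ : ℝ) : Integrable (timeKernel γ K t₀) := by
  have h : Integrable fun s => (2 ^ K : ℝ)⁻¹ * ‖(𝓕 γ) (s / 2 ^ K)‖ :=
    (((𝓕 γ).integrable (μ := volume)).comp_div (by positivity : (2 ^ K : ℝ) ≠ 0)).norm.const_mul _
  exact h.mono' (measurable_timeKernel γ K t₀).aestronglyMeasurable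
    (Filter.Eventually.of_forall fun s => (norm_timeKernel γ K t₀ s).le)

theorem integral_timeKernel (γ : 𝓢(ℝ, ℂ)) (K : ℕ) (t₀ t : ℝ) :
    γ (2 ^ K * (t - t₀)) =
      ∫ s, timeKernel γ K t₀ s * Complex.exp ((2 * Real.pi * (s * t) : ℝ) * Complex.I) := by
  have hK : (0 : ℝ) < 2 ^ K := by positivity
  have h1 : γ (2 ^ K * (t - t₀)) = (𝓕⁻ (𝓕 γ)) (2 ^ K * (t - t₀)) := by
    rw [FourierTransform.fourierInv_fourier_eq]
  rw [h1, SchwartzMap.fourierInv_coe, Real.fourierInv_eq']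
  set g : ℝ → ℂ := fun v => Complex.exp ((2 * Real.pi * inner ℝ v (2 ^ K * (t - t₀)) : ℝ) * Complex.I) •
    (𝓕 γ) v with hg
  have h2 := Measure.integral_comp_div g (2 ^ K)
  rw [abs_of_pos hK] at h2
  have h3 : ∫ v, g v = (2 ^ K : ℝ)⁻¹ • ∫ x, g (x / 2 ^ K) := by
    rw [h2, smul_smul, inv_mul_cancel₀ hK.ne', one_smul]
  rw [h3, ← integral_smul]
  refine integral_congr_ae (Filter.Eventually.of_forall fun s => ?_)
  simp only [hg, timeKernel, smul_eq_mul, Complex.real_smul]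
  rw [mul_assoc _ (Complex.exp _) (Complex.exp _), ← Complex.exp_add, ← add_mul, ← Complex.ofReal_add]
  have e : 2 * Real.pi * inner ℝ (s / 2 ^ K) (2 ^ K * (t - t₀)) =
      2 * Real.pi * (s * -t₀) + 2 * Real.pi * (s * t) := by
    simp only [RCLike.inner_apply, conj_trivial]
    field_simp
    ring
  rw [e, Complex.ofReal_inv]
  ring

/-- The centre t₀ enters only through a phase and K only through scaling, so one constant works for
all localizations; it comes from the decay of orders 0 and 4 of the transform of γ. -/
theorem exists_enorm_timeKernel_le (γ : 𝓢(ℝ, ℂ)) : ∃ A : ℝ, 0 ≤ A ∧ ∀ (K : ℕ) (t₀ s : ℝ),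
    ‖timeKernel γ K t₀ ((2 * Real.pi)⁻¹ * s)‖ₑ ≤ ENNReal.ofReal A * kernelW K s := by
  obtain ⟨C₀, h0, hC₀⟩ := (𝓕 γ).decay 0 0
  obtain ⟨C₄, h4, hC₄⟩ := (𝓕 γ).decay 4 0
  simp only [norm_iteratedFDeriv_zero, pow_zero, one_mul] at hC₀ hC₄
  have hA : 0 ≤ 2 * C₀ + 2 * (2 * Real.pi) ^ 4 * C₄ := by positivity
  refine ⟨_, hA, fun K t₀ s => ?_⟩
  rw [← ofReal_norm, norm_timeKernel, kernelW, ← ENNReal.ofReal_mul hA]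
  refine ENNReal.ofReal_le_ofReal ?_
  have hK : (0 : ℝ) < 2 ^ K := by positivity
  set x : ℝ := (2 * Real.pi)⁻¹ * s / 2 ^ K with hx
  have hs : s / 2 ^ K = 2 * Real.pi * x := by
    rw [hx]; field_simp
  rw [hs, mul_left_comm]
  refine mul_le_mul_of_nonneg_left ?_ (by positivity)
  rw [← div_eq_mul_inv, le_div_iff₀ (by positivity)]
  have e1 := hC₀ x
  have e2 := hC₄ x
  rw [Real.norm_eq_abs, Even.pow_abs (by decide)] at e2
  have e3 : (1 + (2 * Real.pi * x) ^ 2) ^ 2 ≤ 2 + 2 * (2 * Real.pi) ^ 4 * x ^ 4 := by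
    have : 2 * (2 * Real.pi) ^ 4 * x ^ 4 = 2 * ((2 * Real.pi * x) ^ 2) ^ 2 := by ring
    rw [this]
    nlinarith [sq_nonneg (1 - (2 * Real.pi * x) ^ 2)]
  calc ‖(𝓕 γ) x‖ * (1 + (2 * Real.pi * x) ^ 2) ^ 2
      ≤ ‖(𝓕 γ) x‖ * (2 + 2 * (2 * Real.pi) ^ 4 * x ^ 4) := mul_le_mul_of_nonneg_left e3 (norm_nonneg _)
    _ = 2 * ‖(𝓕 γ) x‖ + 2 * (2 * Real.pi) ^ 4 * (x ^ 4 * ‖(𝓕 γ) x‖) := by ring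
    _ ≤ _ := by gcongr

/-! ### Dilations -/

theorem lintegral_comp_smul {E : Type*} [NormedAddCommGroup E] [NormedSpace ℝ E] [MeasurableSpace E]
    [BorelSpace E] [FiniteDimensional ℝ E] (μ : Measure E) [μ.IsAddHaarMeasure] {f : E → ℝ≥0∞}
    (hf : Measurable f) {r : ℝ} (hr : r ≠ 0) :
    ∫⁻ x, f (r • x) ∂μ = ENNReal.ofReal |(r ^ Module.finrank ℝ E)⁻¹| * ∫⁻ x, f x ∂μ := by
  rw [← lintegral_map hf (measurable_const_smul r), Measure.map_addHaar_smul μ hr,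
    lintegral_smul_measure, smul_eq_mul]

/-- The Jacobian (2π)^{-n} is at most 1 and is thrown away, so changing between the two Fourier
normalizations costs no constant. -/
theorem lintegral_comp_two_pi_smul_le {E : Type*} [NormedAddCommGroup E] [NormedSpace ℝ E]
    [MeasurableSpace E] [BorelSpace E] [FiniteDimensional ℝ E] (μ : Measure E) [μ.IsAddHaarMeasure]
    {f : E → ℝ≥0∞} (hf : Measurable f) : ∫⁻ x, f ((2 * Real.pi) • x) ∂μ ≤ ∫⁻ x, f x ∂μ := by
  rw [lintegral_comp_smul μ hf (by positivity)]
  refine mul_le_of_le_one_left' ?_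
  rw [← ENNReal.ofReal_one]
  refine ENNReal.ofReal_le_ofReal ?_
  rw [abs_of_nonneg (by positivity)]
  exact inv_le_one_of_one_le₀ (one_le_pow₀ (by linarith [Real.pi_gt_three]))

theorem quasiMeasurePreserving_smul {r : ℝ} (hr : r ≠ 0) :
    Measure.QuasiMeasurePreserving (fun z : E3 => r • z) volume volume :=
  ⟨measurable_const_smul r, by
    rw [Measure.map_addHaar_smul volume hr]
    exact Measure.smul_absolutelyContinuous⟩

theorem l2_comp_two_pi_smul_le {f : E3 → ℝ≥0∞} (hf : Measurable f) :
    l2 volume (fun z => f ((2 * Real.pi) • z)) ≤ l2 volume f :=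
  l2_le_of_sq_le (by
    rw [l2_sq]
    exact lintegral_comp_two_pi_smul_le volume (hf.pow_const 2))

theorem enorm_tconv_dilate_le {γ : 𝓢(ℝ, ℂ)} {A : ℝ} {K : ℕ} {t₀ : ℝ}
    (hA : ∀ s : ℝ, ‖timeKernel γ K t₀ ((2 * Real.pi)⁻¹ * s)‖ₑ ≤ ENNReal.ofReal A * kernelW K s)
    {g : E3 → ℂ} (hg : Measurable g) (z : E3) :
    ‖tconv (timeKernel γ K t₀) (fun w => g ((2 * Real.pi) • w)) z‖ₑ ≤
      ENNReal.ofReal A * tlconv (kernelW K) (fun w => ‖g w‖ₑ) ((2 * Real.pi) • z) := by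
  have mκ := measurable_timeKernel γ K t₀
  have h2π : 2 * Real.pi ≠ 0 := by positivity
  set F : ℝ → ℝ≥0∞ := fun s => ‖timeKernel γ K t₀ ((2 * Real.pi)⁻¹ * s)‖ₑ *
    ‖g ((2 * Real.pi) • z - s • e2)‖ₑ with hF
  have mF : Measurable F := by fun_prop
  calc _ ≤ ∫⁻ s, F ((2 * Real.pi) • s) := by
        refine (enorm_tconv_le _ _ z).trans (le_of_eq (lintegral_congr fun s => ?_))
        simp only [hF, smul_eq_mul]
        rw [inv_mul_cancel_left₀ h2π, smul_sub, smul_smul]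
    _ ≤ ∫⁻ s, F s := lintegral_comp_two_pi_smul_le volume mF
    _ ≤ ∫⁻ s, ENNReal.ofReal A * (kernelW K s * ‖g ((2 * Real.pi) • z - s • e2)‖ₑ) := by
        refine lintegral_mono fun s => ?_
        rw [← mul_assoc]
        exact mul_le_mul_left (hA s) _
    _ = _ := lintegral_const_mul _ (by have := measurable_kernelW K; fun_prop)

theorem lconv_dilate_le {F G : E3 → ℝ≥0∞} (hF : Measurable F) (hG : Measurable G) (z : E3) :
    lconv volume (fun w => F ((2 * Real.pi) • w)) (fun w => G ((2 * Real.pi) • w))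
      ((2 * Real.pi)⁻¹ • z) ≤ lconv volume F G z := by
  have h2π : 2 * Real.pi ≠ 0 := by positivity
  refine le_trans (le_of_eq (lintegral_congr fun w => ?_))
    (lintegral_comp_two_pi_smul_le volume (f := fun w => F w * G (z - w)) (by fun_prop))
  simp only
  rw [smul_sub, smul_inv_smul₀ h2π]

/-! ### Localization in time of distributions -/

/-- The time cutoff at scale `2^{-k}` around `t₀`. -/
def timeCut (η₀ : ℝ → ℝ) (k : ℕ) (t₀ : ℝ) (z : E3) : ℂ := (η₀ ((2 : ℝ) ^ k * (z 2 - t₀)) : ℂ)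

section TimeLoc

variable {η₀ : ℝ → ℝ}

theorem IsCutoff.hasTemperateGrowth_timeCut (hη : IsCutoff η₀) (k : ℕ) (t₀ : ℝ) :
    (timeCut η₀ k t₀).HasTemperateGrowth := hη.timeSymbol_hasTemperateGrowth k t₀

theorem IsCutoff.norm_timeCut_le (hη : IsCutoff η₀) (k : ℕ) (t₀ : ℝ) (z : E3) :
    ‖timeCut η₀ k t₀ z‖ ≤ 1 := by
  rw [timeCut, Complex.norm_real, Real.norm_of_nonneg (hη.mem_Icc _).1]
  exact (hη.mem_Icc _).2

theorem IsCutoff.isTemperedFun_timeCut_mul (hη : IsCutoff η₀) (k : ℕ) (t₀ : ℝ) {f : E3 → ℂ}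
    (hf : IsTemperedFun f) : IsTemperedFun fun z => timeCut η₀ k t₀ z * f z :=
  hf.bdd_mul (hη.hasTemperateGrowth_timeCut k t₀).1.continuous.aestronglyMeasurable
    (hη.norm_timeCut_le k t₀)

theorem IsCutoff.timeLoc_toTD (hη : IsCutoff η₀) (k : ℕ) (t₀ : ℝ) {f : E3 → ℂ}
    (hf : IsTemperedFun f) : timeLoc η₀ k t₀ (toTD f) = toTD fun z => timeCut η₀ k t₀ z * f z := by
  ext φ
  rw [timeLoc, TemperedDistribution.smulLeftCLM_apply_apply, toTD_apply hf,
    toTD_apply (hη.isTemperedFun_timeCut_mul k t₀ hf)]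
  refine integral_congr_ae (Filter.Eventually.of_forall fun z => ?_)
  simp only
  rw [SchwartzMap.smulLeftCLM_apply_apply (hη.timeSymbol_hasTemperateGrowth k t₀), smul_eq_mul,
    timeCut]
  ring

/-- The symbol of `∂_x P_k`, in Mathlib's normalization. -/
def outSymbol (η₀ : ℝ → ℝ) (k : ℕ) (ζ : E3) : ℂ :=
  (2 * Real.pi * Complex.I) * ((ζ 0 : ℂ) * (chi η₀ k (2 * Real.pi * ζ 0) : ℂ))

theorem IsCutoff.hasTemperateGrowth_outSymbol (hη : IsCutoff η₀) (k : ℕ) :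
    (outSymbol η₀ k).HasTemperateGrowth := by
  have h0 : (fun z : E3 => z 0).HasTemperateGrowth :=
    (EuclideanSpace.proj (𝕜 := ℝ) (0 : Fin 3)).hasTemperateGrowth
  have h1 : (fun z : E3 => ((z 0 : ℝ) : ℂ)).HasTemperateGrowth :=
    Function.HasTemperateGrowth.comp Function.Complex.hasTemperateGrowth_ofReal h0
  exact (Function.HasTemperateGrowth.const _).mul (h1.mul (hη.projSymbol_hasTemperateGrowth k))

theorem outSymbol_add_smul_e2 (k : ℕ) (w : E3) (s : ℝ) :
    outSymbol η₀ k (w + s • e2) = outSymbol η₀ k w := by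
  have : (w + s • e2) 0 = w 0 := by simp [e2]
  rw [outSymbol, this, outSymbol]

theorem IsCutoff.norm_outSymbol_le (hη : IsCutoff η₀) (k : ℕ) (ζ : E3) :
    ‖outSymbol η₀ k ζ‖ ≤ 2 * 2 ^ k := by
  have e : ‖outSymbol η₀ k ζ‖ = |2 * Real.pi * ζ 0| * |chi η₀ k (2 * Real.pi * ζ 0)| := by
    rw [outSymbol]
    simp only [norm_mul, Complex.norm_real, Complex.norm_I, Real.norm_eq_abs, abs_mul]
    simp
    ring
  rw [e]
  by_cases h : chi η₀ k (2 * Real.pi * ζ 0) = 0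
  · rw [h, abs_zero, mul_zero]; positivity
  · have h1 := (hη.abs_bounds_of_chi_ne_zero h).2
    rw [zpow_natCast] at h1
    have h2 := hη.abs_chi_le k (2 * Real.pi * ζ 0)
    have h3 : (0 : ℝ) < 2 ^ k := by positivity
    calc _ ≤ |2 * Real.pi * ζ 0| * 1 := mul_le_mul_of_nonneg_left h2 (abs_nonneg _)
      _ ≤ _ := by linarith

/-- A cutoff as a Schwartz function. -/
def IsCutoff.toSchwartz (hη : IsCutoff η₀) : 𝓢(ℝ, ℂ) :=
  ((HasCompactSupport.of_support_subset_isCompact isCompact_Icc hη.support_subset).comp_left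
    (g := Complex.ofRealCLM) (map_zero _)).toSchwartzMap (by have := hη.smooth; fun_prop)

theorem IsCutoff.toSchwartz_apply (hη : IsCutoff η₀) (s : ℝ) : hη.toSchwartz s = (η₀ s : ℂ) := rfl

theorem IsCutoff.fourierInv_timeCut_apply (hη : IsCutoff η₀) (k : ℕ) (t₀ : ℝ) (ψ : 𝓢(E3, ℂ))
    (w : E3) : (𝓕⁻ (SchwartzMap.smulLeftCLM ℂ (timeCut η₀ k t₀) ψ)) w =
      ∫ s, timeKernel hη.toSchwartz k t₀ s * (𝓕⁻ ψ) (w + s • e2) :=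
  fourierInv_timeMul_apply (integrable_timeKernel _ _ _) (measurable_timeKernel _ _ _)
    (h := fun t => (η₀ ((2 : ℝ) ^ k * (t - t₀)) : ℂ)) (fun t => (hη.toSchwartz_apply _).symm.trans (integral_timeKernel _ _ _ t))
    (hη.hasTemperateGrowth_timeCut k t₀) ψ w

/-- Time localization commutes with Fourier multipliers in the spatial frequency. -/
theorem IsCutoff.timeCut_outSymbol_comm (hη : IsCutoff η₀) (k l : ℕ) (t₀ : ℝ) (φ : 𝓢(E3, ℂ)) :
    𝓕 (SchwartzMap.smulLeftCLM ℂ (outSymbol η₀ l)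
      (𝓕⁻ (SchwartzMap.smulLeftCLM ℂ (timeCut η₀ k t₀) (𝓕 φ)))) =
    SchwartzMap.smulLeftCLM ℂ (timeCut η₀ k t₀)
      (𝓕 (SchwartzMap.smulLeftCLM ℂ (outSymbol η₀ l) φ)) := by
  have key : SchwartzMap.smulLeftCLM ℂ (outSymbol η₀ l)
      (𝓕⁻ (SchwartzMap.smulLeftCLM ℂ (timeCut η₀ k t₀) (𝓕 φ))) =
      𝓕⁻ (SchwartzMap.smulLeftCLM ℂ (timeCut η₀ k t₀)
      (𝓕 (SchwartzMap.smulLeftCLM ℂ (outSymbol η₀ l) φ))) := by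
    ext w
    rw [SchwartzMap.smulLeftCLM_apply_apply (hη.hasTemperateGrowth_outSymbol l),
      hη.fourierInv_timeCut_apply, hη.fourierInv_timeCut_apply,
      FourierTransform.fourierInv_fourier_eq, FourierTransform.fourierInv_fourier_eq, smul_eq_mul,
      ← integral_const_mul]
    refine integral_congr_ae (Filter.Eventually.of_forall fun s => ?_)
    simp only
    rw [SchwartzMap.smulLeftCLM_apply_apply (hη.hasTemperateGrowth_outSymbol l),
      outSymbol_add_smul_e2, smul_eq_mul]
    ring
  rw [key, FourierTransform.fourier_fourierInv_eq]

theorem IsCutoff.proj_dx_apply (hη : IsCutoff η₀) (l : ℕ) (T : 𝓢'(E3, ℂ)) (φ : 𝓢(E3, ℂ)) :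
    proj η₀ l (dx T) φ = T (𝓕 (SchwartzMap.smulLeftCLM ℂ (outSymbol η₀ l) (𝓕⁻ φ))) := by
  rw [proj, TemperedDistribution.fourierMultiplierCLM_apply_apply, dx,
    TemperedDistribution.lineDerivOp_apply_apply, SchwartzMap.lineDerivOp_fourier_eq,
    ← FourierTransform.fourier_neg]
  congr 2
  ext w
  have h0 : (fun z : E3 => inner ℝ z (EuclideanSpace.single 0 1 : E3)).HasTemperateGrowth := by
    fun_prop
  simp only [neg_smul, neg_neg, smul_apply]
  rw [SchwartzMap.smulLeftCLM_apply_apply h0,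
    SchwartzMap.smulLeftCLM_apply_apply (hη.projSymbol_hasTemperateGrowth l),
    SchwartzMap.smulLeftCLM_apply_apply (hη.hasTemperateGrowth_outSymbol l),
    EuclideanSpace.inner_single_right, outSymbol]
  simp
  ring

/-- The symbol of P_k ∂_x does not involve τ, so it commutes with convolution in τ, that is, with
the time cutoff. The cutoff can therefore be placed directly on the product of functions. -/
theorem IsCutoff.isFourierOf_output (hη : IsCutoff η₀) (k : ℕ) (t₀ : ℝ) {w H : E3 → ℂ}
    (hw : IsTemperedFun w) (hH : HasFT (fun z => timeCut η₀ k t₀ z * w z) H) :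
    IsFourierOf (timeLoc η₀ k t₀ (proj η₀ k (dx (toTD w))))
      (fun ζ => Complex.I * ((ζ 0 * chi η₀ k (ζ 0) : ℝ) : ℂ) * H ((2 * Real.pi)⁻¹ • ζ)) := by
  have e : (fun ζ : E3 => Complex.I * ((((2 * Real.pi) • ζ) 0 * chi η₀ k (((2 * Real.pi) • ζ) 0) : ℝ) : ℂ) *
      H ((2 * Real.pi)⁻¹ • (2 * Real.pi) • ζ)) = fun ζ => outSymbol η₀ k ζ * H ζ := by
    ext ζ
    rw [inv_smul_smul₀ (by positivity), outSymbol]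
    simp only [PiLp.smul_apply, smul_eq_mul]
    push_cast
    ring
  have ht : IsTemperedFun fun ζ => outSymbol η₀ k ζ * H ζ :=
    hH.right.bdd_mul (hη.hasTemperateGrowth_outSymbol k).1.continuous.aestronglyMeasurable
      (hη.norm_outSymbol_le k)
  unfold IsFourierOf
  simp only
  rw [e]
  refine ⟨ht, ?_⟩
  ext φ
  rw [toTD_apply ht, TemperedDistribution.fourier_apply, timeLoc,
    TemperedDistribution.smulLeftCLM_apply_apply, hη.proj_dx_apply]
  have h1 := hη.timeCut_outSymbol_comm k k t₀ φ
  unfold timeCut at h1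
  rw [h1, toTD_apply hw]
  have h2 := hH.integral_eq (SchwartzMap.smulLeftCLM ℂ (outSymbol η₀ k) φ)
  calc _ = ∫ z, (𝓕 (SchwartzMap.smulLeftCLM ℂ (outSymbol η₀ k) φ)) z * (timeCut η₀ k t₀ z * w z) := by
        refine integral_congr_ae (Filter.Eventually.of_forall fun z => ?_)
        simp only
        rw [SchwartzMap.smulLeftCLM_apply_apply (hη.timeSymbol_hasTemperateGrowth k t₀), smul_eq_mul,
          timeCut]
        ring
    _ = _ := h2.symm
    _ = _ := by
        refine integral_congr_ae (Filter.Eventually.of_forall fun z => ?_)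
        simp only
        rw [SchwartzMap.smulLeftCLM_apply_apply (hη.hasTemperateGrowth_outSymbol k), smul_eq_mul]
        ring

end TimeLoc

/-! ### A partition of the time cutoff -/

/-- The pieces, at scale `1/32`, of a cutoff. -/
def cutPiece (η₀ : ℝ → ℝ) (n : ℕ) (s : ℝ) : ℝ :=
  η₀ s * (Real.smoothTransition (32 * s + 60 - n) - Real.smoothTransition (32 * s + 60 - (n + 1 : ℕ)))

section Partition

variable {η₀ : ℝ → ℝ}

/-- A telescoping sum. For |s| ≤ 8/5 the number 32s+60 lies between 8.8 and 111.2, so the transition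
is 1 at n = 0 and 0 at n = 121. -/
theorem IsCutoff.sum_cutPiece (hη : IsCutoff η₀) (s : ℝ) :
    ∑ n ∈ Finset.range 121, cutPiece η₀ n s = η₀ s := by
  by_cases hs : η₀ s = 0
  · simp [cutPiece, hs]
  have h1 : |s| ≤ 8 / 5 := by
    by_contra h
    exact hs (hη.eq_zero (not_le.1 h))
  rw [abs_le] at h1
  unfold cutPiece
  rw [← Finset.mul_sum,
    Finset.sum_range_sub' (fun n : ℕ => Real.smoothTransition (32 * s + 60 - n)),
    Real.smoothTransition.one_of_one_le, Real.smoothTransition.zero_of_nonpos, sub_zero, mul_one]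
  · push_cast; linarith [h1.2]
  · push_cast; linarith [h1.1]

theorem IsCutoff.contDiff_cutPiece (hη : IsCutoff η₀) (n : ℕ) : ContDiff ℝ ∞ (cutPiece η₀ n) := by
  have h1 := hη.smooth
  have h2 : ContDiff ℝ ∞ Real.smoothTransition := Real.smoothTransition.contDiff
  unfold cutPiece
  fun_prop

theorem IsCutoff.abs_cutPiece_le (hη : IsCutoff η₀) (n : ℕ) (s : ℝ) : |cutPiece η₀ n s| ≤ 1 := by
  rw [cutPiece, abs_mul]
  have h1 := hη.mem_Icc s
  refine mul_le_one₀ ?_ (abs_nonneg _) ?_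
  · rw [abs_of_nonneg h1.1]; exact h1.2
  · have a1 := Real.smoothTransition.nonneg (32 * s + 60 - n)
    have a2 := Real.smoothTransition.le_one (32 * s + 60 - n)
    have b1 := Real.smoothTransition.nonneg (32 * s + 60 - (n + 1 : ℕ))
    have b2 := Real.smoothTransition.le_one (32 * s + 60 - (n + 1 : ℕ))
    rw [abs_le]; constructor <;> linarith

theorem IsCutoff.abs_le_of_cutPiece_ne_zero (hη : IsCutoff η₀) {n : ℕ} {s : ℝ}
    (h : cutPiece η₀ n s ≠ 0) : |s| ≤ 8 / 5 ∧ |s - (n - 59) / 32| ≤ 1 / 32 := by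
  refine ⟨?_, ?_⟩
  · by_contra hc
    exact h (by rw [cutPiece, hη.eq_zero (not_le.1 hc), zero_mul])
  · have hlo : 0 ≤ 32 * s + 60 - n := by
      by_contra hc
      rw [not_le] at hc
      apply h
      rw [cutPiece, Real.smoothTransition.zero_of_nonpos hc.le,
        Real.smoothTransition.zero_of_nonpos (by push_cast; linarith), sub_zero, mul_zero]
    have hhi : 32 * s + 60 - n ≤ 2 := by
      by_contra hc
      rw [not_le] at hc
      apply h
      rw [cutPiece, Real.smoothTransition.one_of_one_le (by linarith),
        Real.smoothTransition.one_of_one_le (by push_cast; linarith), sub_self, mul_zero]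
    rw [abs_le]; constructor <;> linarith

theorem IsCutoff.hasCompactSupport_cutPiece (hη : IsCutoff η₀) (n : ℕ) :
    HasCompactSupport (cutPiece η₀ n) :=
  HasCompactSupport.of_support_subset_isCompact (isCompact_Icc (a := -(8 / 5 : ℝ)) (b := 8 / 5))
    fun _ hs => abs_le.1 (hη.abs_le_of_cutPiece_ne_zero hs).1

/-- The pieces of a cutoff as Schwartz functions. -/
def IsCutoff.pieceSchwartz (hη : IsCutoff η₀) (n : ℕ) : 𝓢(ℝ, ℂ) :=
  ((hη.hasCompactSupport_cutPiece n).comp_left (g := Complex.ofRealCLM) (map_zero _)).toSchwartzMap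
    (by have := hη.contDiff_cutPiece n; fun_prop)

theorem IsCutoff.pieceSchwartz_apply (hη : IsCutoff η₀) (n : ℕ) (s : ℝ) :
    hη.pieceSchwartz n s = (cutPiece η₀ n s : ℂ) := rfl

/-- The window of v may be up to 32 times shorter than that of the output, hence pieces of radius
2^{-k₃}/32 around centres that move with n. The window of u is at least 32 times longer than that of
the output, so it can stay centred at t₀ for every piece. -/
theorem IsCutoff.timeCut_mul_eq_sum (hη : IsCutoff η₀) {k₁ k₂ k₃ : ℕ} (h₁ : k₁ + 5 ≤ k₃)
    (h₂ : k₂ ≤ k₃ + 5) (t₀ : ℝ) (a b : ℂ) (z : E3) :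
    timeCut η₀ k₃ t₀ z * (a * b) = ∑ n ∈ Finset.range 121,
      hη.pieceSchwartz n (2 ^ k₃ * (z 2 - t₀)) * (timeCut η₀ k₁ t₀ z * a) *
        (timeCut η₀ k₂ (t₀ + (2 ^ k₃)⁻¹ * ((n - 59) / 32)) z * b) := by
  have hk₃ : (0 : ℝ) < 2 ^ k₃ := by positivity
  rw [timeCut, ← hη.sum_cutPiece, Complex.ofReal_sum, Finset.sum_mul]
  refine Finset.sum_congr rfl fun n _ => ?_
  rw [hη.pieceSchwartz_apply]
  by_cases h : cutPiece η₀ n (2 ^ k₃ * (z 2 - t₀)) = 0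
  · rw [h]; simp
  obtain ⟨e1, e2⟩ := hη.abs_le_of_cutPiece_ne_zero h
  have f1 : timeCut η₀ k₁ t₀ z = 1 := by
    rw [timeCut, hη.eq_one_of_abs_le, Complex.ofReal_one]
    rw [abs_mul, abs_of_pos hk₃] at e1
    rw [abs_mul, abs_of_pos (by positivity)]
    have : (2 : ℝ) ^ k₁ * 2 ^ 5 ≤ 2 ^ k₃ := by
      rw [← pow_add]; exact pow_le_pow_right₀ (by norm_num) h₁
    nlinarith [abs_nonneg (z 2 - t₀)]
  have f2 : timeCut η₀ k₂ (t₀ + (2 ^ k₃)⁻¹ * ((n - 59) / 32)) z = 1 := by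
    rw [timeCut, hη.eq_one_of_abs_le, Complex.ofReal_one]
    have e3 : (2 : ℝ) ^ k₃ * (z 2 - t₀) - (n - 59) / 32 =
        2 ^ k₃ * (z 2 - (t₀ + (2 ^ k₃)⁻¹ * ((n - 59) / 32))) := by
      field_simp
      ring
    rw [e3, abs_mul, abs_of_pos hk₃] at e2
    rw [abs_mul, abs_of_pos (by positivity)]
    have : (2 : ℝ) ^ k₂ ≤ 2 ^ k₃ * 2 ^ 5 := by
      rw [← pow_add]; exact pow_le_pow_right₀ (by norm_num) h₂
    nlinarith [abs_nonneg (z 2 - (t₀ + (2 ^ k₃)⁻¹ * ((n - 59) / 32)))]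
  rw [f1, f2]
  ring

end Partition

/-! ### Localized Fourier transforms of elements of `F_k` -/

theorem normX_congr {η₀ : ℝ → ℝ} {g g' : E3 → ℂ} (h : g =ᵐ[volume] g') :
    normX η₀ g = normX η₀ g' := by
  unfold normX
  refine tsum_congr fun j => ?_
  congr 1
  refine eLpNorm_congr_ae ?_
  filter_upwards [h] with z hz
  rw [hz]

theorem measurableSet_freqSet (k : ℕ) : MeasurableSet (freqSet k) := by
  have hI : ∀ j : ℤ, MeasurableSet (dyadicI j) := fun j =>
    (measurable_norm (α := ℝ)) measurableSet_Ico
  unfold freqSet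
  split_ifs
  · exact MeasurableSet.biUnion (Set.to_countable _) fun j _ => hI j
  · exact hI _

theorem ae_eq_of_comp_smul {g g' : E3 → ℂ} {r : ℝ} (hr : r ≠ 0)
    (h : (fun z => g (r • z)) =ᵐ[volume] fun z => g' (r • z)) : g =ᵐ[volume] g' := by
  have := (quasiMeasurePreserving_smul (inv_ne_zero hr)).ae_eq_comp h
  simpa [Function.comp_def, smul_inv_smul₀ hr] using this

section Localized

variable {η₀ : ℝ → ℝ} {k : ℕ} {u : E3 → ℂ}

/-- The properties of the Fourier transform of a time localization that are used. -/
structure LocalizedFT (η₀ : ℝ → ℝ) (k : ℕ) (u : E3 → ℂ) (t₀ : ℝ) (g : E3 → ℂ) : Prop where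
  measurable : Measurable g
  support : ∀ z, g z ≠ 0 → z 0 ∈ freqSet k
  hasFT : HasFT (fun z => timeCut η₀ k t₀ z * u z) (fun ζ => g ((2 * Real.pi) • ζ))
  normX_ne_top : normX η₀ g ≠ ⊤

/-- The transform is replaced by a Borel representative vanishing everywhere outside its frequency
set, since the counting lemmas need pointwise support conditions. -/
theorem IsCutoff.exists_localizedFT (hη : IsCutoff η₀) (hu : MemF η₀ k u) (t₀ : ℝ) :
    ∃ g, LocalizedFT η₀ k u t₀ g := by
  obtain ⟨hu1, hu2, -⟩ := hu
  obtain ⟨g, ⟨ht, hF⟩, hg, hsupp, hfin⟩ := hu2 t₀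
  rw [hη.timeLoc_toTD k t₀ hu1] at hF
  have hFT := hasFT_of_fourier_toTD (hη.isTemperedFun_timeCut_mul k t₀ hu1) ht hF
  set S : Set E3 := {z | z 0 ∈ freqSet k}
  have hS : MeasurableSet S := (measurableSet_freqSet k).preimage (measurable_coord 0)
  set g' : E3 → ℂ := S.indicator (hg.mk g)
  have hgg' : g =ᵐ[volume] g' := by
    filter_upwards [hg.ae_eq_mk, hsupp] with z h1 h2
    by_cases hz : z ∈ S
    · simp only [g']
      rw [indicator_of_mem hz, h1]
    · simp only [g']
      rw [indicator_of_notMem hz, h2 hz]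
  refine ⟨g', hg.stronglyMeasurable_mk.measurable.indicator hS, ?_, ?_, ?_⟩
  · exact fun z hz => show z ∈ S from mem_of_indicator_ne_zero hz
  · exact hFT.congr (Filter.EventuallyEq.refl _ _)
      ((quasiMeasurePreserving_smul (by positivity)).ae_eq_comp hgg')
  · rw [← normX_congr hgg']
    exact hfin.ne

variable {t₀ : ℝ} {g : E3 → ℂ}

theorem LocalizedFT.measurable_dilate (h : LocalizedFT η₀ k u t₀ g) :
    Measurable fun ζ : E3 => g ((2 * Real.pi) • ζ) :=
  h.measurable.comp (measurable_const_smul _)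

theorem LocalizedFT.memLp (h : LocalizedFT η₀ k u t₀ g) (hη : IsCutoff η₀) :
    MemLp (fun ζ => g ((2 * Real.pi) • ζ)) 2 volume :=
  memLp_two_of_l2 h.measurable_dilate (ne_top_of_le_ne_top h.normX_ne_top
    ((l2_comp_two_pi_smul_le h.measurable.enorm).trans (hη.l2_enorm_le_normX h.measurable)))

theorem LocalizedFT.eLpNorm_le (h : LocalizedFT η₀ k u t₀ g) (hη : IsCutoff η₀) :
    eLpNorm (fun z => timeCut η₀ k t₀ z * u z) 2 volume ≤ normX η₀ g := by
  rw [h.hasFT.eLpNorm_eq (h.memLp hη), eLpNorm_two_eq_l2]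
  exact (l2_comp_two_pi_smul_le h.measurable.enorm).trans (hη.l2_enorm_le_normX h.measurable)

/-- All admissible representatives agree almost everywhere, so the infimum in `normF` is attained by
each of them. -/
theorem LocalizedFT.normX_le (h : LocalizedFT η₀ k u t₀ g) (hη : IsCutoff η₀)
    (hu : IsTemperedFun u) : normX η₀ g ≤ normF η₀ k (toTD u) := by
  refine le_iSup_of_le t₀ (le_iInf₂ fun g' hg' => le_of_eq ?_)
  obtain ⟨ht, hF⟩ := hg'
  rw [hη.timeLoc_toTD k t₀ hu] at hF
  have hFT := hasFT_of_fourier_toTD (hη.isTemperedFun_timeCut_mul k t₀ hu) ht hF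
  exact normX_congr (ae_eq_of_comp_smul (by positivity) (h.hasFT.unique hFT))

end Localized

/-! ### The product is a tempered distribution -/

/-- Integrate the slab bounds against dt/(1+t²) and exchange the integrals. Each point z is then
counted over a t-interval of length 2δ on which the weight is at least (1+‖z‖)^{-2}/4, so f is
integrable against (1+‖z‖)^{-2}. -/
theorem isTemperedFun_of_slab {f : E3 → ℂ} (hf : AEStronglyMeasurable f volume) {δ : ℝ} (hδ : 0 < δ)
    (hδ1 : δ ≤ 1) {B : ℝ≥0∞} (hB : B ≠ ⊤)
    (h : ∀ t₀ : ℝ, ∫⁻ z in {z : E3 | |z 2 - t₀| ≤ δ}, ‖f z‖ₑ ≤ B) : IsTemperedFun f := by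
  wlog hm : Measurable f generalizing f
  · refine (this (f := hf.mk f) hf.stronglyMeasurable_mk.aestronglyMeasurable (fun t₀ => ?_)
      hf.stronglyMeasurable_mk.measurable).congr hf.ae_eq_mk.symm
    refine le_trans (le_of_eq (lintegral_congr_ae ?_)) (h t₀)
    filter_upwards [ae_restrict_of_ae hf.ae_eq_mk] with z hz
    rw [hz]
  set w : ℝ → ℝ≥0∞ := fun t => ENNReal.ofReal (1 + t ^ 2)⁻¹ with hw
  have mw : Measurable w := by fun_prop
  have hwint : ∫⁻ t, w t ≠ ⊤ := by
    rw [← ofReal_integral_eq_lintegral_ofReal integrable_inv_one_add_sq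
      (Filter.Eventually.of_forall fun s => by positivity)]
    exact ENNReal.ofReal_ne_top
  have mslab : ∀ t₀ : ℝ, MeasurableSet {z : E3 | |z 2 - t₀| ≤ δ} := fun t₀ =>
    measurableSet_le (by fun_prop) (by fun_prop)
  set F : ℝ → E3 → ℝ≥0∞ := fun t z => w t * (Icc (z 2 - δ) (z 2 + δ)).indicator 1 t * ‖f z‖ₑ with hF
  have mF : Measurable (Function.uncurry F) := by
    have : Measurable fun q : ℝ × E3 => (Icc (q.2 2 - δ) (q.2 2 + δ)).indicator (1 : ℝ → ℝ≥0∞) q.1 := by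
      have hs : MeasurableSet {q : ℝ × E3 | q.1 ∈ Icc (q.2 2 - δ) (q.2 2 + δ)} :=
        measurableSet_and (measurableSet_le (by fun_prop) (by fun_prop))
          (measurableSet_le (by fun_prop) (by fun_prop))
      have := (measurable_const : Measurable fun _ : ℝ × E3 => (1 : ℝ≥0∞)).indicator hs
      convert this using 1
      ext q
      by_cases hq : q.1 ∈ Icc (q.2 2 - δ) (q.2 2 + δ)
      · rw [indicator_of_mem hq, indicator_of_mem (by exact hq)]; rfl
      · rw [indicator_of_notMem hq, indicator_of_notMem (by exact hq)]
    simp only [hF, Function.uncurry_def]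
    fun_prop
  have h1 : ∫⁻ t, ∫⁻ z, F t z ≤ (∫⁻ t, w t) * B := by
    rw [← lintegral_mul_const _ mw]
    refine lintegral_mono fun t => ?_
    calc ∫⁻ z, F t z = ∫⁻ z, w t * ({z : E3 | |z 2 - t| ≤ δ}.indicator (fun z => ‖f z‖ₑ) z) := by
          refine lintegral_congr fun z => ?_
          simp only [hF]
          rw [mul_assoc]
          congr 1
          by_cases hz : |z 2 - t| ≤ δ
          · have ht : t ∈ Icc (z 2 - δ) (z 2 + δ) := by
              rw [abs_le] at hz
              exact ⟨by linarith, by linarith⟩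
            rw [indicator_of_mem ht, indicator_of_mem (show z ∈ {z : E3 | |z 2 - t| ≤ δ} from hz),
              Pi.one_apply, one_mul]
          · have ht : t ∉ Icc (z 2 - δ) (z 2 + δ) := fun h' =>
              hz (abs_le.2 ⟨by linarith [h'.2], by linarith [h'.1]⟩)
            rw [indicator_of_notMem ht, indicator_of_notMem (show z ∉ {z : E3 | |z 2 - t| ≤ δ} from hz),
              zero_mul]
      _ = w t * ∫⁻ z in {z : E3 | |z 2 - t| ≤ δ}, ‖f z‖ₑ := by
          rw [lintegral_const_mul _ (hm.enorm.indicator (mslab t)), lintegral_indicator (mslab t)]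
      _ ≤ w t * B := mul_le_mul_right (h t) _
  have h2 : ∀ z, ENNReal.ofReal (δ / 2) * ENNReal.ofReal (((1 + ‖z‖) ^ 2)⁻¹ * ‖f z‖) ≤
      ∫⁻ t, F t z := by
    intro z
    have hz2 : |z 2| ≤ ‖z‖ := by
      simpa using EuclideanSpace.norm_eq z ▸ (Real.abs_le_sqrt (by
        rw [Fin.sum_univ_three]
        simp only [Real.norm_eq_abs, sq_abs]
        nlinarith [sq_nonneg (z 0), sq_nonneg (z 1)]))
    have hlow : ∀ t ∈ Icc (z 2 - δ) (z 2 + δ), ENNReal.ofReal (4 * (1 + ‖z‖) ^ 2)⁻¹ ≤ w t := by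
      intro t ht
      refine ENNReal.ofReal_le_ofReal (inv_anti₀ (by positivity) ?_)
      have : |t| ≤ 1 + ‖z‖ := by
        rw [abs_le] at hz2 ⊢
        constructor <;> linarith [ht.1, ht.2]
      have h3 : t ^ 2 ≤ (1 + ‖z‖) ^ 2 := by
        rw [← sq_abs t]; exact pow_le_pow_left₀ (abs_nonneg _) this 2
      nlinarith [norm_nonneg z]
    calc _ = ∫⁻ t in Icc (z 2 - δ) (z 2 + δ), ENNReal.ofReal (4 * (1 + ‖z‖) ^ 2)⁻¹ * ‖f z‖ₑ := by
          rw [lintegral_const, Measure.restrict_apply_univ, Real.volume_Icc, ← ofReal_norm,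
            ← ENNReal.ofReal_mul (by positivity), ← ENNReal.ofReal_mul (by positivity),
            ← ENNReal.ofReal_mul (by positivity)]
          congr 1
          rw [mul_inv]
          ring
      _ ≤ ∫⁻ t in Icc (z 2 - δ) (z 2 + δ), w t * ‖f z‖ₑ :=
          setLIntegral_mono (by fun_prop) fun t ht => mul_le_mul_left (hlow t ht) _
      _ = _ := by
          rw [← lintegral_indicator measurableSet_Icc]
          refine lintegral_congr fun t => ?_
          by_cases ht : t ∈ Icc (z 2 - δ) (z 2 + δ)
          · simp [hF, ht]
          · simp only [hF]
            rw [indicator_of_notMem ht, indicator_of_notMem ht]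
            simp
  have h3 : ENNReal.ofReal (δ / 2) * ∫⁻ z, ENNReal.ofReal (((1 + ‖z‖) ^ 2)⁻¹ * ‖f z‖) ≠ ⊤ := by
    rw [← lintegral_const_mul _ (by fun_prop)]
    refine ne_top_of_le_ne_top (ENNReal.mul_ne_top hwint hB) ((lintegral_mono h2).trans ?_)
    rwa [lintegral_lintegral_swap mF.aemeasurable] at h1
  refine ⟨hf, 2, Measurable.aestronglyMeasurable (by fun_prop), ?_⟩
  rw [hasFiniteIntegral_iff_ofReal (Filter.Eventually.of_forall fun z => by positivity)]
  by_contra hc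
  rw [not_lt, top_le_iff] at hc
  rw [hc, ENNReal.mul_top (by simp [hδ])] at h3
  exact h3 rfl

/-- On a slab of half-width 2^{-(k₁+k₂)} both time cutoffs equal one. Plancherel and Cauchy-Schwarz
bound the product there in L¹, uniformly in the position of the slab. -/
theorem IsCutoff.isTemperedFun_mul {η₀ : ℝ → ℝ} (hη : IsCutoff η₀) {k₁ k₂ : ℕ} {u v : E3 → ℂ}
    (hu : MemF η₀ k₁ u) (hv : MemF η₀ k₂ v) : IsTemperedFun fun z => u z * v z := by
  have mu : AEStronglyMeasurable u volume := hu.1.1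
  have mv : AEStronglyMeasurable v volume := hv.1.1
  have hδ : (0 : ℝ) < (2 ^ (k₁ + k₂))⁻¹ := by positivity
  refine isTemperedFun_of_slab (mu.mul mv) hδ (inv_le_one_of_one_le₀ (one_le_pow₀ (by norm_num)))
    (B := normF η₀ k₁ (toTD u) * normF η₀ k₂ (toTD v)) (ENNReal.mul_ne_top hu.2.2.ne hv.2.2.ne)
    fun t₀ => ?_
  obtain ⟨gu, hgu⟩ := hη.exists_localizedFT hu t₀
  obtain ⟨gv, hgv⟩ := hη.exists_localizedFT hv t₀
  have one : ∀ k ≤ k₁ + k₂, ∀ z : E3, |z 2 - t₀| ≤ (2 ^ (k₁ + k₂))⁻¹ → timeCut η₀ k t₀ z = 1 := by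
    intro k hk z hz
    rw [timeCut, hη.eq_one_of_abs_le, Complex.ofReal_one]
    rw [abs_mul, abs_of_pos (by positivity)]
    calc (2 : ℝ) ^ k * |z 2 - t₀| ≤ 2 ^ (k₁ + k₂) * (2 ^ (k₁ + k₂))⁻¹ :=
          mul_le_mul (pow_le_pow_right₀ (by norm_num) hk) hz (abs_nonneg _) (by positivity)
      _ ≤ 5 / 4 := by rw [mul_inv_cancel₀ (by positivity)]; norm_num
  set U : E3 → ℂ := fun z => timeCut η₀ k₁ t₀ z * u z
  set V : E3 → ℂ := fun z => timeCut η₀ k₂ t₀ z * v z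
  have mU : AEStronglyMeasurable U volume := hgu.hasFT.left.1
  have mV : AEStronglyMeasurable V volume := hgv.hasFT.left.1
  have hU : eLpNorm U 2 volume ≤ normF η₀ k₁ (toTD u) :=
    (hgu.eLpNorm_le hη).trans (hgu.normX_le hη hu.1)
  have hV : eLpNorm V 2 volume ≤ normF η₀ k₂ (toTD v) :=
    (hgv.eLpNorm_le hη).trans (hgv.normX_le hη hv.1)
  calc ∫⁻ z in {z : E3 | |z 2 - t₀| ≤ (2 ^ (k₁ + k₂))⁻¹}, ‖u z * v z‖ₑ
      = ∫⁻ z in {z : E3 | |z 2 - t₀| ≤ (2 ^ (k₁ + k₂))⁻¹}, ‖U z * V z‖ₑ := by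
        refine setLIntegral_congr_fun (measurableSet_le (by fun_prop) (by fun_prop)) fun z hz => ?_
        simp only [U, V]
        rw [one k₁ (by omega) z hz, one k₂ (by omega) z hz, one_mul, one_mul]
    _ ≤ ∫⁻ z, ‖U z * V z‖ₑ := setLIntegral_le_lintegral _ _
    _ = eLpNorm (fun z => U z * V z) 1 volume := eLpNorm_one_eq_lintegral_enorm.symm
    _ ≤ eLpNorm U 2 volume * eLpNorm V 2 volume := by
        have h1 : eLpNorm (U • V) 1 volume ≤ eLpNorm U 2 volume * eLpNorm V 2 volume :=
          eLpNorm_smul_le_mul_eLpNorm mV mU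
        have e : (fun z => U z * V z) = U • V := by ext z; simp only [Pi.smul_apply', smul_eq_mul]
        rw [e]
        exact h1
    _ ≤ _ := mul_le_mul' hU hV

/-! ### The bilinear estimate -/

/-- The Fourier transform of one piece in time of a product. -/
theorem IsCutoff.hasFT_piece {η₀ : ℝ → ℝ} (hη : IsCutoff η₀) {k₁ k₂ : ℕ} (k₃ n : ℕ) {u v : E3 → ℂ}
    {t₀ t₁ : ℝ} {gu gv : E3 → ℂ} (hu : LocalizedFT η₀ k₁ u t₀ gu) (hv : LocalizedFT η₀ k₂ v t₁ gv) :
    HasFT (fun z => hη.pieceSchwartz n (2 ^ k₃ * (z 2 - t₀)) * (timeCut η₀ k₁ t₀ z * u z) *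
        (timeCut η₀ k₂ t₁ z * v z))
      (vconv (tconv (timeKernel (hη.pieceSchwartz n) k₃ t₀) fun ζ => gu ((2 * Real.pi) • ζ))
        fun ζ => gv ((2 * Real.pi) • ζ)) := by
  have iκ := integrable_timeKernel (hη.pieceSchwartz n) k₃ t₀
  have mκ := measurable_timeKernel (hη.pieceSchwartz n) k₃ t₀
  have hg : (fun z : E3 => hη.pieceSchwartz n (2 ^ k₃ * (z 2 - t₀))).HasTemperateGrowth := by
    have h2 : (fun z : E3 => z 2).HasTemperateGrowth :=
      (EuclideanSpace.proj (𝕜 := ℝ) (2 : Fin 3)).hasTemperateGrowth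
    exact (hη.pieceSchwartz n).hasTemperateGrowth.comp
      ((Function.HasTemperateGrowth.const _).mul (h2.sub (Function.HasTemperateGrowth.const _)))
  have h1 := hu.hasFT.timeMul (h := fun t => hη.pieceSchwartz n (2 ^ k₃ * (t - t₀))) (B := 1) iκ mκ
    (fun t => integral_timeKernel _ _ _ t) hg (fun t => by
      rw [hη.pieceSchwartz_apply, Complex.norm_real]
      exact hη.abs_cutPiece_le _ _) hu.measurable_dilate (hu.memLp hη)
  exact h1.mul hv.hasFT (measurable_tconv mκ hu.measurable_dilate) hv.measurable_dilate
    (memLp_tconv iκ mκ hu.measurable_dilate (hu.memLp hη)) (hv.memLp hη)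

theorem IsCutoff.enorm_piece_le {η₀ : ℝ → ℝ} (hη : IsCutoff η₀) {k₃ n : ℕ} {t₀ A : ℝ}
    (hA : ∀ s : ℝ, ‖timeKernel (hη.pieceSchwartz n) k₃ t₀ ((2 * Real.pi)⁻¹ * s)‖ₑ ≤
      ENNReal.ofReal A * kernelW k₃ s)
    {gu gv : E3 → ℂ} (hu : Measurable gu) (hv : Measurable gv) (ζ : E3) :
    ‖vconv (tconv (timeKernel (hη.pieceSchwartz n) k₃ t₀) fun ζ => gu ((2 * Real.pi) • ζ))
        (fun ζ => gv ((2 * Real.pi) • ζ)) ((2 * Real.pi)⁻¹ • ζ)‖ₑ ≤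
      ENNReal.ofReal A *
        lconv volume (tlconv (kernelW k₃) fun z => ‖gu z‖ₑ) (fun z => ‖gv z‖ₑ) ζ := by
  have mT : Measurable (tlconv (kernelW k₃) fun z => ‖gu z‖ₑ) :=
    measurable_tlconv (measurable_kernelW k₃) hu.enorm
  refine (enorm_vconv_le _ _ _).trans ((lconv_mono (enorm_tconv_dilate_le hA hu)
    (fun z => le_rfl) _).trans ((lconv_dilate_le
      (F := fun z => ENNReal.ofReal A * tlconv (kernelW k₃) (fun z => ‖gu z‖ₑ) z)
      (G := fun z => ‖gv z‖ₑ) (by fun_prop) hv.enorm ζ).trans (le_of_eq ?_)))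
  unfold lconv
  simp_rw [mul_assoc]
  exact lintegral_const_mul _ (by fun_prop)

/-- For each t₀ an explicit transform of the localized output is exhibited, so the infimum in
`normN` is bounded by its norm. Everything afterwards concerns absolute values only. -/
theorem IsCutoff.normN_product_le {η₀ : ℝ → ℝ} (hη : IsCutoff η₀) {A : ℕ → ℝ}
    (hA : ∀ n (K : ℕ) (t₀ s : ℝ), ‖timeKernel (hη.pieceSchwartz n) K t₀ ((2 * Real.pi)⁻¹ * s)‖ₑ ≤
      ENNReal.ofReal (A n) * kernelW K s) {k₁ k₂ k₃ : ℕ} (h₁ : k₁ + 5 ≤ k₃) (h₂ : k₂ ≤ k₃ + 5)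
    {u v : E3 → ℂ} (hu : MemF η₀ k₁ u) (hv : MemF η₀ k₂ v) :
    normN η₀ k₃ (proj η₀ k₃ (dx (toTD fun z => u z * v z))) ≤
      20 * (∑ n ∈ Finset.range 121, ENNReal.ofReal (A n)) *
        (655360 * (1 + k₁) * tw (-(k₁ : ℝ) / 2) *
          (normF η₀ k₁ (toTD u) * normF η₀ k₂ (toTD v))) := by
  refine iSup_le fun t₀ => ?_
  have hw := hη.isTemperedFun_mul hu hv
  obtain ⟨gu, hgu⟩ := hη.exists_localizedFT hu t₀
  choose gv hgv using fun n : ℕ => hη.exists_localizedFT hv (t₀ + (2 ^ k₃)⁻¹ * (((n : ℝ) - 59) / 32))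
  set P : ℕ → E3 → ℂ := fun n =>
    vconv (tconv (timeKernel (hη.pieceSchwartz n) k₃ t₀) fun ζ => gu ((2 * Real.pi) • ζ))
      fun ζ => gv n ((2 * Real.pi) • ζ) with hP
  have hFT : HasFT (fun z => timeCut η₀ k₃ t₀ z * (u z * v z))
      (fun ζ => ∑ n ∈ Finset.range 121, P n ζ) := by
    have e := fun z => hη.timeCut_mul_eq_sum h₁ h₂ t₀ (u z) (v z) z
    have hl := hη.isTemperedFun_timeCut_mul k₃ t₀ hw
    simp_rw [e] at hl ⊢
    refine HasFT.sum _ (fun n _ => hη.hasFT_piece k₃ n hgu (hgv n)) hl ?_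
    have hb : ∀ n ζ, ‖P n ζ‖ ≤ (l2 volume (fun w => ‖tconv (timeKernel (hη.pieceSchwartz n) k₃ t₀)
        (fun ζ => gu ((2 * Real.pi) • ζ)) w‖ₑ) * l2 volume
          (fun w => ‖gv n ((2 * Real.pi) • w)‖ₑ)).toReal := by
      intro n ζ
      have iκ := integrable_timeKernel (hη.pieceSchwartz n) k₃ t₀
      have mκ := measurable_timeKernel (hη.pieceSchwartz n) k₃ t₀
      rw [← toReal_enorm]
      exact ENNReal.toReal_mono (ENNReal.mul_ne_top
        (memLp_tconv iκ mκ hgu.measurable_dilate (hgu.memLp hη)).l2_ne_top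
        ((hgv n).memLp hη).l2_ne_top) ((enorm_vconv_le _ _ ζ).trans
          (lconv_le_l2 (measurable_tconv mκ hgu.measurable_dilate).enorm
            (hgv n).measurable_dilate.enorm ζ))
    refine IsTemperedFun.of_norm_le (Finset.measurable_fun_sum _ fun n _ =>
      measurable_vconv (measurable_tconv (measurable_timeKernel _ _ _) hgu.measurable_dilate)
        (hgv n).measurable_dilate).aestronglyMeasurable
      fun ζ => (norm_sum_le _ _).trans (Finset.sum_le_sum fun n _ => hb n ζ)
  refine iInf₂_le_of_le _ (hη.isFourierOf_output k₃ t₀ hw hFT) ?_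
  set L : ℕ → E3 → ℝ≥0∞ := fun n =>
    lconv volume (tlconv (kernelW k₃) fun z => ‖gu z‖ₑ) fun z => ‖gv n z‖ₑ with hL
  have mL : ∀ n, Measurable (L n) := fun n => measurable_lconv
    (measurable_tlconv (measurable_kernelW k₃) hgu.measurable.enorm) (hgv n).measurable.enorm
  have hout := hη.normX_resolvent_le k₃
    (G := fun ζ => Complex.I * ((ζ 0 * chi η₀ k₃ (ζ 0) : ℝ) : ℂ) *
      ∑ n ∈ Finset.range 121, P n ((2 * Real.pi)⁻¹ • ζ))
    (H := fun ζ => ∑ n ∈ Finset.range 121, ENNReal.ofReal (A n) * L n ζ) (by fun_prop)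
    (Filter.Eventually.of_forall fun ζ => by
      have hI : ‖Complex.I‖ₑ = 1 := by rw [← ofReal_norm, Complex.norm_I, ENNReal.ofReal_one]
      rw [enorm_mul, enorm_mul, hI, one_mul]
      refine mul_le_mul_right ((enorm_sum_le _ _).trans (Finset.sum_le_sum fun n _ => ?_)) _
      exact hη.enorm_piece_le (hA n k₃ t₀) hgu.measurable (hgv n).measurable ζ)
  refine hout.trans ?_
  rw [mul_assoc, Finset.sum_mul]
  refine mul_le_mul_right ((outputSum_finset_sum_le _ fun n => (mL n).const_mul _).trans
    (Finset.sum_le_sum fun n _ => ?_)) _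
  rw [outputSum_const_mul _ (mL n)]
  refine mul_le_mul_right ((hη.outputSum_lconv_le h₁ hgu.measurable (hgv n).measurable hgu.support
    hgu.normX_ne_top (hgv n).normX_ne_top).trans (mul_le_mul_right (mul_le_mul'
      (hgu.normX_le hη hu.1) ((hgv n).normX_le hη hv.1)) _)) _

end KPI

end

theorem mainTheorem3 (η₀ : ℝ → ℝ) (hη : KPI.IsCutoff η₀) :
    ∃ C : ℝ, 0 < C ∧
      ∀ k₁ k₂ k₃ : ℕ, 20 ≤ k₃ → |(k₂ : ℤ) - (k₃ : ℤ)| ≤ 5 → (k₁ : ℤ) ≤ (k₂ : ℤ) - 10 →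
        ∀ u v : KPI.E3 → ℂ, KPI.MemF η₀ k₁ u → KPI.MemF η₀ k₂ v →
          KPI.IsTemperedFun (fun z => u z * v z) ∧
          KPI.normN η₀ k₃ (KPI.proj η₀ k₃ (KPI.dx (KPI.toTD (fun z => u z * v z)))) ≤
            ENNReal.ofReal (C * (1 + (k₁ : ℝ)) * (2 : ℝ) ^ (-(k₁ : ℝ) / 2)) *
              KPI.normF η₀ k₁ (KPI.toTD u) * KPI.normF η₀ k₂ (KPI.toTD v) := by
  choose A hA0 hA using fun n => KPI.exists_enorm_timeKernel_le (hη.pieceSchwartz n)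
  have hsum : 0 ≤ ∑ n ∈ Finset.range 121, A n := Finset.sum_nonneg fun n _ => hA0 n
  -- 13107200 = 20·4096·160: resolvent, dyadic summation and time localization. The numbers A n
  -- depend only on η₀, and the added 1 ensures positivity.
  refine ⟨13107200 * (1 + ∑ n ∈ Finset.range 121, A n), by positivity,
    fun k₁ k₂ k₃ _ h23 h12 u v hu hv => ⟨hη.isTemperedFun_mul hu hv, ?_⟩⟩
  rw [abs_le] at h23
  -- The hypotheses give k₁ ≤ k₂-10 ≤ k₃-5, which is the separation of frequencies used in every
  -- estimate.
  refine (hη.normN_product_le hA (by omega) (by omega) hu hv).trans ?_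
  rw [ENNReal.ofReal_mul (by positivity), ENNReal.ofReal_mul (by positivity),
    KPI.ofReal_two_rpow, ENNReal.ofReal_mul (by norm_num),
    ← ENNReal.ofReal_sum_of_nonneg fun n _ => hA0 n,
    show ENNReal.ofReal (1 + (k₁ : ℝ)) = 1 + (k₁ : ENNReal) by
      rw [ENNReal.ofReal_add (by norm_num) (by positivity), ENNReal.ofReal_one,
        ENNReal.ofReal_natCast],
    show ENNReal.ofReal 13107200 = 20 * 655360 by norm_num]
  have h1 : ENNReal.ofReal (∑ n ∈ Finset.range 121, A n) ≤
      ENNReal.ofReal (1 + ∑ n ∈ Finset.range 121, A n) :=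
    ENNReal.ofReal_le_ofReal (by linarith)
  refine (mul_le_mul_left (mul_le_mul_right h1 20) _).trans (le_of_eq ?_)
  ring
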